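/- Let $X$ be a random vector of $\mathbb R^p$ and $g:\mathbb R^p\times\mathbb R^d\to\mathbb R$ a function such that $g(X,\cdot)$ is almost surely convex, for every $h\in\mathbb R^d$ the function $g(X,\cdot)$ is almost surely twice differentiable at $h$, and $G(h):=\mathbb E[g(X,h)]$ is well defined and finite for all $h$. Write $\nabla_h g,\nabla_h^2 g$ for the gradient and the Hessian of $g$ in its second variable. Let $\theta\in\mathbb R^d$ be the unique point with $\nabla G(\theta)=0$ (hence the minimizer of the convex function $G$). Let $\|\cdot\|$, $\|\cdot\|_{op}$, $\|\cdot\|_F$ denote the Euclidean, spectral and Frobenius norms. Assume: - (A1a) there is $C>0$ with $\mathbb E\|\nabla_h g(X,h)\|^2\le C(1+G(h)-G(\theta))$ for all $h\in\mathbb R^d$; - (A2) $G$ is twice continuously differentiable, $\nabla^2G(\theta)$ is positive definite, and there is $L>0$ with $\|\nabla^2G(h)\|_{op}\le L$ for all $h\in\mathbb R^d$; - (A3) there are $r,L_r>0$ with $\|\nabla^2G(h)-\nabla^2G(\theta)\|_{op}\le L_r\|\theta-h\|$ for all $h$ in the ball of radius $r$ centred at $\theta$; - (A4) there are $q>2$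 and $C_q$ with $\mathbb E\|\nabla_h^2g(X,h)\|_F^q\le C_q$ for all $h\in\mathbb R^d$. Let $(X_n)_{n\ge1}$ be i.i.d. with the law of $X$, and let $(Z_n)_{n\ge1}$ be i.i.d. bounded random vectors of $\mathbb R^d$ with $\mathbb E[Z_n]=0$ and $\mathbb E[Z_nZ_n^T]=I_d$, the sequence $(Z_n)$ being independent of $(X_n)$. Let $\tau,\tau'\ge0$ and, for $n\ge1$, $$\gamma_n=c_\gamma n^{-\gamma},\quad \beta_n=c_\beta n^{\beta},\quad \beta'_n=c'_{\beta}n^{\beta'},\quad \nu_n=c_\nu n^{-\nu},$$ with $c_\gamma,c_\beta,c'_\beta,c_\nu>0$, $\gamma\in(1/2,1)$, $$\tfrac{1-\gamma}{q-1}<\beta<\gamma-\tfrac12,\qquad \gamma+\nu>\tfrac32,\qquad \nu\in(\tfrac12,1-\beta),\qquad \beta'\in(1-\gamma,\gamma-2\beta),$$ and $\gamma_n^2\beta_n^2\beta'_n\le\gamma_n$ for all $n\ge1$. For $\sigma\ge0$ put $w_{n,\sigma}=(\ln(n+1))^{\sigma}/\sum_{k=0}^n(\ln(k+1))^{\sigma}$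 (with $0^0=1$), and let $\Pi_{r}$ be the projection of $d\times d$ matrices onto the Frobenius ball of radius $r$ centred at $0$. Starting from any $\theta_{0,\tau'}=\theta_0\in\mathbb R^d$ and any symmetric positive definite matrix $A_{0,\tau}=A_0$, define the Universal Weighted Averaged Stochastic Newton iterates for $n\ge1$ by $$P_n=A_{n-1}Z_n,\qquad Q_n=\nabla_h^2g(X_n,\theta_{n-1,\tau'})Z_n,$$ $$\theta_n=\theta_{n-1}-\nu_nA_{n-1,\tau}\nabla_hg(X_n,\theta_{n-1}),\qquad \theta_{n,\tau'}=(1-w_{n,\tau'})\theta_{n-1,\tau'}+w_{n,\tau'}\theta_n,$$ $$A_n=\Pi_{\beta'_n}\Big(A_{n-1}-\gamma_n\big(P_nQ_n^T+Q_nP_n^T-2I_d\big)\mathbf 1_{\{\|Q_n\|\|Z_n\|\le\beta_n\}}\Big),\qquad A_{n,\tau}=(1-w_{n,\tau})A_{n-1,\tau}+w_{n,\tau}A_n.$$ Then, as $n\to\infty$, $\theta_n\to\theta$ almost surely and $\theta_{n,\tau'}\to\theta$ almost surely. -/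

import Mathlib

open MeasureTheory ProbabilityTheory Filter Topology

noncomputable section

namespace USN

/-- The Euclidean space `ℝ^d` (with the Euclidean norm). -/
abbrev Vec (d : ℕ) : Type := EuclideanSpace ℝ (Fin d)

/-- Real `d × d` matrices. -/
abbrev Mat (d : ℕ) : Type := Matrix (Fin d) (Fin d) ℝ

/-! ### Gradients and Hessians -/

/-- The Hessian of `f` at `h`, as a linear operator: the derivative of `∇f` at `h`.
Its norm is the spectral norm. -/
def hessian {d : ℕ} (f : Vec d → ℝ) (h : Vec d) : Vec d →L[ℝ] Vec d :=
  fderiv ℝ (gradient f) h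

/-- The matrix of the Hessian in the canonical basis: the `(i, j)` entry is the derivative of
the `i`-th coordinate of `∇f` in the direction of the `j`-th basis vector. -/
def hessianMatrix {d : ℕ} (f : Vec d → ℝ) (h : Vec d) : Mat d :=
  Matrix.of fun i j => hessian f h (EuclideanSpace.single j 1) i

/-- `f` is twice differentiable at `h`: it is differentiable near `h` and its gradient is
differentiable at `h`. -/
def TwiceDifferentiableAt {d : ℕ} (f : Vec d → ℝ) (h : Vec d) : Prop :=
  (∀ᶠ k in 𝓝 h, DifferentiableAt ℝ f k) ∧ DifferentiableAt ℝ (gradient f) h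

/-! ### The minimization problem and its assumptions -/

section Problem

variable {Ω : Type*} [MeasurableSpace Ω]

/-- The objective `G(h) = E[g(X, h)]`. -/
def objective {p d : ℕ} (P : Measure Ω) (X : Ω → Vec p) (g : Vec p → Vec d → ℝ) (h : Vec d) : ℝ :=
  ∫ ω, g (X ω) h ∂P

/-- The general framework: a random vector `X`, a loss `g` such that `g(X, ·)` is convex and, for
each `h`, almost surely twice differentiable at `h`, with `G(h) = E[g(X, h)]` well defined, and
`θ` the unique zero of `∇G`. -/
structure Framework {p d : ℕ} (P : Measure Ω) (X : Ω → Vec p) (g : Vec p → Vec d → ℝ)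
    (θ : Vec d) : Prop where
  measurable_X : Measurable X
  measurable_g : Measurable fun y : Vec p × Vec d => g y.1 y.2
  measurable_gradient : Measurable fun y : Vec p × Vec d => gradient (g y.1) y.2
  measurable_hessian : ∀ i j, Measurable fun y : Vec p × Vec d => hessianMatrix (g y.1) y.2 i j
  integrable : ∀ h, Integrable (fun ω => g (X ω) h) P
  convex : ∀ᵐ ω ∂P, ConvexOn ℝ Set.univ (g (X ω))
  twiceDifferentiable : ∀ h, ∀ᵐ ω ∂P, TwiceDifferentiableAt (g (X ω)) h
  gradient_eq_zero_iff : ∀ h, gradient (objective P X g) h = 0 ↔ h = θ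

/-- There is `C > 0` with `E ‖∇_h g(X, h)‖² ≤ C (1 + G(h) - G(θ))` for all `h`. -/
def AssumptionA1a {p d : ℕ} (P : Measure Ω) (X : Ω → Vec p) (g : Vec p → Vec d → ℝ)
    (θ : Vec d) : Prop :=
  ∃ C : ℝ, 0 < C ∧ ∀ h : Vec d,
    Integrable (fun ω => ‖gradient (g (X ω)) h‖ ^ 2) P ∧
    ∫ ω, ‖gradient (g (X ω)) h‖ ^ 2 ∂P ≤ C * (1 + objective P X g h - objective P X g θ)

/-- `G` is twice continuously differentiable, `∇²G(θ)` is positive definite, and the operator norm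
of `∇²G` is bounded. -/
def AssumptionA2 {p d : ℕ} (P : Measure Ω) (X : Ω → Vec p) (g : Vec p → Vec d → ℝ)
    (θ : Vec d) : Prop :=
  ContDiff ℝ 2 (objective P X g) ∧
  (hessianMatrix (objective P X g) θ).PosDef ∧
  ∃ L : ℝ, 0 < L ∧ ∀ h : Vec d, ‖hessian (objective P X g) h‖ ≤ L

/-- `‖∇²G(h) - ∇²G(θ)‖ ≤ L ‖θ - h‖` on a ball around `θ` (operator norm on the left). -/
def AssumptionA3 {p d : ℕ} (P : Measure Ω) (X : Ω → Vec p) (g : Vec p → Vec d → ℝ)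
    (θ : Vec d) : Prop :=
  ∃ r L : ℝ, 0 < r ∧ 0 < L ∧ ∀ h ∈ Metric.ball θ r,
    ‖hessian (objective P X g) h - hessian (objective P X g) θ‖ ≤ L * ‖θ - h‖

open scoped Matrix.Norms.Frobenius in
/-- `E ‖∇²_h g(X, h)‖_F ^ q` is bounded uniformly in `h` (Frobenius norm). -/
def AssumptionA4 {p d : ℕ} (P : Measure Ω) (X : Ω → Vec p) (g : Vec p → Vec d → ℝ)
    (q : ℝ) : Prop :=
  ∃ C : ℝ, ∀ h : Vec d,
    Integrable (fun ω => ‖hessianMatrix (g (X ω)) h‖ ^ q) P ∧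
    ∫ ω, ‖hessianMatrix (g (X ω)) h‖ ^ q ∂P ≤ C

/-- The data fed to the algorithm; the terms of index `k` are the vectors `X_{k+1}`, `Z_{k+1}` used
in iteration `k + 1`. The `X`'s are i.i.d. with the law of `X`; the `Z`'s are i.i.d., bounded,
centred, with identity covariance; and the two sequences are independent. -/
structure IsSample {p d : ℕ} (P : Measure Ω) (X : Ω → Vec p) (Xs : ℕ → Ω → Vec p)
    (Zs : ℕ → Ω → Vec d) : Prop where
  measurable_X : ∀ k, Measurable (Xs k)
  measurable_Z : ∀ k, Measurable (Zs k)
  iIndep_X : iIndepFun Xs P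
  iIndep_Z : iIndepFun Zs P
  indep_XZ : IndepFun (fun ω k => Xs k ω) (fun ω k => Zs k ω) P
  identDistrib_X : ∀ k, IdentDistrib (Xs k) X P P
  identDistrib_Z : ∀ k, IdentDistrib (Zs k) (Zs 0) P P
  bounded_Z : ∃ M : ℝ, ∀ k, ∀ᵐ ω ∂P, ‖Zs k ω‖ ≤ M
  mean_Z : ∀ k, ∫ ω, Zs k ω ∂P = 0
  cov_Z : ∀ k i j, ∫ ω, Zs k ω i * Zs k ω j ∂P = (1 : Mat d) i j

end Problem

/-! ### The algorithm -/

/-- The parameters of the algorithm. -/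
structure Params where
  (cγ γ cβ β cβ' β' cν ν τ τ' : ℝ)

/-- `γ_n = c_γ n^{-γ}`. -/
def Params.gammaSeq (a : Params) (n : ℕ) : ℝ := a.cγ * (n : ℝ) ^ (-a.γ)

/-- `β_n = c_β n^β`. -/
def Params.betaSeq (a : Params) (n : ℕ) : ℝ := a.cβ * (n : ℝ) ^ a.β

/-- `β'_n = c_β' n^{β'}`. -/
def Params.betaSeq' (a : Params) (n : ℕ) : ℝ := a.cβ' * (n : ℝ) ^ a.β'

/-- `ν_n = c_ν n^{-ν}`. -/
def Params.nuSeq (a : Params) (n : ℕ) : ℝ := a.cν * (n : ℝ) ^ (-a.ν)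

/-- The averaging weight `ln(n+1)^τ / ∑_{k=0}^n ln(k+1)^τ` (powers of logarithms, `0 ^ 0 = 1`). -/
def avgWeight (τ : ℝ) (n : ℕ) : ℝ :=
  Real.log ((n : ℝ) + 1) ^ τ / ∑ k ∈ Finset.range (n + 1), Real.log ((k : ℝ) + 1) ^ τ

open scoped Matrix.Norms.Frobenius in
/-- The projection onto the closed ball of radius `r` about `0` for the Frobenius norm. -/
def frobProj {d : ℕ} (r : ℝ) (A : Mat d) : Mat d :=
  if ‖A‖ ≤ r then A else (r / ‖A‖) • A

/-- The quantities `θ_n`, `θ_{n,τ'}`, `A_n`, `A_{n,τ}`. -/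
structure State (d : ℕ) where
  theta : Vec d
  thetaAvg : Vec d
  A : Mat d
  AAvg : Mat d

/-- Iteration `n ≥ 1`: the state of index `n` from that of index `n - 1` and `x = X_n`,
`z = Z_n`. -/
def step {p d : ℕ} (g : Vec p → Vec d → ℝ) (a : Params) (n : ℕ) (x : Vec p) (z : Vec d)
    (s : State d) : State d :=
  let P : Vec d := WithLp.toLp 2 (s.A.mulVec z.ofLp)
  let Q : Vec d := WithLp.toLp 2 ((hessianMatrix (g x) s.thetaAvg).mulVec z.ofLp)
  let theta : Vec d :=
    s.theta - a.nuSeq n • WithLp.toLp 2 (s.AAvg.mulVec (gradient (g x) s.theta).ofLp)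
  let A : Mat d := frobProj (a.betaSeq' n)
    (s.A - (a.gammaSeq n * (if ‖Q‖ * ‖z‖ ≤ a.betaSeq n then 1 else 0)) •
      (Matrix.vecMulVec P.ofLp Q.ofLp + Matrix.vecMulVec Q.ofLp P.ofLp - (2 : ℝ) • (1 : Mat d)))
  { theta := theta
    thetaAvg := (1 - avgWeight a.τ' n) • s.thetaAvg + avgWeight a.τ' n • theta
    A := A
    AAvg := (1 - avgWeight a.τ n) • s.AAvg + avgWeight a.τ n • A }

/-- The Universal Weighted Averaged Stochastic Newton algorithm, started at `θ_0`, `A_0` (the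
averages start at `θ_{0,τ'} = θ_0`, `A_{0,τ} = A_0`) and run on the sequences `x k = X_{k+1}`,
`z k = Z_{k+1}`. -/
def iterate {p d : ℕ} (g : Vec p → Vec d → ℝ) (a : Params) (θ₀ : Vec d) (A₀ : Mat d)
    (x : ℕ → Vec p) (z : ℕ → Vec d) : ℕ → State d
  | 0 => ⟨θ₀, θ₀, A₀, A₀⟩
  | n + 1 => step g a (n + 1) (x n) (z n) (iterate g a θ₀ A₀ x z n)

end USN

end

/-! The algorithm is a stochastic gradient descent with the random preconditioner A_{n-1,τ}. Since G
is convex with a Lipschitz gradient, conditionally on the past the excess V_n = G(θ_n) - G(θ)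
satisfies E[V_{n+1}] ≤ (1 + c s_n) V_n + c s_n - ν_{n+1} ⟨∇G(θ_n), A_{n,τ} ∇G(θ_n)⟩, with s_n =
ν_{n+1}² ‖A_{n,τ}‖² (`Setting.excess_step`). The Robbins–Siegmund theorem
(`ae_tendsto_of_condExp_le`) then needs two facts about the matrices: s_n is almost surely summable,
and the smallest eigenvalue of A_{n,τ} is eventually at least a random positive multiple of 1/β_n.
Given these, V_n converges and the sum of (ν_{n+1}/β_n) ‖∇G(θ_n)‖² is finite. Since ν + β < 1, the
weights ν_{n+1}/β_n have infinite sum, so the gradients come arbitrarily close to 0. Convexity and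
uniqueness of the critical point turn this into θ_n → θ (`SmoothConvex.tendsto_of_frequently`), and
weighted Cesàro averaging transfers the limit (`tendsto_avg`).

Upper bound. As E[Z Zᵀ] = I and Hessians of convex functions are positive semidefinite, the linear
part of the update decreases ‖A_n‖² on average, up to a truncation error controlled by the moment of
order q and up to the term 2γ_n I. Hence the root mean square of ‖A_n‖ grows at most like the sum of
the γ_k, that is n^{1-γ} (`Setting.exists_integral_norm_sq_le`), and γ + ν > 3/2 makes the
expectations of s_n summable.

Lower bound. With T = 1 - γ_n Z_n Q_nᵀ, an untruncated update before projection is Tᵀ A T - γ_n² (Zᵀ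
A Z) Q Qᵀ + 2γ_n I, and γ_n² β_n² β'_n ≤ γ_n makes it at least Tᵀ A T + γ_n I as a quadratic form
(`quadForm_preA_ge`). Positivity therefore persists once ‖A_{n-1}‖ ≤ β'_n, but A_0 may violate this
at the first step, so A_1 can have negative eigenvalues. To recover, let M_n be the product of the
matrices T from step 2 on: A_n ≥ -σ_n M_nᵀ M_n, where σ_n decreases by a multiple of γ_n at every
untruncated step if the M_n are bounded. They are, almost surely, by Robbins–Siegmund applied to
‖M_n‖². So A_n becomes positive semidefinite in finite time (`MatrixRecursion.exists_nonneg`).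
Afterwards the gain of order γ_n balances the loss of order γ_n β_n λ on the smallest eigenvalue λ
at the level λ ~ 1/β_n (`MatrixRecursion.exists_quadForm_ge`). -/

noncomputable section

namespace USN

/-! ### Conditional bounds from independence, and the filtration of the data. -/

section Independence

variable {Ω : Type*} {m m0 : MeasurableSpace Ω} {P : Measure Ω}

/-- If `ξ` is independent of `m` and `S` is `m`-measurable, `E[f(S, ξ) | m]` is at most `R` as soon
as the integral of `f(S ω, ·)` against the law of `ξ` is at most `R ω` for every `ω`. -/
theorem condExp_le_of_indep [IsProbabilityMeasure P] (hm : m ≤ m0)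
    {E T : Type*} [MeasurableSpace E] [MeasurableSpace T] {ξ : Ω → E} (hξ : Measurable ξ)
    (hind : Indep m (MeasurableSpace.comap ξ inferInstance) P) {S : Ω → T} (hS : Measurable[m] S)
    {f : T → E → ℝ} (hf : Measurable fun y : T × E => f y.1 y.2) (hf0 : ∀ t y, 0 ≤ f t y)
    {R : Ω → ℝ} (hRi : Integrable R P)
    (h : ∀ ω, Integrable (f (S ω)) (P.map ξ) ∧ ∫ y, f (S ω) y ∂(P.map ξ) ≤ R ω) :
    Integrable (fun ω => f (S ω) (ξ ω)) P ∧
      (StronglyMeasurable[m] R → P[fun ω => f (S ω) (ξ ω) | m] ≤ᵐ[P] R) := by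
  have hS0 : Measurable S := hS.mono hm le_rfl
  have hfm : Measurable fun ω => f (S ω) (ξ ω) := hf.comp (hS0.prodMk hξ)
  have hR0 : ∀ ω, 0 ≤ R ω := fun ω => (integral_nonneg (hf0 (S ω))).trans (h ω).2
  have : IsProbabilityMeasure (P.map ξ) := Measure.isProbabilityMeasure_map hξ.aemeasurable
  have key : ∀ s, MeasurableSet[m] s →
      ∫⁻ ω in s, ENNReal.ofReal (f (S ω) (ξ ω)) ∂P ≤ ∫⁻ ω in s, ENNReal.ofReal (R ω) ∂P := by
    intro s hs
    have hs0 : MeasurableSet s := hm s hs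
    -- Carrying the indicator of `s` along with `S` keeps the pair `m`-measurable, hence independent
    -- of `ξ`. The integral over `s` becomes one against a product law, to which Tonelli applies.
    let W : Ω → ENNReal × T := fun ω => (s.indicator 1 ω, S ω)
    have hWm : Measurable[m] W := by
      refine Measurable.prodMk ?_ hS
      exact Measurable.indicator (m := m) (@measurable_one _ _ _ m _) hs
    have hW : Measurable W := hWm.mono hm le_rfl
    have hWξ : IndepFun W ξ P := by
      rw [IndepFun_iff_Indep]
      exact indep_of_indep_of_le_left hind hWm.comap_le
    have hmap := (indepFun_iff_map_prod_eq_prod_map_map hW.aemeasurable hξ.aemeasurable).1 hWξ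
    have hmeas : Measurable fun y : (ENNReal × T) × E => y.1.1 * ENNReal.ofReal (f y.1.2 y.2) := by
      refine (measurable_fst.comp measurable_fst).mul (ENNReal.measurable_ofReal.comp ?_)
      exact hf.comp ((measurable_snd.comp measurable_fst).prodMk measurable_snd)
    have h1 : ∫⁻ ω in s, ENNReal.ofReal (f (S ω) (ξ ω)) ∂P
        = ∫⁻ ω, (W ω).1 * ENNReal.ofReal (f (W ω).2 (ξ ω)) ∂P := by
      rw [← lintegral_indicator hs0]
      refine lintegral_congr fun ω => ?_
      by_cases hω : ω ∈ s <;> simp [W, hω]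
    have h2 : ∫⁻ ω, (W ω).1 * ENNReal.ofReal (f (W ω).2 (ξ ω)) ∂P
        = ∫⁻ ω, (∫⁻ y, (W ω).1 * ENNReal.ofReal (f (W ω).2 y) ∂(P.map ξ)) ∂P := by
      rw [← lintegral_map (f := fun y : (ENNReal × T) × E => y.1.1 * ENNReal.ofReal (f y.1.2 y.2))
        (g := fun ω => (W ω, ξ ω)) hmeas (hW.prodMk hξ), hmap,
        lintegral_prod _ hmeas.aemeasurable, lintegral_map hmeas.lintegral_prod_right' hW]
    rw [h1, h2, ← lintegral_indicator hs0]
    refine lintegral_mono fun ω => ?_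
    have hfω : Measurable (f (S ω)) := hf.comp measurable_prodMk_left
    by_cases hω : ω ∈ s
    · simp only [W, hω, Set.indicator_of_mem, Pi.one_apply, one_mul]
      rw [← ofReal_integral_eq_lintegral_ofReal (h ω).1 (Eventually.of_forall (hf0 _))]
      exact ENNReal.ofReal_le_ofReal (h ω).2
    · simp [W, hω]
  have hint : Integrable (fun ω => f (S ω) (ξ ω)) P := by
    refine ⟨hfm.aestronglyMeasurable, ?_⟩
    rw [hasFiniteIntegral_iff_ofReal (Eventually.of_forall fun ω => hf0 _ _)]
    have := key Set.univ MeasurableSet.univ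
    rw [Measure.restrict_univ] at this
    refine this.trans_lt ?_
    rw [← hasFiniteIntegral_iff_ofReal (Eventually.of_forall hR0)]
    exact hRi.2
  refine ⟨hint, fun hRm => ?_⟩
  have hcm : StronglyMeasurable[m] (P[fun ω => f (S ω) (ξ ω) | m]) := stronglyMeasurable_condExp
  -- Both sides are `m`-measurable, so the comparison may be made for the measure trimmed to `m`,
  -- where only integrals over sets of `m` matter.
  refine ae_le_of_ae_le_trim (hm := hm) ?_
  refine ae_le_of_forall_setIntegral_le (integrable_condExp.trim hm hcm) (hRi.trim hm hRm) ?_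
  intro s hs _
  rw [← setIntegral_trim hm hcm hs, ← setIntegral_trim hm hRm hs, setIntegral_condExp hm hint hs]
  have e1 := integral_eq_lintegral_of_nonneg_ae (μ := P.restrict s)
    (Eventually.of_forall fun ω => hf0 (S ω) (ξ ω)) hfm.aestronglyMeasurable
  have e2 := integral_eq_lintegral_of_nonneg_ae (μ := P.restrict s)
    (Eventually.of_forall hR0) (hRm.mono hm).aestronglyMeasurable
  rw [e1, e2]
  refine ENNReal.toReal_mono ?_ (key s hs)
  have := hRi.restrict (s := s)
  have h3 := (hasFiniteIntegral_iff_ofReal (Eventually.of_forall hR0)).1 this.2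
  exact h3.ne

/-- The same bound for expectations. -/
theorem integral_le_of_indep [IsProbabilityMeasure P] (hm : m ≤ m0)
    {E T : Type*} [MeasurableSpace E] [MeasurableSpace T] {ξ : Ω → E} (hξ : Measurable ξ)
    (hind : Indep m (MeasurableSpace.comap ξ inferInstance) P) {S : Ω → T} (hS : Measurable[m] S)
    {f : T → E → ℝ} (hf : Measurable fun y : T × E => f y.1 y.2) (hf0 : ∀ t y, 0 ≤ f t y)
    {R : Ω → ℝ} (hRi : Integrable R P) (hRm : StronglyMeasurable[m] R)
    (h : ∀ ω, Integrable (f (S ω)) (P.map ξ) ∧ ∫ y, f (S ω) y ∂(P.map ξ) ≤ R ω) :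
    Integrable (fun ω => f (S ω) (ξ ω)) P ∧ ∫ ω, f (S ω) (ξ ω) ∂P ≤ ∫ ω, R ω ∂P := by
  obtain ⟨h1, h2⟩ := condExp_le_of_indep hm hξ hind hS hf hf0 hRi h
  refine ⟨h1, ?_⟩
  rw [← integral_condExp hm (f := fun ω => f (S ω) (ξ ω))]
  exact integral_mono_ae integrable_condExp hRi (h2 hRm)

/-- Nonnegative random variables with summable expectations are almost surely summable. -/
theorem ae_summable_of_integral_le {f : ℕ → Ω → ℝ} (hf0 : ∀ n ω, 0 ≤ f n ω)
    (hf : ∀ n, Integrable (f n) P) {c : ℕ → ℝ} (hc : Summable c) (h : ∀ n, ∫ ω, f n ω ∂P ≤ c n) :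
    ∀ᵐ ω ∂P, Summable fun n => f n ω := by
  have hs : Summable fun n => ∫ ω, f n ω ∂P :=
    hc.of_nonneg_of_le (fun n => integral_nonneg (hf0 n)) h
  have hm : ∀ n, AEMeasurable (fun ω => ENNReal.ofReal (f n ω)) P := fun n =>
    (hf n).aestronglyMeasurable.aemeasurable.ennreal_ofReal
  have hfin : ∫⁻ ω, ∑' n, ENNReal.ofReal (f n ω) ∂P ≠ ⊤ := by
    rw [lintegral_tsum hm]
    have : ∀ n, ∫⁻ ω, ENNReal.ofReal (f n ω) ∂P = ENNReal.ofReal (∫ ω, f n ω ∂P) := fun n =>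
      (ofReal_integral_eq_lintegral_ofReal (hf n) (Eventually.of_forall (hf0 n))).symm
    simp_rw [this]
    exact hs.tsum_ofReal_ne_top
  filter_upwards [ae_lt_top' (AEMeasurable.tsum hm) hfin] with ω hω
  have := ENNReal.summable_toReal hω.ne
  exact this.congr fun n => ENNReal.toReal_ofReal (hf0 n ω)

/-- The past of a sequence of random variables: `past n` is generated by the terms of index less
than `n`. -/
def past {E : Type*} [mE : MeasurableSpace E] (ξ : ℕ → Ω → E) (hξ : ∀ k, Measurable (ξ k)) :
    Filtration ℕ m0 where
  seq n := ⨆ k ∈ Set.Iio n, MeasurableSpace.comap (ξ k) mE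
  mono' _ _ hij := biSup_mono fun _ hk => lt_of_lt_of_le hk hij
  le' _ := iSup₂_le fun k _ => (hξ k).comap_le

theorem measurable_past {E : Type*} [mE : MeasurableSpace E] {ξ : ℕ → Ω → E}
    (hξ : ∀ k, Measurable (ξ k)) {k n : ℕ} (hk : k < n) : Measurable[past ξ hξ n] (ξ k) := by
  have : MeasurableSpace.comap (ξ k) mE ≤ past ξ hξ n :=
    le_iSup₂_of_le (f := fun k (_ : k ∈ Set.Iio n) => MeasurableSpace.comap (ξ k) mE) k hk le_rfl
  exact (comap_measurable (ξ k)).mono this le_rfl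

theorem indep_past {E : Type*} [mE : MeasurableSpace E] {ξ : ℕ → Ω → E}
    (hξ : ∀ k, Measurable (ξ k)) (hind : iIndepFun ξ P) (n : ℕ) :
    Indep (past ξ hξ n) (MeasurableSpace.comap (ξ n) mE) P := by
  have h := indep_iSup_of_disjoint (fun k => (hξ k).comap_le) hind.iIndep
    (S := Set.Iio n) (T := {n}) (by simp)
  rw [iSup_singleton] at h
  exact h

/-- Two independent families of independent random variables can be paired. -/
theorem iIndepFun_prodMk_of_indepFun [IsProbabilityMeasure P] {E F : Type*} [mE : MeasurableSpace E]
    [mF : MeasurableSpace F] {X : ℕ → Ω → E} {Z : ℕ → Ω → F} (hX : ∀ k, Measurable (X k))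
    (hZ : ∀ k, Measurable (Z k)) (iX : iIndepFun X P) (iZ : iIndepFun Z P)
    (hXZ : IndepFun (fun ω k => X k ω) (fun ω k => Z k ω) P) :
    iIndepFun (fun k ω => (X k ω, Z k ω)) P := by
  -- Rectangles form a π-system generating the σ-algebra of the pair, and on them independence is
  -- the product formula `hbox`.
  let π : ℕ → Set (Set Ω) := fun k =>
    {s | ∃ A B, MeasurableSet A ∧ MeasurableSet B ∧ s = X k ⁻¹' A ∩ Z k ⁻¹' B}
  have hbox : ∀ (s : Finset ℕ) (A : ℕ → Set E) (B : ℕ → Set F), (∀ k, MeasurableSet (A k)) →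
      (∀ k, MeasurableSet (B k)) → P (⋂ k ∈ s, (X k ⁻¹' A k ∩ Z k ⁻¹' B k))
        = (∏ k ∈ s, P (X k ⁻¹' A k)) * ∏ k ∈ s, P (Z k ⁻¹' B k) := by
    intro s A B hA hB
    have e : (⋂ k ∈ s, (X k ⁻¹' A k ∩ Z k ⁻¹' B k))
        = (fun ω k => X k ω) ⁻¹' (⋂ k ∈ s, (fun x : ℕ → E => x k) ⁻¹' A k)
          ∩ (fun ω k => Z k ω) ⁻¹' (⋂ k ∈ s, (fun x : ℕ → F => x k) ⁻¹' B k) := by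
      ext ω
      simp only [Set.mem_iInter, Set.mem_inter_iff, Set.mem_preimage]
      exact ⟨fun h => ⟨fun k hk => (h k hk).1, fun k hk => (h k hk).2⟩,
        fun h k hk => ⟨h.1 k hk, h.2 k hk⟩⟩
    rw [e, hXZ.measure_inter_preimage_eq_mul]
    · congr 1
      · rw [← iX.meas_biInter (S := s) (s := fun k => X k ⁻¹' A k)
          (fun k _ => ⟨A k, hA k, rfl⟩)]
        congr 1
        ext ω
        simp
      · rw [← iZ.meas_biInter (S := s) (s := fun k => Z k ⁻¹' B k)
          (fun k _ => ⟨B k, hB k, rfl⟩)]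
        congr 1
        ext ω
        simp
    · exact Finset.measurableSet_biInter _ fun k _ => measurable_pi_apply k (hA k)
    · exact Finset.measurableSet_biInter _ fun k _ => measurable_pi_apply k (hB k)
  refine (iIndepSets.iIndep (m := fun k => MeasurableSpace.comap (fun ω => (X k ω, Z k ω)) inferInstance)
    (fun k => ((hX k).prodMk (hZ k)).comap_le) π ?_ ?_ ?_ : _)
  · rintro k _ ⟨A, B, hA, hB, rfl⟩ _ ⟨A', B', hA', hB', rfl⟩ _
    refine ⟨A ∩ A', B ∩ B', hA.inter hA', hB.inter hB', ?_⟩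
    ext ω
    simp only [Set.mem_inter_iff, Set.mem_preimage]
    tauto
  · intro k
    rw [← generateFrom_prod, MeasurableSpace.comap_generateFrom]
    congr 1
    ext s
    constructor
    · rintro ⟨_, ⟨A, hA, B, hB, rfl⟩, rfl⟩
      exact ⟨A, B, hA, hB, rfl⟩
    · rintro ⟨A, B, hA, hB, rfl⟩
      exact ⟨A ×ˢ B, ⟨A, hA, B, hB, rfl⟩, rfl⟩
  · rw [iIndepSets_iff]
    intro s f hf
    have hf' : ∀ k, ∃ A B, MeasurableSet A ∧ MeasurableSet B ∧
        (k ∈ s → f k = X k ⁻¹' A ∩ Z k ⁻¹' B) := by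
      intro k
      by_cases hk : k ∈ s
      · obtain ⟨A, B, hA, hB, e⟩ := hf k hk
        exact ⟨A, B, hA, hB, fun _ => e⟩
      · exact ⟨∅, ∅, MeasurableSet.empty, MeasurableSet.empty, fun h => absurd h hk⟩
    choose A B hA hB hAB using hf'
    have e1 : (⋂ k ∈ s, f k) = ⋂ k ∈ s, (X k ⁻¹' A k ∩ Z k ⁻¹' B k) :=
      Set.iInter₂_congr fun k hk => hAB k hk
    rw [e1, hbox s A B hA hB, ← Finset.prod_mul_distrib]
    refine Finset.prod_congr rfl fun k hk => ?_
    have := hbox {k} A B hA hB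
    simp only [Finset.mem_singleton, Set.iInter_iInter_eq_left, Finset.prod_singleton] at this
    rw [hAB k hk, this]

end Independence

end USN
end

noncomputable section

namespace USN

/-! ### Almost supermartingales. -/

section RobbinsSiegmund

variable {Ω : Type*} {m0 : MeasurableSpace Ω} {P : Measure Ω} {F : Filtration ℕ m0}

/-- A supermartingale that is bounded below by a constant converges almost surely. -/
theorem ae_tendsto_of_supermartingale_of_le [IsProbabilityMeasure P] {U : ℕ → Ω → ℝ}
    (hU : Supermartingale U F P) {K : ℝ} (hK : ∀ n ω, -K ≤ U n ω) :
    ∀ᵐ ω ∂P, ∃ l, Tendsto (fun n => U n ω) atTop (𝓝 l) := by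
  -- From `U ≥ -K` follows `|U| ≤ U + 2|K|`, and expectations of a supermartingale decrease; this is
  -- the L¹ bound required by Doob's theorem.
  have hbd : ∀ n, eLpNorm ((-U) n) 1 P ≤ (Real.toNNReal (∫ ω, U 0 ω ∂P + 2 * |K|) : ENNReal) := by
    intro n
    have hi : Integrable (U n) P := hU.integrable n
    rw [eLpNorm_one_eq_lintegral_enorm]
    have e : ∀ ω, ‖(-U) n ω‖ₑ = ENNReal.ofReal |U n ω| := fun ω => by
      rw [Pi.neg_apply, Pi.neg_apply, enorm_neg, Real.enorm_eq_ofReal_abs]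
    simp_rw [e]
    rw [← ofReal_integral_eq_lintegral_ofReal hi.abs (Eventually.of_forall fun ω => abs_nonneg _)]
    refine ENNReal.ofReal_le_ofReal ?_
    have h1 : ∫ ω, |U n ω| ∂P ≤ ∫ ω, (U n ω + 2 * |K|) ∂P := by
      refine integral_mono hi.abs (hi.add (integrable_const _)) fun ω => ?_
      have h2 := hK n ω
      have h3 := le_abs_self K
      have h4 := abs_nonneg K
      simp only
      rcases abs_cases (U n ω) with h | h <;> rw [h.1] <;> linarith
    rw [integral_add hi (integrable_const _)] at h1
    have h2 : ∫ ω, U n ω ∂P ≤ ∫ ω, U 0 ω ∂P := by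
      have := hU.setIntegral_le (Nat.zero_le n) (s := Set.univ) MeasurableSet.univ
      simpa using this
    simp only [integral_const, probReal_univ, smul_eq_mul, one_mul] at h1
    linarith
  filter_upwards [hU.neg.exists_ae_tendsto_of_bdd hbd] with ω hω
  obtain ⟨c, hc⟩ := hω
  exact ⟨-c, by simpa using hc.neg⟩

/-- As `v ≥ 0`, the nondecreasing sums `s` are bounded by any bound of `v + s`, so they converge by
themselves and `v` converges by difference. -/
theorem exists_tendsto_of_add_monotone {v s : ℕ → ℝ} (hv : ∀ n, 0 ≤ v n) {c : ℕ → ℝ}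
    (hc : ∀ n, 0 ≤ c n) {l : ℝ} (hs : ∀ n, s n = ∑ k ∈ Finset.range n, c k)
    (h : Tendsto (fun n => v n + s n) atTop (𝓝 l)) :
    (∃ l', Tendsto v atTop (𝓝 l')) ∧ Summable c := by
  obtain ⟨B, hB⟩ := h.bddAbove_range
  have hsum : Summable c := by
    refine summable_of_sum_range_le hc (c := B) fun n => ?_
    have := hB ⟨n, rfl⟩
    simp only [hs] at this
    linarith [hv n]
  refine ⟨⟨l - ∑' k, c k, ?_⟩, hsum⟩
  have h2 : Tendsto s atTop (𝓝 (∑' k, c k)) :=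
    (hsum.hasSum.tendsto_sum_nat).congr fun n => (hs n).symm
  exact (h.sub h2).congr fun n => by ring

/-- The Robbins–Siegmund theorem without multiplicative perturbation. -/
theorem ae_tendsto_of_condExp_le_add_sub [IsProbabilityMeasure P] {V b c : ℕ → Ω → ℝ}
    (hV0 : ∀ n ω, 0 ≤ V n ω) (hb0 : ∀ n ω, 0 ≤ b n ω) (hc0 : ∀ n ω, 0 ≤ c n ω)
    (hVm : ∀ n, StronglyMeasurable[F n] (V n)) (hbm : ∀ n, StronglyMeasurable[F n] (b n))
    (hcm : ∀ n, StronglyMeasurable[F n] (c n)) (hVi : ∀ n, Integrable (V n) P)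
    (hbi : ∀ n, Integrable (b n) P) (hci : ∀ n, Integrable (c n) P)
    (h : ∀ n, P[V (n + 1) | F n] ≤ᵐ[P] fun ω => V n ω + b n ω - c n ω)
    (hb : ∀ᵐ ω ∂P, Summable fun n => b n ω) :
    ∀ᵐ ω ∂P, (∃ l, Tendsto (fun n => V n ω) atTop (𝓝 l)) ∧ Summable fun n => c n ω := by
  classical
  let B : ℕ → Ω → ℝ := fun n ω => ∑ k ∈ Finset.range n, b k ω
  have hBm : ∀ n, StronglyMeasurable[F n] (B (n + 1)) := fun n =>
    Finset.stronglyMeasurable_fun_sum _ fun k hk =>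
      (hbm k).mono (F.mono (Nat.lt_succ_iff.1 (Finset.mem_range.1 hk)))
  have hBmono : ∀ n ω, B n ω ≤ B (n + 1) ω := fun n ω => by
    simp only [B, Finset.sum_range_succ]
    linarith [hb0 n ω]
  have key : ∀ K : ℕ, ∀ᵐ ω ∂P, (∀ n, B n ω ≤ K) →
      (∃ l, Tendsto (fun n => V n ω) atTop (𝓝 l)) ∧ Summable fun n => c n ω := by
    intro K
    -- Localization: `b` is summable only pathwise, so its sum need not be integrable. The sum `B (n
    -- + 1)` ends with `b n`, so `A (n + 1)` is known at time `n`; on these decreasing sets the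
    -- perturbation totals at most `K`, and letting `K` run over the integers covers almost every
    -- path.
    let A : ℕ → Set Ω := fun n => {ω | B n ω ≤ K}
    have hAm : ∀ n, MeasurableSet[F n] (A (n + 1)) := fun n =>
      (hBm n).measurable (measurableSet_Iic (a := (K : ℝ)))
    have hA0 : A 0 = Set.univ := by
      ext ω
      simp [A, B]
    have hAm' : ∀ n, MeasurableSet[F n] (A n) := by
      rintro (_ | n)
      · rw [hA0]; exact MeasurableSet.univ
      · exact F.mono n.le_succ _ (hAm n)
    have hAanti : ∀ n, A (n + 1) ⊆ A n := fun n ω hω => (hBmono n ω).trans hω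
    let U : ℕ → Ω → ℝ := fun n ω => (A n).indicator (V n) ω
      + ∑ k ∈ Finset.range n, (A (k + 1)).indicator (fun ω => c k ω - b k ω) ω
    have hAmeas : ∀ n, MeasurableSet (A n) := fun n => F.le n _ (hAm' n)
    have hcb : ∀ k, Integrable ((A (k + 1)).indicator (fun ω => c k ω - b k ω)) P := fun k =>
      ((hci k).sub (hbi k)).indicator (hAmeas (k + 1))
    have hSi : ∀ n, Integrable (fun ω => ∑ k ∈ Finset.range n,
        (A (k + 1)).indicator (fun ω => c k ω - b k ω) ω) P := fun n =>
      integrable_finsetSum _ fun k _ => hcb k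
    have hSm : ∀ n, StronglyMeasurable[F n] (fun ω => ∑ k ∈ Finset.range (n + 1),
        (A (k + 1)).indicator (fun ω => c k ω - b k ω) ω) := fun n =>
      Finset.stronglyMeasurable_fun_sum _ fun k hk =>
        ((((hcm k).sub (hbm k)).indicator (hAm k)).mono
          (F.mono (Nat.lt_succ_iff.1 (Finset.mem_range.1 hk))))
    have hSm' : ∀ n, StronglyMeasurable[F n] (fun ω => ∑ k ∈ Finset.range n,
        (A (k + 1)).indicator (fun ω => c k ω - b k ω) ω) := by
      rintro (_ | n)
      · simpa using stronglyMeasurable_const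
      · exact (hSm n).mono (F.mono n.le_succ)
    have hU : Supermartingale U F P := by
      refine supermartingale_nat (fun n => ((hVm n).indicator (hAm' n)).add (hSm' n))
        (fun n => ((hVi n).indicator (hAmeas n)).add (hSi n)) fun n => ?_
      have e : U (n + 1) = (A (n + 1)).indicator (V (n + 1)) + fun ω => ∑ k ∈ Finset.range (n + 1),
        (A (k + 1)).indicator (fun ω => c k ω - b k ω) ω := rfl
      have h1 : P[U (n + 1) | F n] =ᵐ[P] P[(A (n + 1)).indicator (V (n + 1)) | F n]
          + P[fun ω => ∑ k ∈ Finset.range (n + 1),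
            (A (k + 1)).indicator (fun ω => c k ω - b k ω) ω | F n] := by
        rw [e]
        exact condExp_add ((hVi _).indicator (hAmeas _)) (hSi _) _
      have h2 : P[(A (n + 1)).indicator (V (n + 1)) | F n] =ᵐ[P]
          (A (n + 1)).indicator (P[V (n + 1) | F n]) := condExp_indicator (hVi _) (hAm n)
      have h3 := condExp_of_stronglyMeasurable (F.le n) (hSm n) (hSi (n + 1))
      rw [h3] at h1
      filter_upwards [h1, h2, h n] with ω g1 g2 g3
      rw [g1, Pi.add_apply, g2]
      simp only [U, Finset.sum_range_succ]
      by_cases hω : ω ∈ A (n + 1)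
      · have hω' := hAanti n hω
        simp only [Set.indicator_of_mem, hω, hω']
        linarith
      · simp only [Set.indicator_of_notMem, hω, not_false_eq_true]
        have : 0 ≤ (A n).indicator (V n) ω := Set.indicator_nonneg (fun ω _ => hV0 n ω) ω
        linarith
    have hlow : ∀ n ω, -(K : ℝ) ≤ U n ω := by
      intro n ω
      have h1 : 0 ≤ (A n).indicator (V n) ω := Set.indicator_nonneg (fun ω _ => hV0 n ω) ω
      -- Either `ω` is still in `A (n + 1)` and the whole sum is at most `B (n + 1) ω ≤ K`, or the
      -- last term vanishes and the previous bound applies.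
      have h2 : ∀ n, -(K : ℝ) ≤ ∑ k ∈ Finset.range n, -((A (k + 1)).indicator (b k) ω) := by
        intro n
        induction n with
        | zero => simp
        | succ n ih =>
          by_cases hω : ω ∈ A (n + 1)
          · have : ∑ k ∈ Finset.range (n + 1), (A (k + 1)).indicator (b k) ω ≤ B (n + 1) ω :=
              Finset.sum_le_sum fun k _ => Set.indicator_le_self' (fun ω _ => hb0 k ω) ω
            rw [Finset.sum_neg_distrib]
            have : B (n + 1) ω ≤ K := hω
            linarith
          · rw [Finset.sum_range_succ, Set.indicator_of_notMem hω]
            simpa using ih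
      have h3 : ∑ k ∈ Finset.range n, -((A (k + 1)).indicator (b k) ω)
          ≤ ∑ k ∈ Finset.range n, (A (k + 1)).indicator (fun ω => c k ω - b k ω) ω := by
        refine Finset.sum_le_sum fun k _ => ?_
        by_cases hω : ω ∈ A (k + 1)
        · simp only [Set.indicator_of_mem, hω]
          linarith [hc0 k ω]
        · simp [Set.indicator_of_notMem, hω]
      have := h2 n
      simp only [U]
      linarith
    filter_upwards [ae_tendsto_of_supermartingale_of_le hU hlow, hb] with ω hω hbω hBω
    obtain ⟨l, hl⟩ := hω
    have hmem : ∀ n, ω ∈ A n := hBω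
    have hBt : Tendsto (fun n => B n ω) atTop (𝓝 (∑' k, b k ω)) := hbω.hasSum.tendsto_sum_nat
    refine exists_tendsto_of_add_monotone (fun n => hV0 n ω) (fun n => hc0 n ω) (fun n => rfl)
      ((hl.add hBt).congr fun n => ?_)
    simp only [U, B, Set.indicator_of_mem, hmem, Finset.sum_sub_distrib]
    ring
  have key' := ae_all_iff.2 key
  filter_upwards [key', hb] with ω h1 h2
  obtain ⟨K, hK⟩ := exists_nat_ge (∑' k, b k ω)
  exact h1 K fun n => (h2.sum_le_tsum _ fun k _ => hb0 k ω).trans hK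

/-- The Robbins–Siegmund theorem. -/
theorem ae_tendsto_of_condExp_le [IsProbabilityMeasure P] {V a b c : ℕ → Ω → ℝ}
    (hV0 : ∀ n ω, 0 ≤ V n ω) (ha0 : ∀ n ω, 0 ≤ a n ω) (hb0 : ∀ n ω, 0 ≤ b n ω)
    (hc0 : ∀ n ω, 0 ≤ c n ω)
    (hVm : ∀ n, StronglyMeasurable[F n] (V n)) (ham : ∀ n, StronglyMeasurable[F n] (a n))
    (hbm : ∀ n, StronglyMeasurable[F n] (b n)) (hcm : ∀ n, StronglyMeasurable[F n] (c n))
    (hVi : ∀ n, Integrable (V n) P) (hbi : ∀ n, Integrable (b n) P) (hci : ∀ n, Integrable (c n) P)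
    (h : ∀ n, P[V (n + 1) | F n] ≤ᵐ[P] fun ω => (1 + a n ω) * V n ω + b n ω - c n ω)
    (ha : ∀ᵐ ω ∂P, Summable fun n => a n ω) (hb : ∀ᵐ ω ∂P, Summable fun n => b n ω) :
    ∀ᵐ ω ∂P, (∃ l, Tendsto (fun n => V n ω) atTop (𝓝 l)) ∧ Summable fun n => c n ω := by
  -- Discounting by the predictable product of the factors `1 + a k` removes the multiplicative
  -- perturbation. Since `D (n + 1) (1 + a n) = D n`, the process `D n * V n` falls under the
  -- previous case.
  let D : ℕ → Ω → ℝ := fun n ω => ∏ k ∈ Finset.range n, (1 + a k ω)⁻¹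
  have hD0 : ∀ n ω, 0 < D n ω := fun n ω =>
    Finset.prod_pos fun k _ => inv_pos.2 (by linarith [ha0 k ω])
  have hD1 : ∀ n ω, D n ω ≤ 1 := fun n ω =>
    Finset.prod_le_one (fun k _ => (inv_pos.2 (by linarith [ha0 k ω])).le)
      fun k _ => inv_le_one_of_one_le₀ (by linarith [ha0 k ω])
  have hDs : ∀ n ω, D (n + 1) ω * (1 + a n ω) = D n ω := fun n ω => by
    have : (1 + a n ω) ≠ 0 := by linarith [ha0 n ω]
    simp only [D, Finset.prod_range_succ]
    field_simp
  have hDanti : ∀ n ω, D (n + 1) ω ≤ D n ω := fun n ω => by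
    rw [← hDs n ω]
    nlinarith [ha0 n ω, hD0 (n + 1) ω]
  have hDm : ∀ n, StronglyMeasurable[F n] (D (n + 1)) := fun n =>
    Finset.stronglyMeasurable_fun_prod _ fun k hk =>
      ((stronglyMeasurable_const.add (ham k)).measurable.inv.stronglyMeasurable).mono
        (F.mono (Nat.lt_succ_iff.1 (Finset.mem_range.1 hk)))
  have hDm' : ∀ n, StronglyMeasurable[F n] (D n) := by
    rintro (_ | n)
    · simpa [D] using stronglyMeasurable_const
    · exact (hDm n).mono (F.mono n.le_succ)
  have hDb : ∀ n, ∀ᵐ ω ∂P, ‖D n ω‖ ≤ 1 := fun n => Eventually.of_forall fun ω => by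
    rw [Real.norm_of_nonneg (hD0 n ω).le]
    exact hD1 n ω
  have hDi : ∀ n {f : Ω → ℝ}, Integrable f P → Integrable (fun ω => D n ω * f ω) P := fun n f hf =>
    hf.bdd_mul ((hDm' n).mono (F.le n)).aestronglyMeasurable (hDb n)
  have hRS := ae_tendsto_of_condExp_le_add_sub (P := P) (F := F)
    (V := fun n ω => D n ω * V n ω) (b := fun n ω => D (n + 1) ω * b n ω)
    (c := fun n ω => D (n + 1) ω * c n ω) (fun n ω => mul_nonneg (hD0 n ω).le (hV0 n ω))
    (fun n ω => mul_nonneg (hD0 _ ω).le (hb0 n ω)) (fun n ω => mul_nonneg (hD0 _ ω).le (hc0 n ω))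
    (fun n => (hDm' n).mul (hVm n)) (fun n => (hDm n).mul (hbm n)) (fun n => (hDm n).mul (hcm n))
    (fun n => hDi n (hVi n)) (fun n => hDi _ (hbi n)) (fun n => hDi _ (hci n)) (fun n => by
      have h1 := condExp_stronglyMeasurable_mul_of_bound (F.le n) (hDm n) (hVi (n + 1)) 1 (hDb (n + 1))
      have e : (fun ω => D (n + 1) ω * V (n + 1) ω) = D (n + 1) * V (n + 1) := rfl
      simp only [e]
      filter_upwards [h1, h n] with ω g1 g2
      rw [g1, Pi.mul_apply]
      have := mul_le_mul_of_nonneg_left g2 (hD0 (n + 1) ω).le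
      rw [← hDs n ω]
      linarith)
    (by
      filter_upwards [hb] with ω hω
      exact hω.of_nonneg_of_le (fun n => mul_nonneg (hD0 _ ω).le (hb0 n ω)) fun n =>
        mul_le_of_le_one_left (hb0 n ω) (hD1 _ ω))
  filter_upwards [hRS, ha] with ω h1 h2
  -- From `1 + a ≤ exp a` and summability, the discount stays away from `0`; dividing by it at the
  -- end is therefore harmless.
  have hlow : ∀ n, Real.exp (-∑' k, a k ω) ≤ D n ω := by
    intro n
    have h3 : ∏ k ∈ Finset.range n, (1 + a k ω) ≤ Real.exp (∑' k, a k ω) := by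
      calc ∏ k ∈ Finset.range n, (1 + a k ω) ≤ ∏ k ∈ Finset.range n, Real.exp (a k ω) :=
            Finset.prod_le_prod (fun k _ => by linarith [ha0 k ω]) fun k _ => by
              linarith [Real.add_one_le_exp (a k ω)]
        _ = Real.exp (∑ k ∈ Finset.range n, a k ω) := (Real.exp_sum _ _).symm
        _ ≤ _ := Real.exp_le_exp.2 (h2.sum_le_tsum _ fun k _ => ha0 k ω)
    simp only [D, Finset.prod_inv_distrib]
    rw [Real.exp_neg]
    exact inv_anti₀ (Finset.prod_pos fun k _ => by linarith [ha0 k ω]) h3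
  have hDt : ∃ δ, 0 < δ ∧ Tendsto (fun n => D n ω) atTop (𝓝 δ) := by
    have hanti : Antitone fun n => D n ω := antitone_nat_of_succ_le fun n => hDanti n ω
    have := tendsto_atTop_ciInf hanti ⟨0, by rintro _ ⟨n, rfl⟩; exact (hD0 n ω).le⟩
    exact ⟨_, (Real.exp_pos _).trans_le (ge_of_tendsto' this hlow), this⟩
  obtain ⟨δ, hδ, hDt⟩ := hDt
  obtain ⟨⟨l, hl⟩, hs⟩ := h1
  refine ⟨⟨l / δ, ?_⟩, ?_⟩
  · refine (hl.div hDt hδ.ne').congr fun n => ?_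
    rw [Pi.div_apply]
    field_simp [(hD0 n ω).ne']
  · refine (hs.mul_left (Real.exp (∑' k, a k ω))).of_nonneg_of_le (fun n => hc0 n ω) fun n => ?_
    have h3 := mul_le_mul_of_nonneg_left (hlow (n + 1)) (Real.exp_pos (∑' k, a k ω)).le
    rw [← Real.exp_add, add_neg_cancel, Real.exp_zero] at h3
    rw [← mul_assoc]
    exact le_mul_of_one_le_left (hc0 n ω) h3

end RobbinsSiegmund

end USN
end

/-! ### Linear algebra of one matrix update. -/

noncomputable section

namespace USN

open scoped Matrix.Norms.Frobenius

variable {d : ℕ}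

/-! ### Frobenius norm and quadratic forms -/

theorem frobenius_sq (B : Mat d) : ‖B‖ ^ 2 = ∑ i, ∑ j, B i j ^ 2 := by
  rw [Matrix.frobenius_norm_def, ← Real.rpow_natCast, ← Real.rpow_mul (by positivity)]
  norm_num

theorem norm_sq_eq_dotProduct (z : Vec d) : ‖z‖ ^ 2 = z.ofLp ⬝ᵥ z.ofLp := by
  rw [EuclideanSpace.real_norm_sq_eq, dotProduct]
  exact Finset.sum_congr rfl fun i _ => sq _

theorem dotProduct_self_nonneg' (x : Fin d → ℝ) : 0 ≤ x ⬝ᵥ x :=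
  Finset.sum_nonneg fun i _ => mul_self_nonneg (x i)

theorem dotProduct_sq_le (x y : Fin d → ℝ) : (x ⬝ᵥ y) ^ 2 ≤ (x ⬝ᵥ x) * (y ⬝ᵥ y) := by
  have := Finset.sum_mul_sq_le_sq_mul_sq Finset.univ x y
  simpa [dotProduct, sq] using this

theorem mulVec_dotProduct_self_le (B : Mat d) (x : Fin d → ℝ) :
    (B.mulVec x) ⬝ᵥ (B.mulVec x) ≤ ‖B‖ ^ 2 * (x ⬝ᵥ x) := by
  rw [frobenius_sq, Finset.sum_mul, dotProduct]
  refine Finset.sum_le_sum fun i _ => ?_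
  have := dotProduct_sq_le (B i) x
  have e : (B i) ⬝ᵥ (B i) = ∑ j, B i j ^ 2 := Finset.sum_congr rfl fun j _ => (sq _).symm
  rw [e] at this
  simpa [sq, Matrix.mulVec] using this

theorem norm_mulVec_le (B : Mat d) (z : Vec d) :
    ‖(WithLp.toLp 2 (B.mulVec z.ofLp) : Vec d)‖ ≤ ‖B‖ * ‖z‖ := by
  refine le_of_sq_le_sq ?_ (by positivity)
  rw [mul_pow, norm_sq_eq_dotProduct, norm_sq_eq_dotProduct]
  exact mulVec_dotProduct_self_le B z.ofLp

theorem abs_dotProduct_le (x y : Vec d) : |x.ofLp ⬝ᵥ y.ofLp| ≤ ‖x‖ * ‖y‖ := by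
  refine abs_le_of_sq_le_sq ?_ (by positivity)
  rw [mul_pow, norm_sq_eq_dotProduct, norm_sq_eq_dotProduct]
  exact dotProduct_sq_le _ _

theorem abs_quadForm_le (B : Mat d) (x : Fin d → ℝ) : |x ⬝ᵥ B.mulVec x| ≤ ‖B‖ * (x ⬝ᵥ x) := by
  have h1 := abs_dotProduct_le (WithLp.toLp 2 x : Vec d) (WithLp.toLp 2 (B.mulVec x))
  have h2 := norm_mulVec_le B (WithLp.toLp 2 x : Vec d)
  have h3 := norm_sq_eq_dotProduct (WithLp.toLp 2 x : Vec d)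
  simp only at h1 h2 h3
  rw [← h3]
  nlinarith [norm_nonneg (WithLp.toLp 2 x : Vec d)]

theorem frobenius_sq_vecMulVec (u v : Fin d → ℝ) :
    ‖Matrix.vecMulVec u v‖ ^ 2 = (u ⬝ᵥ u) * (v ⬝ᵥ v) := by
  rw [frobenius_sq, dotProduct, dotProduct, Finset.sum_mul_sum]
  refine Finset.sum_congr rfl fun i _ => Finset.sum_congr rfl fun j _ => ?_
  rw [Matrix.vecMulVec_apply]
  ring

theorem norm_vecMulVec (u v : Vec d) : ‖Matrix.vecMulVec u.ofLp v.ofLp‖ = ‖u‖ * ‖v‖ := by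
  refine (sq_eq_sq₀ (norm_nonneg _) (by positivity)).1 ?_
  rw [frobenius_sq_vecMulVec, mul_pow, norm_sq_eq_dotProduct, norm_sq_eq_dotProduct]

theorem norm_sq_one : ‖(1 : Mat d)‖ ^ 2 = d := by
  rw [frobenius_sq]
  simp [Matrix.one_apply]

theorem norm_one_eq : ‖(1 : Mat d)‖ = √d := by
  rw [← norm_sq_one, Real.sqrt_sq (norm_nonneg _)]

theorem frobenius_sq_add (A B : Mat d) :
    ‖A + B‖ ^ 2 = ‖A‖ ^ 2 + 2 * (∑ i, ∑ j, A i j * B i j) + ‖B‖ ^ 2 := by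
  simp only [frobenius_sq, Finset.mul_sum, ← Finset.sum_add_distrib]
  refine Finset.sum_congr rfl fun i _ => Finset.sum_congr rfl fun j _ => ?_
  rw [Matrix.add_apply]
  ring

theorem sum_mul_vecMulVec (A : Mat d) (u v : Fin d → ℝ) :
    ∑ i, ∑ j, A i j * Matrix.vecMulVec u v i j = u ⬝ᵥ A.mulVec v := by
  simp only [dotProduct, Matrix.mulVec, Finset.mul_sum, Matrix.vecMulVec_apply]
  refine Finset.sum_congr rfl fun i _ => Finset.sum_congr rfl fun j _ => ?_
  ring

theorem quadForm_vecMulVec (u v x : Fin d → ℝ) :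
    x ⬝ᵥ (Matrix.vecMulVec u v).mulVec x = (x ⬝ᵥ u) * (v ⬝ᵥ x) := by
  rw [Matrix.vecMulVec_mulVec, dotProduct_smul]
  simp

/-! ### The projection -/

/-- Being a rescaling, the projection keeps symmetry and the sign of the quadratic form. The last
clause measures what it costs: a relative overshoot `u` loses at most a factor `1 - u`, because `(1
- u)(1 + u) ≤ 1`. -/
theorem frobProj_spec {r : ℝ} (hr : 0 ≤ r) (B : Mat d) :
    ∃ s : ℝ, 0 ≤ s ∧ s ≤ 1 ∧ frobProj r B = s • B ∧
      ∀ u, 0 ≤ u → 0 < r → ‖B‖ ≤ r * (1 + u) → 1 - u ≤ s := by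
  unfold frobProj
  split_ifs with h
  · exact ⟨1, zero_le_one, le_rfl, (one_smul _ _).symm, fun u hu _ _ => by linarith⟩
  · rw [not_le] at h
    have hB : 0 < ‖B‖ := hr.trans_lt h
    refine ⟨r / ‖B‖, by positivity, (div_le_one hB).2 h.le, rfl, fun u hu hr' hu' => ?_⟩
    rw [le_div_iff₀ hB]
    by_cases h1 : u ≤ 1
    · nlinarith [mul_le_mul_of_nonneg_left hu' (sub_nonneg.2 h1), mul_nonneg hr (sq_nonneg u)]
    · nlinarith

theorem norm_frobProj_le {r : ℝ} (hr : 0 ≤ r) (B : Mat d) : ‖frobProj r B‖ ≤ r := by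
  unfold frobProj
  split_ifs with h
  · exact h
  · rw [not_le] at h
    have hB : 0 < ‖B‖ := hr.trans_lt h
    rw [norm_smul, Real.norm_of_nonneg (by positivity), div_mul_cancel₀ _ hB.ne']

theorem norm_frobProj_le_norm {r : ℝ} (hr : 0 ≤ r) (B : Mat d) : ‖frobProj r B‖ ≤ ‖B‖ := by
  obtain ⟨s, h0, h1, e, -⟩ := frobProj_spec hr B
  rw [e, norm_smul, Real.norm_of_nonneg h0]
  exact mul_le_of_le_one_left (norm_nonneg _) h1

/-! ### One step of the recursion for the matrices -/

/-- The product of a matrix and a vector. -/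
def mv (H : Mat d) (z : Vec d) : Vec d := WithLp.toLp 2 (H.mulVec z.ofLp)

/-- The truncation indicator `1_{‖H z‖ ‖z‖ ≤ b}`. -/
def gate (b : ℝ) (H : Mat d) (z : Vec d) : ℝ := if ‖mv H z‖ * ‖z‖ ≤ b then 1 else 0

/-- The update of the matrix before projection. -/
def preA (γ b : ℝ) (A H : Mat d) (z : Vec d) : Mat d :=
  A - (γ * gate b H z) • (Matrix.vecMulVec (mv A z).ofLp (mv H z).ofLp
    + Matrix.vecMulVec (mv H z).ofLp (mv A z).ofLp - (2 : ℝ) • (1 : Mat d))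

/-- Multiplication on the right by `1 - γ z (H z)ᵀ`, truncated. -/
def stepM (γ b : ℝ) (M H : Mat d) (z : Vec d) : Mat d :=
  M - (γ * gate b H z) • Matrix.vecMulVec (mv M z).ofLp (mv H z).ofLp

theorem gate_cases (b : ℝ) (H : Mat d) (z : Vec d) :
    (gate b H z = 1 ∧ ‖mv H z‖ * ‖z‖ ≤ b) ∨ (gate b H z = 0 ∧ b < ‖mv H z‖ * ‖z‖) := by
  unfold gate
  split_ifs with h
  · exact Or.inl ⟨rfl, h⟩
  · exact Or.inr ⟨rfl, not_le.1 h⟩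

theorem gate_nonneg (b : ℝ) (H : Mat d) (z : Vec d) : 0 ≤ gate b H z := by
  rcases gate_cases b H z with h | h <;> simp [h.1]

theorem gate_le_one (b : ℝ) (H : Mat d) (z : Vec d) : gate b H z ≤ 1 := by
  rcases gate_cases b H z with h | h <;> simp [h.1]

theorem preA_of_gate_eq_zero {γ b : ℝ} {A H : Mat d} {z : Vec d} (h : gate b H z = 0) :
    preA γ b A H z = A := by simp [preA, h]

theorem stepM_of_gate_eq_zero {γ b : ℝ} {M H : Mat d} {z : Vec d} (h : gate b H z = 0) :
    stepM γ b M H z = M := by simp [stepM, h]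

theorem preA_isSymm {γ b : ℝ} {A H : Mat d} {z : Vec d} (hA : A.IsSymm) :
    (preA γ b A H z).IsSymm := by
  unfold preA
  refine hA.sub (Matrix.IsSymm.smul ?_ _)
  refine Matrix.IsSymm.sub ?_ (Matrix.isSymm_one.smul _)
  rw [Matrix.IsSymm, Matrix.transpose_add, Matrix.transpose_vecMulVec, Matrix.transpose_vecMulVec,
    add_comm]

theorem frobProj_isSymm {r : ℝ} (hr : 0 ≤ r) {B : Mat d} (hB : B.IsSymm) :
    (frobProj r B).IsSymm := by
  obtain ⟨s, -, -, e, -⟩ := frobProj_spec hr B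
  rw [e]
  exact hB.smul s

theorem dotProduct_mulVec_symm {A : Mat d} (hA : A.IsSymm) (x y : Fin d → ℝ) :
    x ⬝ᵥ A.mulVec y = y ⬝ᵥ A.mulVec x := by
  rw [Matrix.dotProduct_mulVec, dotProduct_comm, ← Matrix.mulVec_transpose, hA.eq]

/-- The vector `(1 - γ z (H z)ᵀ) x`. -/
def shear (γ : ℝ) (H : Mat d) (z : Vec d) (x : Fin d → ℝ) : Fin d → ℝ :=
  x - (γ * ((mv H z).ofLp ⬝ᵥ x)) • z.ofLp

/-- Expanding `Tᵀ A T` with `T = 1 - γ z (H z)ᵀ` reproduces the two rank-one terms of the update, by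
symmetry of `A`, plus one term of order `γ ^ 2` that has to be subtracted. -/
theorem quadForm_preA {γ b : ℝ} {A H : Mat d} {z : Vec d} (hA : A.IsSymm)
    (hg : gate b H z = 1) (x : Fin d → ℝ) :
    x ⬝ᵥ (preA γ b A H z).mulVec x
      = shear γ H z x ⬝ᵥ A.mulVec (shear γ H z x)
        - γ ^ 2 * ((mv H z).ofLp ⬝ᵥ x) ^ 2 * (z.ofLp ⬝ᵥ A.mulVec z.ofLp) + 2 * γ * (x ⬝ᵥ x) := by
  have h1 := dotProduct_mulVec_symm hA z.ofLp x
  have h2 : (mv A z).ofLp = A.mulVec z.ofLp := rfl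
  have h3 : x ⬝ᵥ (mv H z).ofLp = (mv H z).ofLp ⬝ᵥ x := dotProduct_comm _ _
  have h4 : (A.mulVec z.ofLp) ⬝ᵥ x = x ⬝ᵥ A.mulVec z.ofLp := dotProduct_comm _ _
  simp only [preA, shear, hg, mul_one, Matrix.sub_mulVec, Matrix.smul_mulVec, Matrix.add_mulVec,
    dotProduct_sub, dotProduct_add, dotProduct_smul, quadForm_vecMulVec, Matrix.mulVec_sub,
    Matrix.mulVec_smul, sub_dotProduct, smul_dotProduct, smul_eq_mul, Matrix.one_mulVec, h1, h2, h3,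
    h4]
  ring

/-- An open gate and `‖A‖ ≤ r` bound the subtracted term by `γ ^ 2 * b ^ 2 * r * (x ⬝ᵥ x)`, hence by
half of the gain `2 * γ * (x ⬝ᵥ x)`. This is the role of the constraint linking the three step
sequences. -/
theorem quadForm_preA_ge {γ b r : ℝ} {A H : Mat d} {z : Vec d} (hA : A.IsSymm)
    (hr : ‖A‖ ≤ r) (hγb : γ ^ 2 * b ^ 2 * r ≤ γ) (hg : gate b H z = 1) (x : Fin d → ℝ) :
    shear γ H z x ⬝ᵥ A.mulVec (shear γ H z x) + γ * (x ⬝ᵥ x)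
      ≤ x ⬝ᵥ (preA γ b A H z).mulVec x := by
  rw [quadForm_preA hA hg]
  have hb : ‖mv H z‖ * ‖z‖ ≤ b := by
    rcases gate_cases b H z with h | h
    · exact h.2
    · rw [h.1] at hg; norm_num at hg
  have h1 := dotProduct_sq_le (mv H z).ofLp x
  rw [← norm_sq_eq_dotProduct] at h1
  have h2 := (le_abs_self _).trans (abs_quadForm_le A z.ofLp)
  rw [← norm_sq_eq_dotProduct] at h2
  have hx := dotProduct_self_nonneg' x
  have h3 : ((mv H z).ofLp ⬝ᵥ x) ^ 2 * (z.ofLp ⬝ᵥ A.mulVec z.ofLp)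
      ≤ (‖mv H z‖ ^ 2 * (x ⬝ᵥ x)) * (‖A‖ * ‖z‖ ^ 2) := by
    calc _ ≤ ((mv H z).ofLp ⬝ᵥ x) ^ 2 * (‖A‖ * ‖z‖ ^ 2) :=
          mul_le_mul_of_nonneg_left h2 (sq_nonneg _)
      _ ≤ _ := mul_le_mul_of_nonneg_right h1 (by positivity)
  have h4 : (‖mv H z‖ * ‖z‖) ^ 2 ≤ b ^ 2 := by gcongr
  have h5 : (‖mv H z‖ ^ 2 * (x ⬝ᵥ x)) * (‖A‖ * ‖z‖ ^ 2) ≤ b ^ 2 * r * (x ⬝ᵥ x) := by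
    calc _ = (‖mv H z‖ * ‖z‖) ^ 2 * ‖A‖ * (x ⬝ᵥ x) := by ring
      _ ≤ b ^ 2 * r * (x ⬝ᵥ x) := by gcongr
  have h6 := mul_le_mul_of_nonneg_left (h3.trans h5) (sq_nonneg γ)
  have h7 := mul_le_mul_of_nonneg_right hγb hx
  nlinarith

theorem shear_dotProduct_self_ge {γ b : ℝ} {H : Mat d} {z : Vec d} (hγ : 0 ≤ γ)
    (hg : gate b H z = 1) (x : Fin d → ℝ) :
    (1 - 2 * (γ * b)) * (x ⬝ᵥ x) ≤ shear γ H z x ⬝ᵥ shear γ H z x := by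
  have hb : ‖mv H z‖ * ‖z‖ ≤ b := by
    rcases gate_cases b H z with h | h
    · exact h.2
    · rw [h.1] at hg; norm_num at hg
  have hx := norm_sq_eq_dotProduct (WithLp.toLp 2 x : Vec d)
  have h1 := abs_dotProduct_le (mv H z) (WithLp.toLp 2 x)
  have h2 := abs_dotProduct_le z (WithLp.toLp 2 x)
  simp only at hx h1 h2
  have h3 : ((mv H z).ofLp ⬝ᵥ x) * (z.ofLp ⬝ᵥ x) ≤ b * (x ⬝ᵥ x) := by
    calc _ ≤ |((mv H z).ofLp ⬝ᵥ x)| * |(z.ofLp ⬝ᵥ x)| := by rw [← abs_mul]; exact le_abs_self _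
      _ ≤ (‖mv H z‖ * ‖(WithLp.toLp 2 x : Vec d)‖) * (‖z‖ * ‖(WithLp.toLp 2 x : Vec d)‖) := by gcongr
      _ = ‖mv H z‖ * ‖z‖ * ‖(WithLp.toLp 2 x : Vec d)‖ ^ 2 := by ring
      _ ≤ b * (x ⬝ᵥ x) := by rw [← hx]; gcongr
  have h4 : x ⬝ᵥ z.ofLp = z.ofLp ⬝ᵥ x := dotProduct_comm _ _
  have h5 : shear γ H z x ⬝ᵥ shear γ H z x = x ⬝ᵥ x
      - 2 * (γ * (((mv H z).ofLp ⬝ᵥ x) * (z.ofLp ⬝ᵥ x)))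
      + (γ * ((mv H z).ofLp ⬝ᵥ x)) ^ 2 * (z.ofLp ⬝ᵥ z.ofLp) := by
    simp only [shear, dotProduct_sub, sub_dotProduct, dotProduct_smul, smul_dotProduct, smul_eq_mul,
      h4]
    ring
  rw [h5]
  have h6 := mul_le_mul_of_nonneg_left h3 hγ
  have h7 := mul_nonneg (sq_nonneg (γ * ((mv H z).ofLp ⬝ᵥ x))) (dotProduct_self_nonneg' z.ofLp)
  linarith

/-- `stepM` multiplies on the right by the same `T` that acts on `A` by congruence, so a lower bound
of `A` by a multiple of `Mᵀ M` is transported from one step to the next. -/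
theorem stepM_mulVec {γ b : ℝ} {M H : Mat d} {z : Vec d} (hg : gate b H z = 1) (x : Fin d → ℝ) :
    (stepM γ b M H z).mulVec x = M.mulVec (shear γ H z x) := by
  simp only [stepM, shear, hg, mul_one, Matrix.sub_mulVec, Matrix.smul_mulVec, Matrix.mulVec_sub,
    Matrix.mulVec_smul, Matrix.vecMulVec_mulVec, mv]
  ext i
  simp
  ring

theorem norm_preA_le {γ b r : ℝ} {A H : Mat d} {z : Vec d} (hγ : 0 ≤ γ) (hr : ‖A‖ ≤ r)
    (hg : gate b H z = 1) : ‖preA γ b A H z‖ ≤ r + γ * (2 * b * r + 2 * √d) := by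
  have hb : ‖mv H z‖ * ‖z‖ ≤ b := by
    rcases gate_cases b H z with h | h
    · exact h.2
    · rw [h.1] at hg; norm_num at hg
  have hAz : ‖mv A z‖ ≤ ‖A‖ * ‖z‖ := norm_mulVec_le A z
  have h1 : ‖mv A z‖ * ‖mv H z‖ ≤ b * r := by
    calc _ ≤ (‖A‖ * ‖z‖) * ‖mv H z‖ := by gcongr
      _ = (‖mv H z‖ * ‖z‖) * ‖A‖ := by ring
      _ ≤ b * r := by
        have := (mul_nonneg (norm_nonneg (mv H z)) (norm_nonneg z)).trans hb
        gcongr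
  rw [preA, hg, mul_one]
  refine (norm_sub_le _ _).trans ?_
  rw [norm_smul, Real.norm_of_nonneg hγ]
  have h2 : ‖Matrix.vecMulVec (mv A z).ofLp (mv H z).ofLp
      + Matrix.vecMulVec (mv H z).ofLp (mv A z).ofLp - (2 : ℝ) • (1 : Mat d)‖
      ≤ 2 * b * r + 2 * √d := by
    refine (norm_sub_le _ _).trans ?_
    rw [norm_smul, norm_one_eq, Real.norm_of_nonneg zero_le_two]
    refine add_le_add_left ((norm_add_le _ _).trans ?_) _
    rw [norm_vecMulVec, norm_vecMulVec]
    linarith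
  gcongr

/-- A lower bound for the spectrum survives one step of the recursion. -/
theorem quadForm_frobProj_preA_ge {γ b r κ l : ℝ} {A H : Mat d} {z : Vec d} (hA : A.IsSymm)
    (hγ : 0 ≤ γ) (hr0 : 0 < r) (hr : ‖A‖ ≤ r) (hγb : γ ^ 2 * b ^ 2 * r ≤ γ) (hb : 0 ≤ b)
    (hκ : 2 * b * r + 2 * √d ≤ κ * b * r) (hκ2 : 2 ≤ κ) (hκb : κ * (γ * b) ≤ 1 / 2) (hl : 0 ≤ l)
    (hAl : ∀ x, l * (x ⬝ᵥ x) ≤ x ⬝ᵥ A.mulVec x) (hg : gate b H z = 1) (x : Fin d → ℝ) :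
    (l * (1 - (κ + 2) * (γ * b)) + γ / 2) * (x ⬝ᵥ x)
      ≤ x ⬝ᵥ (frobProj r (preA γ b A H z)).mulVec x := by
  obtain ⟨s, hs0, hs1, e, hs⟩ := frobProj_spec hr0.le (preA γ b A H z)
  have hγb0 : 0 ≤ γ * b := mul_nonneg hγ hb
  -- The update enlarges the norm by at most `γ * (2 * b * r + 2 * √d) ≤ κ * γ * b * r`, a relative
  -- overshoot of `κ * (γ * b)`.
  have hsκ : 1 - κ * (γ * b) ≤ s := by
    refine hs _ (by positivity) hr0 ((norm_preA_le hγ hr hg).trans ?_)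
    nlinarith [mul_le_mul_of_nonneg_left hκ hγ]
  have h1 := quadForm_preA_ge hA hr hγb hg x
  have h2 := hAl (shear γ H z x)
  have h3 := mul_le_mul_of_nonneg_left (shear_dotProduct_self_ge hγ hg x) hl
  have hx := dotProduct_self_nonneg' x
  have h4 : (l * (1 - 2 * (γ * b)) + γ) * (x ⬝ᵥ x) ≤ x ⬝ᵥ (preA γ b A H z).mulVec x := by
    nlinarith
  have h5 : 0 ≤ l * (1 - 2 * (γ * b)) + γ := by
    have : 0 ≤ 1 - 2 * (γ * b) := by nlinarith
    positivity
  rw [e, Matrix.smul_mulVec, dotProduct_smul, smul_eq_mul]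
  -- In the product, `κ * (γ * b) ≤ 1 / 2` saves half of the gain `γ`, and the second-order term in
  -- `γ * b` has the favourable sign.
  calc _ ≤ ((1 - κ * (γ * b)) * (l * (1 - 2 * (γ * b)) + γ)) * (x ⬝ᵥ x) := by
        refine mul_le_mul_of_nonneg_right ?_ hx
        nlinarith [mul_nonneg hl (mul_nonneg (by linarith : (0 : ℝ) ≤ κ) (sq_nonneg (γ * b))),
          mul_le_mul_of_nonneg_left hκb hγ]
    _ ≤ (s * (l * (1 - 2 * (γ * b)) + γ)) * (x ⬝ᵥ x) := by gcongr
    _ ≤ _ := by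
        rw [mul_assoc]
        exact mul_le_mul_of_nonneg_left h4 hs0

theorem frobProj_of_norm_le {r : ℝ} {B : Mat d} (h : ‖B‖ ≤ r) : frobProj r B = B := if_pos h

end USN
end

/-! ### The smallest eigenvalue along a trajectory, and weighted averages. -/

noncomputable section

namespace USN

open scoped Matrix.Norms.Frobenius

variable {d : ℕ}

/-- Nonnegativity of the quadratic form survives one step of the recursion. -/
theorem quadForm_frobProj_preA_nonneg {γ b r : ℝ} {A H : Mat d} {z : Vec d} (hA : A.IsSymm)
    (hγ : 0 ≤ γ) (hr0 : 0 ≤ r) (hr : ‖A‖ ≤ r) (hγb : γ ^ 2 * b ^ 2 * r ≤ γ)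
    (hAl : ∀ x, 0 ≤ x ⬝ᵥ A.mulVec x) (x : Fin d → ℝ) :
    0 ≤ x ⬝ᵥ (frobProj r (preA γ b A H z)).mulVec x := by
  obtain ⟨s, hs0, hs1, e, -⟩ := frobProj_spec hr0 (preA γ b A H z)
  rw [e, Matrix.smul_mulVec, dotProduct_smul, smul_eq_mul]
  refine mul_nonneg hs0 ?_
  rcases gate_cases b H z with h | h
  · have h1 := quadForm_preA_ge hA hr hγb h.1 x
    have := mul_nonneg hγ (dotProduct_self_nonneg' x)
    linarith [hAl (shear γ H z x)]
  · rw [preA_of_gate_eq_zero h.1]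
    exact hAl x

/-- The truncated and projected matrix recursion, from index `1` on, together with the sequence of
products of the matrices `1 - γ z (H z)ᵀ`. -/
structure MatrixRecursion (γ b r : ℕ → ℝ) (A M H : ℕ → Mat d) (z : ℕ → Vec d) : Prop where
  γ_pos : ∀ n, 1 ≤ n → 0 < γ n
  b_pos : ∀ n, 1 ≤ n → 0 < b n
  b_mono : ∀ n, 1 ≤ n → b n ≤ b (n + 1)
  r_pos : ∀ n, 1 ≤ n → 0 < r n
  r_mono : ∀ n, 1 ≤ n → r n ≤ r (n + 1)
  trunc : ∀ n, 1 ≤ n → γ n ^ 2 * b n ^ 2 * r n ≤ γ n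
  symm : ∀ n, (A n).IsSymm
  -- Index `0` is excluded: the initial matrix has not been projected and may lie outside the ball.
  norm_le : ∀ n, 1 ≤ n → ‖A n‖ ≤ r n
  A_succ : ∀ n, 1 ≤ n → A (n + 1) =
    frobProj (r (n + 1)) (preA (γ (n + 1)) (b (n + 1)) (A n) (H n) (z n))
  M_one : M 1 = 1
  M_succ : ∀ n, 1 ≤ n → M (n + 1) = stepM (γ (n + 1)) (b (n + 1)) (M n) (H n) (z n)

namespace MatrixRecursion

variable {γ b r : ℕ → ℝ} {A M H : ℕ → Mat d} {z : ℕ → Vec d}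

theorem norm_le_succ (h : MatrixRecursion γ b r A M H z) {n : ℕ} (hn : 1 ≤ n) :
    ‖A n‖ ≤ r (n + 1) := (h.norm_le n hn).trans (h.r_mono n hn)

theorem nonneg_of_le (h : MatrixRecursion γ b r A M H z) {n : ℕ} (hn : 1 ≤ n)
    (hA : ∀ x, 0 ≤ x ⬝ᵥ (A n).mulVec x) {k : ℕ} (hk : n ≤ k) : ∀ x, 0 ≤ x ⬝ᵥ (A k).mulVec x := by
  induction k, hk using Nat.le_induction with
  | base => exact hA
  | succ k hk ih =>
    intro x
    have h1 : 1 ≤ k := hn.trans hk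
    rw [h.A_succ k h1]
    exact quadForm_frobProj_preA_nonneg (h.symm k) (h.γ_pos _ (by omega)).le (h.r_pos _ (by omega)).le
      (h.norm_le_succ h1) (h.trunc _ (by omega)) ih x

/-- If the products stay bounded, the matrices become positive semidefinite in finite time. -/
theorem exists_nonneg (h : MatrixRecursion γ b r A M H z) {K : ℝ} (hK : ∀ n, ‖M n‖ ^ 2 ≤ K)
    (hdiv : Tendsto (fun n => ∑ k ∈ Finset.range n, γ (k + 1) * gate (b (k + 1)) (H k) (z k))
      atTop atTop) : ∃ n, 1 ≤ n ∧ ∀ x, 0 ≤ x ⬝ᵥ (A n).mulVec x := by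
  by_contra! hcon
  let S : ℕ → ℝ := fun n => ∑ k ∈ Finset.range n, γ (k + 1) * gate (b (k + 1)) (H k) (z k)
  have hK0 : 0 ≤ K := (sq_nonneg _).trans (hK 0)
  have hK1 : 0 < K + 1 := by linarith
  -- The invariant is `A n ≥ -σ n • (M n)ᵀ (M n)`. At an open step the gain `γ` times the identity
  -- dominates `γ / (K + 1)` times `Mᵀ M`, which lowers `σ` by `γ / (K + 1)`. Divergence of the sum
  -- eventually makes `σ` nonpositive, a contradiction. The `+ 1` keeps the divisor positive.
  let σ : ℕ → ℝ := fun n => ‖A 1‖ - (S n - S 1) / (K + 1)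
  have key : ∀ n, 1 ≤ n → ∀ x, -σ n * ((M n).mulVec x ⬝ᵥ (M n).mulVec x) ≤ x ⬝ᵥ (A n).mulVec x := by
    intro n hn
    induction n, hn using Nat.le_induction with
    | base =>
      intro x
      have := neg_abs_le (x ⬝ᵥ (A 1).mulVec x)
      simp only [σ, sub_self, zero_div, sub_zero, h.M_one, Matrix.one_mulVec]
      linarith [abs_quadForm_le (A 1) x]
    | succ n hn ih =>
      have hγ := h.γ_pos (n + 1) (by omega)
      have hpre : ∀ x, -σ (n + 1) * ((M (n + 1)).mulVec x ⬝ᵥ (M (n + 1)).mulVec x)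
          ≤ x ⬝ᵥ (preA (γ (n + 1)) (b (n + 1)) (A n) (H n) (z n)).mulVec x := by
        intro x
        rcases gate_cases (b (n + 1)) (H n) (z n) with hg | hg
        · have h1 := quadForm_preA_ge (h.symm n) (h.norm_le_succ hn) (h.trunc _ (by omega)) hg.1 x
          have h2 := ih (shear (γ (n + 1)) (H n) (z n) x)
          have h3 := mulVec_dotProduct_self_le (M (n + 1)) x
          rw [← stepM_mulVec (b := b (n + 1)) hg.1, ← h.M_succ n hn] at h2
          have hσ : σ (n + 1) = σ n - γ (n + 1) / (K + 1) := by
            simp only [σ, S, Finset.sum_range_succ, hg.1]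
            ring
          have hx := dotProduct_self_nonneg' x
          have h4 : γ (n + 1) / (K + 1) * ((M (n + 1)).mulVec x ⬝ᵥ (M (n + 1)).mulVec x)
              ≤ γ (n + 1) * (x ⬝ᵥ x) := by
            calc _ ≤ γ (n + 1) / (K + 1) * ((K + 1) * (x ⬝ᵥ x)) := by
                  refine mul_le_mul_of_nonneg_left (h3.trans ?_) (by positivity)
                  exact mul_le_mul_of_nonneg_right (by linarith [hK (n + 1)]) hx
              _ = _ := by field_simp
          rw [hσ]
          linarith
        · have hσ : σ (n + 1) = σ n := by
            simp only [σ, S, Finset.sum_range_succ, hg.1, mul_zero, add_zero]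
          rw [hσ, h.M_succ n hn, stepM_of_gate_eq_zero hg.1, preA_of_gate_eq_zero hg.1]
          exact ih x
      obtain ⟨s, hs0, hs1, e, -⟩ := frobProj_spec (h.r_pos (n + 1) (by omega)).le
        (preA (γ (n + 1)) (b (n + 1)) (A n) (H n) (z n))
      have hAe : ∀ x, x ⬝ᵥ (A (n + 1)).mulVec x
          = s * (x ⬝ᵥ (preA (γ (n + 1)) (b (n + 1)) (A n) (H n) (z n)).mulVec x) := fun x => by
        rw [h.A_succ n hn, e, Matrix.smul_mulVec, dotProduct_smul, smul_eq_mul]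
      -- Rescaling by `s ≤ 1` preserves the lower bound only if `σ (n + 1) ≥ 0`; a nonpositive value
      -- would make `A (n + 1)` positive semidefinite, which is excluded by `hcon`.
      have hσpos : 0 < σ (n + 1) := by
        by_contra hσ
        obtain ⟨x, hx⟩ := hcon (n + 1) (by omega)
        rw [hAe] at hx
        have h1 := hpre x
        have h2 := dotProduct_self_nonneg' ((M (n + 1)).mulVec x)
        have h3 : 0 ≤ -σ (n + 1) * ((M (n + 1)).mulVec x ⬝ᵥ (M (n + 1)).mulVec x) :=
          mul_nonneg (by linarith) h2
        exact absurd (mul_nonneg hs0 (h3.trans h1)) (not_le.2 hx)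
      intro x
      rw [hAe]
      have h1 := hpre x
      have h2 := mul_nonneg hσpos.le (dotProduct_self_nonneg' ((M (n + 1)).mulVec x))
      nlinarith [mul_le_mul_of_nonneg_left h1 hs0, mul_nonneg (sub_nonneg.2 hs1) h2]
  obtain ⟨n, hn1, hn⟩ := ((eventually_ge_atTop 1).and
    (hdiv.eventually_ge_atTop (S 1 + ‖A 1‖ * (K + 1)))).exists
  obtain ⟨x, hx⟩ := hcon n hn1
  have hσ : σ n ≤ 0 := by
    have : ‖A 1‖ ≤ (S n - S 1) / (K + 1) := by
      rw [le_div_iff₀ hK1]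
      have : S 1 + ‖A 1‖ * (K + 1) ≤ S n := hn
      linarith
    simp only [σ]
    linarith
  have h1 := key n hn1 x
  have h2 := mul_nonneg (neg_nonneg.2 hσ) (dotProduct_self_nonneg' ((M n).mulVec x))
  linarith

/-- The smallest eigenvalue of the matrices is eventually bounded below by a multiple of
`1 / b n`. -/
theorem exists_quadForm_ge (h : MatrixRecursion γ b r A M H z) {K κ : ℝ} (hK : ∀ n, ‖M n‖ ^ 2 ≤ K)
    (hdiv : Tendsto (fun n => ∑ k ∈ Finset.range n, γ (k + 1) * gate (b (k + 1)) (H k) (z k))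
      atTop atTop)
    (hκ2 : 2 ≤ κ) (hκ : ∀ n, 1 ≤ n → 2 * b n * r n + 2 * √d ≤ κ * b n * r n)
    (hκb : ∀ᶠ n in atTop, κ * (γ n * b n) ≤ 1 / 2) :
    ∃ c, 0 < c ∧ ∃ N, ∀ n, N ≤ n → ∀ x, c / b n * (x ⬝ᵥ x) ≤ x ⬝ᵥ (A n).mulVec x := by
  obtain ⟨n₁, hn₁, hpsd⟩ := h.exists_nonneg hK hdiv
  obtain ⟨n₂, hn₂⟩ := eventually_atTop.1 hκb
  -- A late open step upgrades semidefinite to definite: from the bound `l = 0` it produces `γ (k +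
  -- 1) / 2`.
  obtain ⟨k, hk, hgk⟩ : ∃ k, max n₁ n₂ ≤ k ∧ gate (b (k + 1)) (H k) (z k) = 1 := by
    by_contra! hcon
    have hconst : ∀ n, max n₁ n₂ ≤ n →
        ∑ k ∈ Finset.range n, γ (k + 1) * gate (b (k + 1)) (H k) (z k)
          = ∑ k ∈ Finset.range (max n₁ n₂), γ (k + 1) * gate (b (k + 1)) (H k) (z k) := by
      intro n hn
      induction n, hn using Nat.le_induction with
      | base => rfl
      | succ n hn ih =>
        rw [Finset.sum_range_succ, ih]
        rcases gate_cases (b (n + 1)) (H n) (z n) with hg | hg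
        · exact absurd hg.1 (hcon n hn)
        · rw [hg.1, mul_zero, add_zero]
    obtain ⟨n, hn, hn'⟩ := ((eventually_ge_atTop (max n₁ n₂)).and (hdiv.eventually_gt_atTop
      (∑ k ∈ Finset.range (max n₁ n₂), γ (k + 1) * gate (b (k + 1)) (H k) (z k)))).exists
    rw [hconst n hn] at hn'
    exact lt_irrefl _ hn'
  have hk1 : 1 ≤ k := hn₁.trans ((le_max_left _ _).trans hk)
  have hk2 : n₂ ≤ k := (le_max_right _ _).trans hk
  have hstep : ∀ n, k ≤ n → gate (b (n + 1)) (H n) (z n) = 1 → ∀ l, 0 ≤ l →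
      (∀ x, l * (x ⬝ᵥ x) ≤ x ⬝ᵥ (A n).mulVec x) → ∀ x,
      (l * (1 - (κ + 2) * (γ (n + 1) * b (n + 1))) + γ (n + 1) / 2) * (x ⬝ᵥ x)
        ≤ x ⬝ᵥ (A (n + 1)).mulVec x := by
    intro n hn hg l hl hAl x
    have h1 : 1 ≤ n := hk1.trans hn
    rw [h.A_succ n h1]
    exact quadForm_frobProj_preA_ge (h.symm n) (h.γ_pos _ (by omega)).le (h.r_pos _ (by omega))
      (h.norm_le_succ h1) (h.trunc _ (by omega)) (h.b_pos _ (by omega)).le (hκ _ (by omega)) hκ2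
      (hn₂ _ (by omega)) hl hAl hg x
  have hγk := h.γ_pos (k + 1) (by omega)
  have hbk := h.b_pos (k + 1) (by omega)
  have hstart : ∀ x, γ (k + 1) / 2 * (x ⬝ᵥ x) ≤ x ⬝ᵥ (A (k + 1)).mulVec x := fun x => by
    have := hstep k le_rfl hgk 0 le_rfl (fun x => by
      rw [zero_mul]
      exact h.nonneg_of_le hn₁ hpsd ((le_max_left _ _).trans hk) x) x
    simpa using this
  -- The first entry makes the level `c / b n` self-sustaining, the second makes it hold at the
  -- starting index `k + 1`.
  let c : ℝ := min (1 / (2 * (κ + 2))) (γ (k + 1) / 2 * b (k + 1))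
  have hc0 : 0 < c := lt_min (by positivity) (by positivity)
  have hc1 : c * (κ + 2) ≤ 1 / 2 := by
    have : c ≤ 1 / (2 * (κ + 2)) := min_le_left _ _
    calc c * (κ + 2) ≤ 1 / (2 * (κ + 2)) * (κ + 2) := by gcongr
      _ = 1 / 2 := by field_simp
  refine ⟨c, hc0, k + 1, fun n hn => ?_⟩
  induction n, hn using Nat.le_induction with
  | base =>
    intro x
    refine le_trans (mul_le_mul_of_nonneg_right ?_ (dotProduct_self_nonneg' x)) (hstart x)
    rw [div_le_iff₀ hbk]
    exact min_le_right _ _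
  | succ n hn ih =>
    have h1 : 1 ≤ n := by omega
    have hb := h.b_pos n h1
    have hb' := h.b_pos (n + 1) (by omega)
    have hl : ∀ x, c / b (n + 1) * (x ⬝ᵥ x) ≤ x ⬝ᵥ (A n).mulVec x := fun x => by
      refine le_trans (mul_le_mul_of_nonneg_right ?_ (dotProduct_self_nonneg' x)) (ih x)
      exact div_le_div_of_nonneg_left hc0.le hb (h.b_mono n h1)
    intro x
    rcases gate_cases (b (n + 1)) (H n) (z n) with hg | hg
    · refine le_trans (mul_le_mul_of_nonneg_right ?_ (dotProduct_self_nonneg' x))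
        (hstep n (by omega) hg.1 (c / b (n + 1)) (by positivity) hl x)
      have hγ := h.γ_pos (n + 1) (by omega)
      -- At the level `c / b (n + 1)` the loss is `c * (κ + 2) * γ (n + 1)`, at most the gain `γ (n
      -- + 1) / 2`.
      have e : c / b (n + 1) * (1 - (κ + 2) * (γ (n + 1) * b (n + 1)))
          = c / b (n + 1) - c * (κ + 2) * γ (n + 1) := by field_simp
      rw [e]
      nlinarith
    · rw [h.A_succ n h1, preA_of_gate_eq_zero hg.1, frobProj_of_norm_le (h.norm_le_succ h1)]
      exact hl x

end MatrixRecursion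

/-! ### Weighted averages -/

/-- The sum of the unnormalized logarithmic weights. -/
def weightSum (τ : ℝ) (n : ℕ) : ℝ := ∑ k ∈ Finset.range (n + 1), Real.log ((k : ℝ) + 1) ^ τ

theorem log_rpow_nonneg (τ : ℝ) (k : ℕ) : 0 ≤ Real.log ((k : ℝ) + 1) ^ τ :=
  Real.rpow_nonneg (Real.log_nonneg (by linarith [(Nat.cast_nonneg k : (0 : ℝ) ≤ k)])) _

theorem log_two_rpow_le {τ : ℝ} (hτ : 0 ≤ τ) {k : ℕ} (hk : 1 ≤ k) :
    Real.log 2 ^ τ ≤ Real.log ((k : ℝ) + 1) ^ τ := by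
  have : (1 : ℝ) ≤ k := by exact_mod_cast hk
  exact Real.rpow_le_rpow (Real.log_nonneg (by norm_num))
    (Real.log_le_log (by norm_num) (by linarith)) hτ

/-- Only `n` of the `n + 1` terms are counted: the term of index `0` is `0 ^ τ`, which vanishes for
`τ > 0`. -/
theorem le_weightSum {τ : ℝ} (hτ : 0 ≤ τ) (n : ℕ) : Real.log 2 ^ τ * n ≤ weightSum τ n := by
  induction n with
  | zero => simpa [weightSum] using log_rpow_nonneg τ 0
  | succ n ih =>
    have h := log_two_rpow_le hτ (k := n + 1) (by omega)
    simp only [weightSum] at ih ⊢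
    rw [Finset.sum_range_succ]
    push_cast at h ⊢
    linarith

theorem log_two_rpow_pos (τ : ℝ) : 0 < Real.log 2 ^ τ :=
  Real.rpow_pos_of_pos (Real.log_pos (by norm_num)) τ

theorem weightSum_pos {τ : ℝ} (hτ : 0 ≤ τ) {n : ℕ} (hn : 1 ≤ n) : 0 < weightSum τ n := by
  have : (0 : ℝ) < n := by exact_mod_cast hn
  exact (mul_pos (log_two_rpow_pos τ) this).trans_le (le_weightSum hτ n)

theorem weightSum_succ (τ : ℝ) (n : ℕ) :
    weightSum τ (n + 1) = weightSum τ n + Real.log (((n + 1 : ℕ) : ℝ) + 1) ^ τ := by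
  rw [weightSum, Finset.sum_range_succ, weightSum]

theorem weightSum_nonneg (τ : ℝ) (n : ℕ) : 0 ≤ weightSum τ n :=
  Finset.sum_nonneg fun k _ => log_rpow_nonneg τ k

theorem avgWeight_nonneg (τ : ℝ) (n : ℕ) : 0 ≤ avgWeight τ n :=
  div_nonneg (log_rpow_nonneg τ n) (weightSum_nonneg τ n)

theorem avgWeight_le_one (τ : ℝ) (n : ℕ) : avgWeight τ n ≤ 1 :=
  div_le_one_of_le₀ (Finset.single_le_sum (f := fun k : ℕ => Real.log ((k : ℝ) + 1) ^ τ)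
    (fun k _ => log_rpow_nonneg τ k) (Finset.self_mem_range_succ n)) (weightSum_nonneg τ n)

/-- The recursive average is the weighted mean of the terms. -/
theorem weightSum_smul_avg {E : Type*} [AddCommGroup E] [Module ℝ E] {τ : ℝ} (hτ : 0 ≤ τ)
    {u v : ℕ → E} (h0 : v 0 = u 0)
    (hv : ∀ n, v (n + 1) = (1 - avgWeight τ (n + 1)) • v n + avgWeight τ (n + 1) • u (n + 1))
    (n : ℕ) :
    weightSum τ n • v n = ∑ k ∈ Finset.range (n + 1), (Real.log ((k : ℝ) + 1) ^ τ) • u k := by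
  induction n with
  | zero => simp [weightSum, h0]
  | succ n ih =>
    rw [Finset.sum_range_succ, ← ih, hv, smul_add, smul_smul, smul_smul]
    have hW := weightSum_pos hτ (n := n + 1) (by omega)
    have e : weightSum τ (n + 1) * avgWeight τ (n + 1)
        = Real.log (((n + 1 : ℕ) : ℝ) + 1) ^ τ := by
      rw [avgWeight, ← weightSum, mul_div_cancel₀ _ hW.ne']
    rw [mul_sub, e, mul_one, weightSum_succ, add_sub_cancel_right]

theorem tendsto_weightSum {τ : ℝ} (hτ : 0 ≤ τ) : Tendsto (weightSum τ) atTop atTop :=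
  tendsto_atTop_mono (le_weightSum hτ)
    (tendsto_natCast_atTop_atTop.const_mul_atTop (log_two_rpow_pos τ))

/-- The weighted averages of a convergent sequence converge to the same limit. -/
theorem tendsto_avg {E : Type*} [NormedAddCommGroup E] [NormedSpace ℝ E] {τ : ℝ} (hτ : 0 ≤ τ)
    {u v : ℕ → E} (h0 : v 0 = u 0)
    (hv : ∀ n, v (n + 1) = (1 - avgWeight τ (n + 1)) • v n + avgWeight τ (n + 1) • u (n + 1))
    {l : E} (hu : Tendsto u atTop (𝓝 l)) : Tendsto v atTop (𝓝 l) := by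
  let w : ℕ → ℝ := fun k => Real.log ((k : ℝ) + 1) ^ τ
  have hw0 : ∀ k, 0 ≤ w k := log_rpow_nonneg τ
  have hsum : Tendsto (fun n => ∑ k ∈ Finset.range n, w k) atTop atTop :=
    (tendsto_add_atTop_iff_nat 1).1 (tendsto_weightSum hτ)
  -- Weighted Cesàro: terms negligible with respect to weights of infinite sum have partial sums
  -- negligible with respect to the total weight.
  have ho : (fun k => w k • (u k - l)) =o[atTop] w := by
    have h1 : (fun k => u k - l) =o[atTop] (fun _ => (1 : ℝ)) :=
      (Asymptotics.isLittleO_one_iff ℝ).2 (by simpa using hu.sub_const l)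
    have := (Asymptotics.isBigO_refl w atTop).smul_isLittleO h1
    simpa using this
  have h2 := ho.sum_range hw0 hsum
  have h3 : (fun n => ∑ k ∈ Finset.range (n + 1), w k • (u k - l)) =o[atTop] (weightSum τ) :=
    h2.comp_tendsto (tendsto_add_atTop_nat 1)
  have h4 : ∀ᶠ n in atTop, (weightSum τ n)⁻¹ • ∑ k ∈ Finset.range (n + 1), w k • (u k - l)
      = v n - l := by
    filter_upwards [eventually_ge_atTop 1] with n hn
    have hW := weightSum_pos hτ hn
    simp only [smul_sub, Finset.sum_sub_distrib]
    rw [← weightSum_smul_avg hτ h0 hv n, ← Finset.sum_smul, smul_smul, smul_smul,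
      inv_mul_cancel₀ hW.ne', one_smul]
    congr 1
    change ((weightSum τ n)⁻¹ * weightSum τ n) • l = l
    rw [inv_mul_cancel₀ hW.ne', one_smul]
  have h5 := h3.tendsto_inv_smul_nhds_zero
  have h6 : Tendsto (fun n => v n - l) atTop (𝓝 0) := h5.congr' h4
  simpa using h6.add_const l

/-- The weighted averages inherit a lower bound on the spectrum. -/
theorem exists_avg_quadForm_ge {τ : ℝ} (hτ : 0 ≤ τ) {A B : ℕ → Mat d} (h0 : B 0 = A 0)
    (hB : ∀ n, B (n + 1) = (1 - avgWeight τ (n + 1)) • B n + avgWeight τ (n + 1) • A (n + 1))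
    {b : ℕ → ℝ} (hb0 : ∀ n, 1 ≤ n → 0 < b n) (hb : ∀ n, 1 ≤ n → b n ≤ b (n + 1))
    (hbn : Tendsto (fun n : ℕ => b n / n) atTop (𝓝 0)) {c : ℝ} (hc : 0 < c) {N : ℕ}
    (hA : ∀ n, N ≤ n → ∀ x, c / b n * (x ⬝ᵥ x) ≤ x ⬝ᵥ (A n).mulVec x) :
    ∀ᶠ n in atTop, ∀ x, c / (2 * b n) * (x ⬝ᵥ x) ≤ x ⬝ᵥ (B n).mulVec x := by
  let w : ℕ → ℝ := fun k => Real.log ((k : ℝ) + 1) ^ τ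
  have hw0 : ∀ k, 0 ≤ w k := log_rpow_nonneg τ
  have hbmono : ∀ m n, 1 ≤ m → m ≤ n → b m ≤ b n := by
    intro m n hm hmn
    induction n, hmn using Nat.le_induction with
    | base => rfl
    | succ n hn ih => exact ih.trans (hb n (hm.trans hn))
  have hq : ∀ n x, weightSum τ n * (x ⬝ᵥ (B n).mulVec x)
      = ∑ k ∈ Finset.range (n + 1), w k * (x ⬝ᵥ (A k).mulVec x) := by
    intro n x
    have := congrArg (fun C : Mat d => x ⬝ᵥ C.mulVec x) (weightSum_smul_avg hτ h0 hB n)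
    simp only [Matrix.smul_mulVec, dotProduct_smul, smul_eq_mul] at this
    rw [this, Matrix.sum_mulVec, dotProduct_sum]
    refine Finset.sum_congr rfl fun k _ => ?_
    rw [Matrix.smul_mulVec, dotProduct_smul, smul_eq_mul]
  -- The shift ensures a positive index, hence `b N' > 0`. The constant `D` bounds the total deficit
  -- of the terms before `N'`; it is eventually absorbed because `weightSum τ n / b n` grows at
  -- least like `n / b n`.
  let N' := N + 1
  let D : ℝ := ∑ k ∈ Finset.range N', w k * (‖A k‖ + c / b N')
  have hbN' : 0 < b N' := hb0 N' (by omega)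
  have hD : 0 ≤ D := Finset.sum_nonneg fun k _ => mul_nonneg (hw0 k) (by positivity)
  have hlow : ∀ n, N' ≤ n → ∀ x, (c / b n * weightSum τ n - D) * (x ⬝ᵥ x)
      ≤ weightSum τ n * (x ⬝ᵥ (B n).mulVec x) := by
    intro n hn x
    have hx := dotProduct_self_nonneg' x
    have hbn' : b N' ≤ b n := hbmono N' n (by omega) hn
    have hbn0 : 0 < b n := hbN'.trans_le hbn'
    rw [hq]
    have h1 : ∀ k ∈ Finset.range (n + 1), w k * (c / b n * (x ⬝ᵥ x))
        - (if k < N' then w k * (‖A k‖ + c / b N') * (x ⬝ᵥ x) else 0)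
        ≤ w k * (x ⬝ᵥ (A k).mulVec x) := by
      intro k hk
      split_ifs with hkN
      · have h2 := neg_abs_le (x ⬝ᵥ (A k).mulVec x)
        have h3 := abs_quadForm_le (A k) x
        have h4 : c / b n * (x ⬝ᵥ x) ≤ c / b N' * (x ⬝ᵥ x) := by gcongr
        have h5 : c / b n * (x ⬝ᵥ x) - (‖A k‖ + c / b N') * (x ⬝ᵥ x) ≤ x ⬝ᵥ (A k).mulVec x := by
          linarith
        have := mul_le_mul_of_nonneg_left h5 (hw0 k)
        linarith
      · have hkn : k ≤ n := Nat.lt_succ_iff.1 (Finset.mem_range.1 hk)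
        have h2 := hA k (by omega) x
        have h3 : c / b n * (x ⬝ᵥ x) ≤ c / b k * (x ⬝ᵥ x) := by
          have := hb0 k (by omega)
          have := hbmono k n (by omega) hkn
          gcongr
        have := mul_le_mul_of_nonneg_left (h3.trans h2) (hw0 k)
        linarith
    refine le_trans (le_of_eq ?_) (Finset.sum_le_sum h1)
    rw [Finset.sum_sub_distrib, ← Finset.sum_mul, ← Finset.sum_filter]
    have e : (Finset.range (n + 1)).filter (fun k => k < N') = Finset.range N' := by
      ext k
      simp only [Finset.mem_filter, Finset.mem_range]
      omega
    rw [e, ← Finset.sum_mul]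
    simp only [D, weightSum, w]
    ring
  have hl2 := log_two_rpow_pos τ
  have hsmall : ∀ᶠ n : ℕ in atTop, b n / n < c * Real.log 2 ^ τ / (2 * (D + 1)) :=
    hbn.eventually_lt_const (by positivity)
  filter_upwards [hsmall, eventually_ge_atTop N'] with n hn hnN x
  have hn1 : 1 ≤ n := by omega
  have hn0 : (0 : ℝ) < n := by exact_mod_cast hn1
  have hbn0 := hb0 n hn1
  have hW := weightSum_pos hτ hn1
  have hWl := le_weightSum hτ n
  have hDle : D ≤ c / (2 * b n) * weightSum τ n := by
    rw [div_lt_div_iff₀ hn0 (by positivity)] at hn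
    rw [div_mul_eq_mul_div, le_div_iff₀ (by positivity)]
    nlinarith [mul_le_mul_of_nonneg_left hWl hc.le]
  have hx := dotProduct_self_nonneg' x
  refine le_of_mul_le_mul_left (le_trans ?_ (hlow n hnN x)) hW
  have e : c / b n * weightSum τ n = 2 * (c / (2 * b n) * weightSum τ n) := by field_simp
  rw [e, ← mul_assoc]
  refine mul_le_mul_of_nonneg_right ?_ hx
  linarith

end USN
end

/-! ### Second moments after one matrix update. -/

noncomputable section

namespace USN

open scoped Matrix.Norms.Frobenius

variable {d : ℕ}

/-! ### Measurability of matrix operations -/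

instance matrixMeasurableSpace {m n : Type*} : MeasurableSpace (Matrix m n ℝ) :=
  MeasurableSpace.pi

section Measurability

variable {α : Type*} [MeasurableSpace α]

theorem measurable_matrix_iff {f : α → Mat d} :
    Measurable f ↔ ∀ i j, Measurable fun x => f x i j :=
  (measurable_pi_iff (g := (f : α → Fin d → Fin d → ℝ))).trans
    (forall_congr' fun _ => measurable_pi_iff)

theorem measurable_entry {f : α → Mat d} (hf : Measurable f) (i j : Fin d) :
    Measurable fun x => f x i j := measurable_matrix_iff.1 hf i j

theorem measurable_coord {f : α → Vec d} (hf : Measurable f) (i : Fin d) :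
    Measurable fun x => (f x).ofLp i :=
  (measurable_pi_apply i).comp ((WithLp.measurable_ofLp 2 _).comp hf)

theorem measurable_vec_iff {f : α → Vec d} :
    Measurable f ↔ ∀ i, Measurable fun x => (f x).ofLp i :=
  ⟨measurable_coord, fun h => (WithLp.measurable_toLp 2 _).comp (measurable_pi_iff.2 h)⟩

theorem measurable_frobenius_norm {f : α → Mat d} (hf : Measurable f) :
    Measurable fun x => ‖f x‖ := by
  have e : (fun x => ‖f x‖) = fun x => √(∑ i, ∑ j, f x i j ^ 2) := by
    funext x
    rw [← frobenius_sq, Real.sqrt_sq (norm_nonneg _)]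
  rw [e]
  exact (Finset.measurable_fun_sum _ fun i _ => Finset.measurable_fun_sum _ fun j _ =>
    (measurable_entry hf i j).pow_const 2).sqrt

theorem measurable_mv {f : α → Mat d} {v : α → Vec d} (hf : Measurable f) (hv : Measurable v) :
    Measurable fun x => mv (f x) (v x) :=
  measurable_vec_iff.2 fun i => by
    change Measurable fun x => ∑ j, f x i j * (v x).ofLp j
    exact Finset.measurable_fun_sum _ fun j _ => (measurable_entry hf i j).mul (measurable_coord hv j)

theorem measurable_matrix_add {f g : α → Mat d} (hf : Measurable f) (hg : Measurable g) :
    Measurable fun x => f x + g x :=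
  measurable_matrix_iff.2 fun i j => (measurable_entry hf i j).add (measurable_entry hg i j)

theorem measurable_matrix_sub {f g : α → Mat d} (hf : Measurable f) (hg : Measurable g) :
    Measurable fun x => f x - g x :=
  measurable_matrix_iff.2 fun i j => (measurable_entry hf i j).sub (measurable_entry hg i j)

theorem measurable_matrix_smul {c : α → ℝ} {g : α → Mat d} (hc : Measurable c) (hg : Measurable g) :
    Measurable fun x => c x • g x :=
  measurable_matrix_iff.2 fun i j => hc.mul (measurable_entry hg i j)

theorem measurable_vecMulVec {u v : α → Vec d} (hu : Measurable u) (hv : Measurable v) :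
    Measurable fun x => (Matrix.vecMulVec (u x).ofLp (v x).ofLp : Mat d) :=
  measurable_matrix_iff.2 fun i j => (measurable_coord hu i).mul (measurable_coord hv j)

theorem measurable_gate (b : ℝ) {H : α → Mat d} {z : α → Vec d} (hH : Measurable H)
    (hz : Measurable z) : Measurable fun x => gate b (H x) (z x) :=
  Measurable.ite (measurableSet_le ((measurable_mv hH hz).norm.mul hz.norm) measurable_const)
    measurable_const measurable_const

theorem measurable_preA (γ b : ℝ) {A H : α → Mat d} {z : α → Vec d} (hA : Measurable A)
    (hH : Measurable H) (hz : Measurable z) : Measurable fun x => preA γ b (A x) (H x) (z x) :=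
  measurable_matrix_sub hA (measurable_matrix_smul ((measurable_gate b hH hz).const_mul γ)
    (measurable_matrix_sub (measurable_matrix_add
      (measurable_vecMulVec (measurable_mv hA hz) (measurable_mv hH hz))
      (measurable_vecMulVec (measurable_mv hH hz) (measurable_mv hA hz))) measurable_const))

theorem measurable_stepM (γ b : ℝ) {M H : α → Mat d} {z : α → Vec d} (hM : Measurable M)
    (hH : Measurable H) (hz : Measurable z) : Measurable fun x => stepM γ b (M x) (H x) (z x) :=
  measurable_matrix_sub hM (measurable_matrix_smul ((measurable_gate b hH hz).const_mul γ)
    (measurable_vecMulVec (measurable_mv hM hz) (measurable_mv hH hz)))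

theorem measurable_frobProj (r : ℝ) {A : α → Mat d} (hA : Measurable A) :
    Measurable fun x => frobProj r (A x) :=
  Measurable.ite (measurableSet_le (measurable_frobenius_norm hA) measurable_const) hA
    (measurable_matrix_smul (measurable_const.div (measurable_frobenius_norm hA)) hA)

theorem measurable_dotProduct {u v : α → Vec d} (hu : Measurable u) (hv : Measurable v) :
    Measurable fun x => (u x).ofLp ⬝ᵥ (v x).ofLp :=
  Finset.measurable_fun_sum _ fun i _ => (measurable_coord hu i).mul (measurable_coord hv i)

end Measurability

/-! ### Moments after one step -/

theorem norm_mv_le (B : Mat d) (z : Vec d) : ‖mv B z‖ ≤ ‖B‖ * ‖z‖ := norm_mulVec_le B z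

theorem abs_entry_le (B : Mat d) (i j : Fin d) : |B i j| ≤ ‖B‖ := by
  refine abs_le_of_sq_le_sq ?_ (norm_nonneg _)
  rw [frobenius_sq]
  calc B i j ^ 2 ≤ ∑ j, B i j ^ 2 :=
        Finset.single_le_sum (f := fun j => B i j ^ 2) (fun j _ => sq_nonneg _) (Finset.mem_univ j)
    _ ≤ _ := Finset.single_le_sum (f := fun i => ∑ j, B i j ^ 2)
        (fun i _ => Finset.sum_nonneg fun j _ => sq_nonneg _) (Finset.mem_univ i)

theorem rpow_le_one_add_rpow {t p q : ℝ} (ht : 0 ≤ t) (hp : 0 ≤ p) (hpq : p ≤ q) :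
    t ^ p ≤ 1 + t ^ q := by
  rcases le_total t 1 with h | h
  · have := Real.rpow_nonneg ht q
    have := Real.rpow_le_one ht h hp
    linarith
  · have := Real.rpow_le_rpow_of_exponent_le h hpq
    linarith

/-- The law of a random positive semidefinite Hessian `H` with a moment of order `q`, and of an
independent bounded isotropic vector. -/
structure HessianLaw {E : Type*} [MeasurableSpace E] (μ : Measure E) (ρ : Measure (Vec d))
    (H : E → Mat d) (q C K : ℝ) : Prop where
  two_lt : 2 < q
  one_le : 1 ≤ K
  meas : Measurable H
  int : Integrable (fun x => ‖H x‖ ^ q) μ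
  le : ∫ x, ‖H x‖ ^ q ∂μ ≤ C
  psd : ∀ v, ∀ᵐ x ∂μ, 0 ≤ v ⬝ᵥ (H x).mulVec v
  bdd : ∀ᵐ z ∂ρ, ‖z‖ ≤ K
  cov : ∀ i j, ∫ z : Vec d, z.ofLp i * z.ofLp j ∂ρ = (1 : Mat d) i j

/-- The multiplicative error in the second moments after one step. -/
def driftError (q C K γ b : ℝ) : ℝ :=
  2 * (γ * (b ^ (-(q - 1)) * ((K ^ 2) ^ q * C))) + γ ^ 2 * (K ^ 4 * (1 + C))

/-- When the gate is closed, `t = ‖mv H z‖ * ‖z‖` exceeds `b`, so `t ≤ b ^ (-(q - 1)) * t ^ q` as in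
Markov's inequality, while `t ≤ K ^ 2 * ‖H‖`. -/
theorem tail_le {q b K : ℝ} (hq : 2 < q) (hb : 0 < b) {H : Mat d} {z : Vec d} (hz : ‖z‖ ≤ K) :
    (1 - gate b H z) * (‖mv H z‖ * ‖z‖) ≤ b ^ (-(q - 1)) * ((K ^ 2) ^ q * ‖H‖ ^ q) := by
  have hK : 0 ≤ K := (norm_nonneg z).trans hz
  rcases gate_cases b H z with h | h
  · rw [h.1]
    simp only [sub_self, zero_mul]
    positivity
  · rw [h.1, sub_zero, one_mul]
    set t := ‖mv H z‖ * ‖z‖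
    have ht : 0 < t := hb.trans h.2
    have h1 : t ≤ K ^ 2 * ‖H‖ := by
      calc t ≤ (‖H‖ * ‖z‖) * ‖z‖ := by
            have := norm_mv_le H z
            simp only [t]
            gcongr
        _ ≤ (‖H‖ * K) * K := by gcongr
        _ = _ := by ring
    rw [← Real.mul_rpow (by positivity) (norm_nonneg _)]
    have h2 : t ^ q ≤ (K ^ 2 * ‖H‖) ^ q := Real.rpow_le_rpow ht.le h1 (by linarith)
    refine le_trans ?_ (mul_le_mul_of_nonneg_left h2 (Real.rpow_nonneg hb.le _))
    have h3 : t ^ q = t ^ (q - 1) * t := by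
      rw [← Real.rpow_add_one ht.ne']; ring_nf
    have h4 : b ^ (q - 1) ≤ t ^ (q - 1) := Real.rpow_le_rpow hb.le h.2.le (by linarith)
    rw [h3, Real.rpow_neg hb.le, inv_mul_eq_div, le_div_iff₀ (Real.rpow_pos_of_pos hb _)]
    nlinarith

theorem sq_mv_mul_sq_mv_le {K q : ℝ} (hq : 2 < q) (B H : Mat d) {z : Vec d} (hz : ‖z‖ ≤ K) :
    ‖mv B z‖ ^ 2 * ‖mv H z‖ ^ 2 ≤ ‖B‖ ^ 2 * (K ^ 4 * (1 + ‖H‖ ^ q)) := by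
  have hK : 0 ≤ K := (norm_nonneg z).trans hz
  have h1 := norm_mv_le B z
  have h2 := norm_mv_le H z
  have h3 := rpow_le_one_add_rpow (norm_nonneg H) zero_le_two hq.le
  rw [Real.rpow_two] at h3
  calc _ ≤ (‖B‖ * K) ^ 2 * (‖H‖ * K) ^ 2 := by
        gcongr
        · exact h1.trans (by gcongr)
        · exact h2.trans (by gcongr)
    _ = ‖B‖ ^ 2 * (K ^ 4 * ‖H‖ ^ 2) := by ring
    _ ≤ _ := by gcongr

/-- The bilinear term whose expectation is nonnegative. -/
def drift (B H : Mat d) (z : Vec d) : ℝ := (mv B z).ofLp ⬝ᵥ (mv B (mv H z)).ofLp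

/-- This form separates the entries depending on `H` from the products of coordinates of `z`, so
that integrating over the product law only involves the covariance of `z`. -/
theorem drift_eq (B H : Mat d) (z : Vec d) :
    drift B H z = ∑ i, ∑ j, (B.transpose * B * H) i j * (z.ofLp i * z.ofLp j) := by
  have e : drift B H z = z.ofLp ⬝ᵥ (B.transpose * B * H).mulVec z.ofLp := by
    simp only [drift, mv]
    rw [← Matrix.mulVec_mulVec, ← Matrix.mulVec_mulVec, Matrix.dotProduct_mulVec z.ofLp,
      Matrix.vecMul_transpose]
  rw [e]
  simp only [dotProduct, Matrix.mulVec, Finset.mul_sum]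
  exact Finset.sum_congr rfl fun i _ => Finset.sum_congr rfl fun j _ => by ring

theorem abs_drift_le (B H : Mat d) (z : Vec d) :
    |drift B H z| ≤ ‖B‖ ^ 2 * (‖mv H z‖ * ‖z‖) := by
  refine (abs_dotProduct_le _ _).trans ?_
  have h1 := norm_mv_le B z
  have h2 := norm_mv_le B (mv H z)
  calc _ ≤ (‖B‖ * ‖z‖) * (‖B‖ * ‖mv H z‖) := by gcongr
    _ = _ := by ring

/-- Only the untruncated drift has a mean of known sign, so the gate is removed at the price of the
tail term. -/
theorem neg_gate_mul_drift_le {q b K : ℝ} (hq : 2 < q) (hb : 0 < b) (B H : Mat d) {z : Vec d}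
    (hz : ‖z‖ ≤ K) : -(gate b H z * drift B H z)
      ≤ -drift B H z + ‖B‖ ^ 2 * (b ^ (-(q - 1)) * ((K ^ 2) ^ q * ‖H‖ ^ q)) := by
  have h1 := tail_le hq hb (H := H) hz
  have h2 := abs_drift_le B H z
  have h3 := sub_nonneg.2 (gate_le_one b H z)
  have h4 : (1 - gate b H z) * drift B H z ≤ ‖B‖ ^ 2 * ((1 - gate b H z) * (‖mv H z‖ * ‖z‖)) := by
    calc _ ≤ (1 - gate b H z) * (‖B‖ ^ 2 * (‖mv H z‖ * ‖z‖)) :=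
          mul_le_mul_of_nonneg_left ((le_abs_self _).trans h2) h3
      _ = _ := by ring
  have h5 := mul_le_mul_of_nonneg_left h1 (sq_nonneg ‖B‖)
  linarith

theorem norm_sq_stepM (γ b : ℝ) (M H : Mat d) (z : Vec d) :
    ‖stepM γ b M H z‖ ^ 2 = ‖M‖ ^ 2 - 2 * (γ * (gate b H z * drift M H z))
      + γ ^ 2 * (gate b H z * (‖mv M z‖ ^ 2 * ‖mv H z‖ ^ 2)) := by
  have hg : gate b H z ^ 2 = gate b H z := by
    rcases gate_cases b H z with h | h <;> simp [h.1]
  rw [stepM, sub_eq_add_neg, ← neg_smul, frobenius_sq_add]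
  simp only [Matrix.smul_apply, smul_eq_mul, mul_left_comm (M _ _), ← Finset.mul_sum]
  rw [sum_mul_vecMulVec, norm_smul, mul_pow, norm_vecMulVec, Real.norm_eq_abs, sq_abs,
    neg_sq, mul_pow, hg, mul_pow]
  simp only [drift, mv]
  ring

theorem sum_mul_one (A : Mat d) : ∑ i, ∑ j, A i j * (1 : Mat d) i j = A.trace := by
  simp [Matrix.one_apply, Matrix.trace]

theorem trace_le (A : Mat d) : A.trace ≤ √d * ‖A‖ := by
  refine le_of_sq_le_sq ?_ (by positivity)
  rw [mul_pow, Real.sq_sqrt (Nat.cast_nonneg d), frobenius_sq]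
  have h1 := sq_sum_le_card_mul_sum_sq (s := Finset.univ) (f := fun i : Fin d => A i i)
  simp only [Finset.card_univ, Fintype.card_fin] at h1
  refine h1.trans (mul_le_mul_of_nonneg_left (Finset.sum_le_sum fun i _ => ?_) (Nat.cast_nonneg d))
  exact Finset.single_le_sum (f := fun j => A i j ^ 2) (fun j _ => sq_nonneg _) (Finset.mem_univ i)

/-- For symmetric `A` both rank-one terms have inner product `drift A H z` with `A`. The identity
term contributes the trace, at most `√d * ‖A‖`; this is what makes the matrices grow. -/
theorem norm_sq_preA_le {γ b : ℝ} (hγ : 0 ≤ γ) {A H : Mat d} (hA : A.IsSymm) (z : Vec d) :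
    ‖preA γ b A H z‖ ^ 2 ≤ ‖A‖ ^ 2 - 4 * (γ * (gate b H z * drift A H z))
      + 4 * γ * √d * ‖A‖ + γ ^ 2 * (8 * (‖mv A z‖ ^ 2 * ‖mv H z‖ ^ 2) + 8 * d) := by
  have hg : gate b H z ^ 2 = gate b H z := by
    rcases gate_cases b H z with h | h <;> simp [h.1]
  set g := gate b H z with hgdef
  have hg0 : 0 ≤ g := gate_nonneg b H z
  have hg1 : g ≤ 1 := gate_le_one b H z
  set PQ : Mat d := Matrix.vecMulVec (mv A z).ofLp (mv H z).ofLp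
  set QP : Mat d := Matrix.vecMulVec (mv H z).ofLp (mv A z).ofLp
  have h1 : ∑ i, ∑ j, A i j * PQ i j = drift A H z := sum_mul_vecMulVec A _ _
  have h2 : ∑ i, ∑ j, A i j * QP i j = drift A H z := by
    rw [← h1, sum_mul_vecMulVec, sum_mul_vecMulVec]
    exact dotProduct_mulVec_symm hA _ _
  have h3 : ∑ i, ∑ j, A i j * (PQ + QP - (2 : ℝ) • (1 : Mat d)) i j
      = 2 * drift A H z - 2 * A.trace := by
    rw [← sum_mul_one A, two_mul (drift A H z)]
    nth_rewrite 1 [← h1]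
    rw [← h2]
    simp only [Finset.mul_sum, ← Finset.sum_add_distrib, ← Finset.sum_sub_distrib]
    refine Finset.sum_congr rfl fun i _ => Finset.sum_congr rfl fun j _ => ?_
    simp only [Matrix.sub_apply, Matrix.add_apply, Matrix.smul_apply, smul_eq_mul]
    ring
  have h4 : ‖PQ + QP - (2 : ℝ) • (1 : Mat d)‖ ≤ 2 * (‖mv A z‖ * ‖mv H z‖) + 2 * √d := by
    refine (norm_sub_le _ _).trans ?_
    rw [norm_smul, norm_one_eq, Real.norm_of_nonneg zero_le_two]
    refine add_le_add_left ((norm_add_le _ _).trans ?_) _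
    rw [norm_vecMulVec, norm_vecMulVec]
    linarith
  have h5 : ‖PQ + QP - (2 : ℝ) • (1 : Mat d)‖ ^ 2 ≤ 8 * (‖mv A z‖ ^ 2 * ‖mv H z‖ ^ 2) + 8 * d := by
    have h6 : (√d : ℝ) ^ 2 = d := Real.sq_sqrt (Nat.cast_nonneg d)
    calc _ ≤ (2 * (‖mv A z‖ * ‖mv H z‖) + 2 * √d) ^ 2 := by gcongr
      _ ≤ 8 * (‖mv A z‖ * ‖mv H z‖) ^ 2 + 8 * (√d) ^ 2 := by
          nlinarith [sq_nonneg ((‖mv A z‖ * ‖mv H z‖) - √d)]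
      _ = _ := by rw [h6]; ring
  have e : ‖preA γ b A H z‖ ^ 2 = ‖A‖ ^ 2 - 2 * (γ * g * (2 * drift A H z - 2 * A.trace))
      + γ ^ 2 * g * ‖PQ + QP - (2 : ℝ) • (1 : Mat d)‖ ^ 2 := by
    rw [preA, sub_eq_add_neg, ← neg_smul, frobenius_sq_add]
    simp only [Matrix.smul_apply, smul_eq_mul, mul_left_comm (A _ _), ← Finset.mul_sum]
    rw [h3, norm_smul, mul_pow, Real.norm_eq_abs, sq_abs, neg_sq, mul_pow, hg]
    ring
  rw [e]
  have h7 : γ * g * A.trace ≤ γ * (√d * ‖A‖) := by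
    calc _ ≤ γ * g * (√d * ‖A‖) := mul_le_mul_of_nonneg_left (trace_le A) (by positivity)
      _ ≤ γ * 1 * (√d * ‖A‖) := by gcongr
      _ = _ := by ring
  have h8 : γ ^ 2 * g * ‖PQ + QP - (2 : ℝ) • (1 : Mat d)‖ ^ 2
      ≤ γ ^ 2 * (8 * (‖mv A z‖ ^ 2 * ‖mv H z‖ ^ 2) + 8 * d) := by
    calc _ ≤ γ ^ 2 * 1 * ‖PQ + QP - (2 : ℝ) • (1 : Mat d)‖ ^ 2 := by gcongr
      _ ≤ _ := by rw [mul_one]; gcongr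
  linarith

namespace HessianLaw

variable {E : Type*} [MeasurableSpace E] {μ : Measure E} {ρ : Measure (Vec d)} {H : E → Mat d}
  {q C K : ℝ}

theorem C_nonneg (h : HessianLaw μ ρ H q C K) : 0 ≤ C :=
  (integral_nonneg fun _ => Real.rpow_nonneg (norm_nonneg _) _).trans h.le

theorem integrable_entry [IsProbabilityMeasure μ] (h : HessianLaw μ ρ H q C K) (i j : Fin d) :
    Integrable (fun x => H x i j) μ := by
  refine ((integrable_const 1).add h.int).mono' (measurable_entry h.meas i j).aestronglyMeasurable
    (Eventually.of_forall fun x => ?_)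
  have h1 := rpow_le_one_add_rpow (norm_nonneg (H x)) zero_le_one (by linarith [h.two_lt] : 1 ≤ q)
  rw [Real.rpow_one] at h1
  exact (abs_entry_le (H x) i j).trans h1

theorem integrable_coord_mul [IsProbabilityMeasure ρ] (h : HessianLaw μ ρ H q C K) (i j : Fin d) :
    Integrable (fun z : Vec d => z.ofLp i * z.ofLp j) ρ := by
  refine (integrable_const (K * K)).mono' ((measurable_coord measurable_id i).mul
    (measurable_coord measurable_id j)).aestronglyMeasurable ?_
  filter_upwards [h.bdd] with z hz
  rw [norm_mul]
  have h1 := (PiLp.norm_apply_le z i).trans hz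
  have h2 := (PiLp.norm_apply_le z j).trans hz
  have := (norm_nonneg _).trans h1
  exact mul_le_mul h1 h2 (norm_nonneg _) this

/-- Since the covariance of `z` is the identity, the mean is that of the trace of `Bᵀ B H`, equal to
the trace of `B H Bᵀ`, a sum over the rows of `B` of values of the nonnegative quadratic form of
`H`. -/
theorem integrable_drift [IsProbabilityMeasure μ] [IsProbabilityMeasure ρ]
    (h : HessianLaw μ ρ H q C K) (B : Mat d) :
    Integrable (fun y : E × Vec d => drift B (H y.1) y.2) (μ.prod ρ) ∧
      0 ≤ ∫ y, drift B (H y.1) y.2 ∂(μ.prod ρ) := by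
  have hent : ∀ i j, Integrable (fun x => (B.transpose * B * H x) i j) μ := fun i j => by
    simp only [Matrix.mul_apply (M := B.transpose * B)]
    exact integrable_finsetSum _ fun k _ => (h.integrable_entry k j).const_mul _
  have hterm : ∀ i j, Integrable (fun y : E × Vec d =>
      (B.transpose * B * H y.1) i j * (y.2.ofLp i * y.2.ofLp j)) (μ.prod ρ) := fun i j =>
    (hent i j).mul_prod (h.integrable_coord_mul i j)
  simp only [drift_eq]
  refine ⟨integrable_finsetSum _ fun i _ => integrable_finsetSum _ fun j _ => hterm i j, ?_⟩
  rw [integral_finsetSum _ fun i _ => integrable_finsetSum _ fun j _ => hterm i j]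
  simp_rw [integral_finsetSum _ fun j _ => hterm _ j]
  have e : ∀ i j, ∫ y : E × Vec d, (B.transpose * B * H y.1) i j * (y.2.ofLp i * y.2.ofLp j)
      ∂(μ.prod ρ) = (∫ x, (B.transpose * B * H x) i j ∂μ) * (1 : Mat d) i j := fun i j => by
    rw [← h.cov i j, ← integral_prod_mul]
  simp_rw [e, Matrix.one_apply, mul_ite, mul_one, mul_zero, Finset.sum_ite_eq, Finset.mem_univ,
    if_true]
  rw [← integral_finsetSum _ fun i _ => hent i i]
  refine integral_nonneg_of_ae ?_
  have hall : ∀ᵐ x ∂μ, ∀ k, 0 ≤ B k ⬝ᵥ (H x).mulVec (B k) := ae_all_iff.2 fun k => h.psd (B k)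
  filter_upwards [hall] with x hx
  have e2 : ∑ i, (B.transpose * B * H x) i i = ∑ k, B k ⬝ᵥ (H x).mulVec (B k) := by
    have h1 : ∑ i, (B.transpose * B * H x) i i = (B * H x * B.transpose).trace := by
      rw [Matrix.trace_mul_comm, ← Matrix.mul_assoc]
      rfl
    rw [h1]
    refine Finset.sum_congr rfl fun k _ => ?_
    rw [Matrix.diag_apply, Matrix.mul_assoc, Matrix.mul_apply]
    rfl
  rw [Pi.zero_apply, e2]
  exact Finset.sum_nonneg fun k _ => hx k

theorem integrable_rpow [IsProbabilityMeasure ρ] (h : HessianLaw μ ρ H q C K) [SFinite μ] :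
    Integrable (fun y : E × Vec d => ‖H y.1‖ ^ q) (μ.prod ρ) ∧
      ∫ y : E × Vec d, ‖H y.1‖ ^ q ∂(μ.prod ρ) ≤ C := by
  refine ⟨h.int.comp_fst ρ, ?_⟩
  rw [integral_fun_fst (fun x => ‖H x‖ ^ q)]
  simpa using h.le

theorem ae_norm_le [IsProbabilityMeasure ρ] (h : HessianLaw μ ρ H q C K) [SFinite μ] :
    ∀ᵐ y : E × Vec d ∂(μ.prod ρ), ‖y.2‖ ≤ K := by
  exact Measure.quasiMeasurePreserving_snd.ae h.bdd

/-- The basic estimate: a function bounded by `a - e * drift + (tail terms)`. -/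
theorem integral_le_of_le_drift [IsProbabilityMeasure μ] [IsProbabilityMeasure ρ]
    (h : HessianLaw μ ρ H q C K) (B : Mat d) {f : E × Vec d → ℝ} (hf : Measurable f)
    (hf0 : ∀ y, 0 ≤ f y) {a e s t : ℝ} (he : 0 ≤ e) (hs : 0 ≤ s) (ht : 0 ≤ t)
    (hle : ∀ y : E × Vec d, ‖y.2‖ ≤ K →
      f y ≤ a - e * drift B (H y.1) y.2 + s * ‖H y.1‖ ^ q + t * (1 + ‖H y.1‖ ^ q)) :
    Integrable f (μ.prod ρ) ∧ ∫ y, f y ∂(μ.prod ρ) ≤ a + s * C + t * (1 + C) := by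
  obtain ⟨hd1, hd2⟩ := h.integrable_drift B
  obtain ⟨hq1, hq2⟩ := h.integrable_rpow
  have i1 : Integrable (fun y : E × Vec d => a - e * drift B (H y.1) y.2) (μ.prod ρ) :=
    (integrable_const a).sub (hd1.const_mul e)
  have i2 : Integrable (fun y : E × Vec d => s * ‖H y.1‖ ^ q) (μ.prod ρ) := hq1.const_mul s
  have i3 : Integrable (fun y : E × Vec d => t * (1 + ‖H y.1‖ ^ q)) (μ.prod ρ) :=
    ((integrable_const 1).add hq1).const_mul t
  have hbi := (i1.add i2).add i3
  have hae : ∀ᵐ y ∂(μ.prod ρ),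
      f y ≤ a - e * drift B (H y.1) y.2 + s * ‖H y.1‖ ^ q + t * (1 + ‖H y.1‖ ^ q) := by
    filter_upwards [h.ae_norm_le] with y hy using hle y hy
  have hfi : Integrable f (μ.prod ρ) := by
    refine hbi.mono' hf.aestronglyMeasurable ?_
    filter_upwards [hae] with y hy
    rw [Real.norm_of_nonneg (hf0 y)]
    exact hy
  refine ⟨hfi, (integral_mono_ae hfi hbi hae).trans ?_⟩
  have e1 : ∫ y : E × Vec d, ((fun y : E × Vec d => a - e * drift B (H y.1) y.2)
      + (fun y : E × Vec d => s * ‖H y.1‖ ^ q) + fun y : E × Vec d => t * (1 + ‖H y.1‖ ^ q)) y ∂(μ.prod ρ)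
      = (a - e * ∫ y : E × Vec d, drift B (H y.1) y.2 ∂(μ.prod ρ))
        + s * ∫ y : E × Vec d, ‖H y.1‖ ^ q ∂(μ.prod ρ)
        + t * (1 + ∫ y : E × Vec d, ‖H y.1‖ ^ q ∂(μ.prod ρ)) := by
    rw [integral_add' (i1.add i2) i3, integral_add' i1 i2, integral_sub (integrable_const a)
      (hd1.const_mul e), integral_const_mul, integral_const_mul, integral_const_mul,
      integral_add (integrable_const 1) hq1]
    simp
  rw [e1]
  have h1 := mul_nonneg he hd2
  have h2 := mul_le_mul_of_nonneg_left hq2 hs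
  have h3 := mul_le_mul_of_nonneg_left (add_le_add_right hq2 1) ht
  linarith

theorem integral_norm_sq_stepM_le [IsProbabilityMeasure μ] [IsProbabilityMeasure ρ]
    (h : HessianLaw μ ρ H q C K) {γ b : ℝ} (hγ : 0 ≤ γ) (hb : 0 < b) (M : Mat d) :
    Integrable (fun y : E × Vec d => ‖stepM γ b M (H y.1) y.2‖ ^ 2) (μ.prod ρ) ∧
      ∫ y : E × Vec d, ‖stepM γ b M (H y.1) y.2‖ ^ 2 ∂(μ.prod ρ)
        ≤ (1 + driftError q C K γ b) * ‖M‖ ^ 2 := by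
  have hK : 0 ≤ K := zero_le_one.trans h.one_le
  have hm : Measurable fun y : E × Vec d => ‖stepM γ b M (H y.1) y.2‖ ^ 2 :=
    (measurable_frobenius_norm (measurable_stepM γ b measurable_const
      (h.meas.comp measurable_fst) measurable_snd)).pow_const 2
  have hb' := Real.rpow_nonneg hb.le (-(q - 1))
  have hKq := Real.rpow_nonneg (sq_nonneg K) q
  obtain ⟨h1, h2⟩ := h.integral_le_of_le_drift M (a := ‖M‖ ^ 2) (e := 2 * γ)
    (s := 2 * (γ * (‖M‖ ^ 2 * (b ^ (-(q - 1)) * (K ^ 2) ^ q)))) (t := γ ^ 2 * (‖M‖ ^ 2 * K ^ 4))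
    hm (fun y => sq_nonneg _) (by positivity) (by positivity) (by positivity) (fun y hy => by
      rw [norm_sq_stepM]
      have g1 := mul_le_mul_of_nonneg_left
        (neg_gate_mul_drift_le h.two_lt hb M (H y.1) hy) hγ
      have g2 := sq_mv_mul_sq_mv_le h.two_lt M (H y.1) hy
      have g3 : gate b (H y.1) y.2 * (‖mv M y.2‖ ^ 2 * ‖mv (H y.1) y.2‖ ^ 2)
          ≤ ‖mv M y.2‖ ^ 2 * ‖mv (H y.1) y.2‖ ^ 2 :=
        mul_le_of_le_one_left (by positivity) (gate_le_one _ _ _)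
      have g4 := mul_le_mul_of_nonneg_left (g3.trans g2) (sq_nonneg γ)
      linarith)
  refine ⟨h1, h2.trans (le_of_eq ?_)⟩
  rw [driftError]
  ring

theorem integral_norm_sq_frobProj_preA_le [IsProbabilityMeasure μ] [IsProbabilityMeasure ρ]
    (h : HessianLaw μ ρ H q C K) {γ b r : ℝ} (hγ : 0 ≤ γ) (hb : 0 < b) (hr : 0 ≤ r) {A : Mat d}
    (hA : A.IsSymm) :
    Integrable (fun y : E × Vec d => ‖frobProj r (preA γ b A (H y.1) y.2)‖ ^ 2) (μ.prod ρ) ∧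
      ∫ y : E × Vec d, ‖frobProj r (preA γ b A (H y.1) y.2)‖ ^ 2 ∂(μ.prod ρ)
        ≤ (1 + 8 * driftError q C K γ b) * ‖A‖ ^ 2 + 4 * γ * √d * ‖A‖ + 8 * γ ^ 2 * d := by
  have hK : 0 ≤ K := zero_le_one.trans h.one_le
  have hm : Measurable fun y : E × Vec d => ‖frobProj r (preA γ b A (H y.1) y.2)‖ ^ 2 :=
    (measurable_frobenius_norm (measurable_frobProj r (measurable_preA γ b measurable_const
      (h.meas.comp measurable_fst) measurable_snd))).pow_const 2
  have hb' := Real.rpow_nonneg hb.le (-(q - 1))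
  have hKq := Real.rpow_nonneg (sq_nonneg K) q
  obtain ⟨h1, h2⟩ := h.integral_le_of_le_drift A
    (a := ‖A‖ ^ 2 + 4 * γ * √d * ‖A‖ + 8 * γ ^ 2 * d) (e := 4 * γ)
    (s := 4 * (γ * (‖A‖ ^ 2 * (b ^ (-(q - 1)) * (K ^ 2) ^ q))))
    (t := 8 * (γ ^ 2 * (‖A‖ ^ 2 * K ^ 4)))
    hm (fun y => sq_nonneg _) (by positivity) (by positivity) (by positivity) (fun y hy => by
      have g0 : ‖frobProj r (preA γ b A (H y.1) y.2)‖ ^ 2 ≤ ‖preA γ b A (H y.1) y.2‖ ^ 2 := by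
        gcongr
        exact norm_frobProj_le_norm hr _
      refine g0.trans ((norm_sq_preA_le hγ hA y.2).trans ?_)
      have g1 := mul_le_mul_of_nonneg_left
        (neg_gate_mul_drift_le h.two_lt hb A (H y.1) hy) hγ
      have g2 := mul_le_mul_of_nonneg_left
        (sq_mv_mul_sq_mv_le h.two_lt A (H y.1) hy) (sq_nonneg γ)
      linarith)
  refine ⟨h1, h2.trans ?_⟩
  have hC := h.C_nonneg
  -- The factor `8` is dictated by the quadratic error; the linear error needs only `2` times its
  -- share in `driftError`, which leaves the slack displayed on the right.
  have e : (1 + 8 * driftError q C K γ b) * ‖A‖ ^ 2 + 4 * γ * √d * ‖A‖ + 8 * γ ^ 2 * d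
      - (‖A‖ ^ 2 + 4 * γ * √d * ‖A‖ + 8 * γ ^ 2 * d
        + 4 * (γ * (‖A‖ ^ 2 * (b ^ (-(q - 1)) * (K ^ 2) ^ q))) * C
        + 8 * (γ ^ 2 * (‖A‖ ^ 2 * K ^ 4)) * (1 + C))
      = 12 * (γ * (‖A‖ ^ 2 * (b ^ (-(q - 1)) * (K ^ 2) ^ q))) * C := by
    rw [driftError]
    ring
  have : 0 ≤ 12 * (γ * (‖A‖ ^ 2 * (b ^ (-(q - 1)) * (K ^ 2) ^ q))) * C := by positivity
  linarith

/-- A closed gate forces `‖mv H z‖ * ‖z‖ > b ≥ b₀`, so the tail divided by `b₀` bounds its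
indicator. Taking `0` for the matrix removes the drift, and the bound is a multiple of the same
error sequence as elsewhere. -/
theorem integral_one_sub_gate_le [IsProbabilityMeasure μ] [IsProbabilityMeasure ρ]
    (h : HessianLaw μ ρ H q C K) {γ b b₀ : ℝ} (hγ : 0 ≤ γ) (hb₀ : 0 < b₀) (hb : b₀ ≤ b) :
    Integrable (fun y : E × Vec d => γ * (1 - gate b (H y.1) y.2)) (μ.prod ρ) ∧
      ∫ y : E × Vec d, γ * (1 - gate b (H y.1) y.2) ∂(μ.prod ρ) ≤ b₀⁻¹ * driftError q C K γ b := by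
  have hK : 0 ≤ K := zero_le_one.trans h.one_le
  have hb1 : 0 < b := hb₀.trans_le hb
  have hm : Measurable fun y : E × Vec d => γ * (1 - gate b (H y.1) y.2) :=
    ((measurable_gate b (h.meas.comp measurable_fst) measurable_snd).const_sub 1).const_mul γ
  have hb' := Real.rpow_nonneg hb1.le (-(q - 1))
  have hKq := Real.rpow_nonneg (sq_nonneg K) q
  obtain ⟨h1, h2⟩ := h.integral_le_of_le_drift 0 (a := 0) (e := 0)
    (s := b₀⁻¹ * (γ * (b ^ (-(q - 1)) * (K ^ 2) ^ q))) (t := 0)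
    hm (fun y => mul_nonneg hγ (sub_nonneg.2 (gate_le_one _ _ _))) le_rfl (by positivity) le_rfl
    (fun y hy => by
      have g1 := tail_le h.two_lt hb1 (H := H y.1) hy
      have g2 : b₀ * (1 - gate b (H y.1) y.2)
          ≤ (1 - gate b (H y.1) y.2) * (‖mv (H y.1) y.2‖ * ‖y.2‖) := by
        rcases gate_cases b (H y.1) y.2 with hg | hg
        · simp [hg.1]
        · rw [hg.1]
          linarith [hg.2]
      have g3 := mul_le_mul_of_nonneg_left (g2.trans g1) hγ
      have g4 := mul_le_mul_of_nonneg_left g3 (inv_nonneg.2 hb₀.le)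
      have e : b₀⁻¹ * (γ * (b₀ * (1 - gate b (H y.1) y.2))) = γ * (1 - gate b (H y.1) y.2) := by
        field_simp
      rw [e] at g4
      linarith)
  refine ⟨h1, h2.trans ?_⟩
  have hC := h.C_nonneg
  have e : b₀⁻¹ * driftError q C K γ b
      - (0 + b₀⁻¹ * (γ * (b ^ (-(q - 1)) * (K ^ 2) ^ q)) * C + 0 * (1 + C))
      = b₀⁻¹ * (γ * (b ^ (-(q - 1)) * ((K ^ 2) ^ q * C)) + γ ^ 2 * (K ^ 4 * (1 + C))) := by
    rw [driftError]
    ring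
  have : 0 ≤ b₀⁻¹ * (γ * (b ^ (-(q - 1)) * ((K ^ 2) ^ q * C)) + γ ^ 2 * (K ^ 4 * (1 + C))) := by
    positivity
  linarith

end HessianLaw

end USN
end

/-! ### Convex analysis and the expected descent of the objective. -/

noncomputable section

namespace USN

open scoped Matrix.Norms.Frobenius

variable {d : ℕ}

theorem inner_eq_dotProduct (x y : Vec d) : inner ℝ x y = x.ofLp ⬝ᵥ y.ofLp := by
  rw [EuclideanSpace.inner_eq_star_dotProduct, star_trivial, dotProduct_comm]

/-! ### Convex functions and their gradients -/

theorem hasDerivAt_line {f : Vec d → ℝ} {h : Vec d} (hf : DifferentiableAt ℝ f h) (v : Vec d) :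
    HasDerivAt (fun t : ℝ => f (h + t • v)) (inner ℝ (gradient f h) v) 0 := by
  have h1 : HasDerivAt (fun t : ℝ => h + t • v) v 0 := by
    simpa using ((hasDerivAt_id (0 : ℝ)).smul_const v).const_add h
  have h2 : HasFDerivAt f (fderiv ℝ f h) (h + (0 : ℝ) • v) := by simpa using hf.hasFDerivAt
  have := h2.comp_hasDerivAt (0 : ℝ) h1
  rw [inner_gradient_left]
  exact this

/-- The gradient inequality for convex functions. -/
theorem _root_.ConvexOn.add_inner_gradient_le {f : Vec d → ℝ} (hc : ConvexOn ℝ Set.univ f) {h : Vec d}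
    (hf : DifferentiableAt ℝ f h) (k : Vec d) : f h + inner ℝ (gradient f h) (k - h) ≤ f k := by
  have h1 := (hasDerivAt_line hf (k - h)).tendsto_slope
  have h2 : Tendsto (slope (fun t : ℝ => f (h + t • (k - h))) 0) (𝓝[>] 0)
      (𝓝 (inner ℝ (gradient f h) (k - h))) :=
    h1.mono_left (nhdsWithin_mono _ fun t ht => ne_of_gt ht)
  have h3 : inner ℝ (gradient f h) (k - h) ≤ f k - f h := by
    refine le_of_tendsto h2 ?_
    filter_upwards [Ioo_mem_nhdsGT (zero_lt_one' ℝ)] with t ht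
    have h4 := hc.2 (Set.mem_univ h) (Set.mem_univ k) (by linarith [ht.2] : 0 ≤ 1 - t) ht.1.le
      (by ring)
    have e : (1 - t) • h + t • k = h + t • (k - h) := by
      rw [smul_sub, sub_smul, one_smul]
      abel
    rw [e, smul_eq_mul, smul_eq_mul] at h4
    rw [slope_def_field, sub_zero, div_le_iff₀ ht.1]
    simp only [zero_smul, add_zero]
    linarith
  linarith

theorem _root_.ConvexOn.inner_gradient_sub_nonneg {f : Vec d → ℝ} (hc : ConvexOn ℝ Set.univ f)
    {h k : Vec d} (hh : DifferentiableAt ℝ f h) (hk : DifferentiableAt ℝ f k) :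
    0 ≤ inner ℝ (gradient f k - gradient f h) (k - h) := by
  have h1 := hc.add_inner_gradient_le hh k
  have h2 := hc.add_inner_gradient_le hk h
  have e : inner ℝ (gradient f k) (h - k) = -inner ℝ (gradient f k) (k - h) := by
    rw [← inner_neg_right, neg_sub]
  rw [inner_sub_left]
  linarith

theorem hessianMatrix_mulVec (f : Vec d → ℝ) (h v : Vec d) :
    (hessianMatrix f h).mulVec v.ofLp = (hessian f h v).ofLp := by
  have e : v = ∑ j, v.ofLp j • (EuclideanSpace.single j 1 : Vec d) := by
    ext i
    rw [WithLp.ofLp_sum, Finset.sum_apply]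
    simp
  ext i
  conv_rhs => rw [e]
  rw [map_sum, WithLp.ofLp_sum, Finset.sum_apply]
  change ∑ j, hessianMatrix f h i j * v.ofLp j = _
  refine Finset.sum_congr rfl fun j _ => ?_
  rw [map_smul, WithLp.ofLp_smul, Pi.smul_apply, smul_eq_mul, mul_comm]
  rfl

/-- The Hessian of a convex function is positive semidefinite. -/
theorem _root_.ConvexOn.hessianMatrix_nonneg {f : Vec d → ℝ} (hc : ConvexOn ℝ Set.univ f) {h : Vec d}
    (hf : TwiceDifferentiableAt f h) (v : Fin d → ℝ) :
    0 ≤ v ⬝ᵥ (hessianMatrix f h).mulVec v := by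
  let w : Vec d := WithLp.toLp 2 v
  have e : v ⬝ᵥ (hessianMatrix f h).mulVec v = inner ℝ (hessian f h w) w := by
    rw [inner_eq_dotProduct, ← hessianMatrix_mulVec, dotProduct_comm]
  rw [e]
  have h1 : HasDerivAt (fun t : ℝ => h + t • w) w 0 := by
    simpa using ((hasDerivAt_id (0 : ℝ)).smul_const w).const_add h
  have h2 : HasFDerivAt (gradient f) (hessian f h) (h + (0 : ℝ) • w) := by
    simpa [hessian] using hf.2.hasFDerivAt
  have h3 := h2.comp_hasDerivAt (0 : ℝ) h1
  -- The map `t ↦ ⟨∇f(h + t w), w⟩` has derivative `⟨hessian f h w, w⟩` at `0`; monotonicity of the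
  -- gradient makes its right slopes at `0` nonnegative.
  have h4 := (h3.inner ℝ (hasDerivAt_const (0 : ℝ) w)).tendsto_slope
  simp only [inner_zero_right, zero_add] at h4
  have h5 := h4.mono_left (nhdsWithin_mono _ fun t (ht : t ∈ Set.Ioi 0) => ne_of_gt ht)
  refine ge_of_tendsto h5 ?_
  have hline : Tendsto (fun t : ℝ => h + t • w) (𝓝[>] 0) (𝓝 h) := by
    have := h1.continuousAt.tendsto
    simp only [zero_smul, add_zero] at this
    exact this.mono_left nhdsWithin_le_nhds
  filter_upwards [hline.eventually hf.1, self_mem_nhdsWithin] with t ht ht0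
  have h6 := hc.inner_gradient_sub_nonneg hf.1.self_of_nhds ht
  rw [add_sub_cancel_left, inner_smul_right] at h6
  rw [slope_def_field, sub_zero]
  refine div_nonneg ?_ (le_of_lt ht0)
  have h7 := nonneg_of_mul_nonneg_right h6 ht0
  simpa [inner_sub_left] using h7

/-- A convex function with a Lipschitz gradient that vanishes exactly at `θ`. -/
structure SmoothConvex (G : Vec d → ℝ) (θ : Vec d) (L : ℝ) : Prop where
  convex : ConvexOn ℝ Set.univ G
  diff : Differentiable ℝ G
  L_pos : 0 < L
  lip : ∀ h k, ‖gradient G k - gradient G h‖ ≤ L * ‖k - h‖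
  grad_eq_zero_iff : ∀ h, gradient G h = 0 ↔ h = θ

namespace SmoothConvex

variable {G : Vec d → ℝ} {θ : Vec d} {L : ℝ}

/-- The gradient inequality at `k`, followed by the Lipschitz bound, avoids integrating along the
segment; the price is `L` in place of `L / 2`. -/
theorem le_add (hG : SmoothConvex G θ L) (h k : Vec d) :
    G k ≤ G h + inner ℝ (gradient G h) (k - h) + L * ‖k - h‖ ^ 2 := by
  have h1 := hG.convex.add_inner_gradient_le (hG.diff k) h
  have h2 : inner ℝ (gradient G k) (h - k) = -inner ℝ (gradient G k) (k - h) := by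
    rw [← inner_neg_right, neg_sub]
  have h3 := real_inner_le_norm (gradient G k - gradient G h) (k - h)
  have h4 := mul_le_mul_of_nonneg_right (hG.lip h k) (norm_nonneg (k - h))
  rw [inner_sub_left] at h3
  linarith [sq (‖k - h‖)]

theorem min_le (hG : SmoothConvex G θ L) (h : Vec d) : G θ ≤ G h := by
  have := hG.convex.add_inner_gradient_le (hG.diff θ) h
  rw [(hG.grad_eq_zero_iff θ).2 rfl, inner_zero_left] at this
  linarith

/-- A gradient step of length `1 / (2 * L)` lowers `G` by at least `‖gradient G h‖ ^ 2 / (4 * L)`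
and cannot go below the minimum. -/
theorem norm_gradient_sq_le (hG : SmoothConvex G θ L) (h : Vec d) :
    ‖gradient G h‖ ^ 2 ≤ 4 * L * (G h - G θ) := by
  have hL := hG.L_pos
  have h1 := hG.le_add h (h - (1 / (2 * L)) • gradient G h)
  have h2 := hG.min_le (h - (1 / (2 * L)) • gradient G h)
  rw [sub_sub_cancel_left, inner_neg_right, inner_smul_right, real_inner_self_eq_norm_sq, norm_neg,
    norm_smul, Real.norm_of_nonneg (by positivity)] at h1
  have e : L * (1 / (2 * L) * ‖gradient G h‖) ^ 2 = 1 / (4 * L) * ‖gradient G h‖ ^ 2 := by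
    field_simp
    ring
  have e2 : 1 / (2 * L) * ‖gradient G h‖ ^ 2 = 2 * (1 / (4 * L) * ‖gradient G h‖ ^ 2) := by
    field_simp
    ring
  have h3 : 1 / (4 * L) * ‖gradient G h‖ ^ 2 ≤ G h - G θ := by linarith
  calc ‖gradient G h‖ ^ 2 = 4 * L * (1 / (4 * L) * ‖gradient G h‖ ^ 2) := by field_simp
    _ ≤ _ := by gcongr

theorem min_lt (hG : SmoothConvex G θ L) {h : Vec d} (hh : h ≠ θ) : G θ < G h := by
  refine lt_of_le_of_ne (hG.min_le h) fun e => hh ((hG.grad_eq_zero_iff h).1 ?_)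
  have := hG.norm_gradient_sq_le h
  rw [e, sub_self, mul_zero] at this
  exact norm_eq_zero.1 (pow_eq_zero_iff two_ne_zero |>.1 (le_antisymm this (sq_nonneg _)))

/-- Away from `θ`, both `G - G θ` and the norm of the gradient are bounded below. -/
theorem exists_sharp (hG : SmoothConvex G θ L) {ε : ℝ} (hε : 0 < ε) :
    ∃ m, 0 < m ∧ ∀ h, ε ≤ ‖h - θ‖ → m ≤ G h - G θ ∧ m ≤ ‖gradient G h‖ := by
  obtain ⟨m, hm, hsph⟩ : ∃ m, 0 < m ∧ ∀ h ∈ Metric.sphere θ ε, m ≤ G h - G θ := by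
    -- The sphere is empty in dimension `0`; otherwise compactness gives a positive minimum on it.
    rcases (Metric.sphere θ ε).eq_empty_or_nonempty with he | hne
    · exact ⟨1, one_pos, fun h hh => by rw [he] at hh; exact absurd hh (Set.notMem_empty h)⟩
    · obtain ⟨h₀, hh₀, hmin⟩ := (isCompact_sphere θ ε).exists_isMinOn hne
        (hG.diff.continuous.sub continuous_const : Continuous fun h => G h - G θ).continuousOn
      refine ⟨G h₀ - G θ, sub_pos.2 (hG.min_lt ?_), fun h hh => hmin hh⟩
      rintro rfl
      rw [Metric.mem_sphere, dist_self] at hh₀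
      exact hε.ne hh₀
  refine ⟨min m (m / ε), lt_min hm (by positivity), fun h hh => ?_⟩
  have hn : 0 < ‖h - θ‖ := hε.trans_le hh
  have ht1 : ε / ‖h - θ‖ ≤ 1 := (div_le_one hn).2 hh
  have ht0 : 0 ≤ ε / ‖h - θ‖ := by positivity
  -- Convexity on the segment from `θ` to `h`, which crosses the sphere, gives linear growth `m * ‖h
  -- - θ‖ ≤ ε * (G h - G θ)`. Together with `G h - G θ ≤ ‖gradient G h‖ * ‖h - θ‖` it bounds the
  -- gradient below.
  have h1 := hG.convex.2 (Set.mem_univ θ) (Set.mem_univ h) (sub_nonneg.2 ht1) ht0 (by ring)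
  have hmem : (1 - ε / ‖h - θ‖) • θ + (ε / ‖h - θ‖) • h ∈ Metric.sphere θ ε := by
    have e : (1 - ε / ‖h - θ‖) • θ + (ε / ‖h - θ‖) • h - θ = (ε / ‖h - θ‖) • (h - θ) := by
      rw [sub_smul, one_smul, smul_sub]
      abel
    rw [mem_sphere_iff_norm, e, norm_smul, Real.norm_of_nonneg ht0, div_mul_cancel₀ _ hn.ne']
  have h2 := hsph _ hmem
  simp only [smul_eq_mul] at h1
  have h3 : m ≤ ε / ‖h - θ‖ * (G h - G θ) := by linarith
  have h4 : m * ‖h - θ‖ ≤ ε * (G h - G θ) := by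
    rw [div_mul_eq_mul_div, le_div_iff₀ hn] at h3
    exact h3
  have h5 := hG.min_le h
  refine ⟨(min_le_left _ _).trans (h3.trans (mul_le_of_le_one_left (by linarith) ht1)),
    (min_le_right _ _).trans ?_⟩
  rw [div_le_iff₀ hε]
  have h6 := hG.convex.add_inner_gradient_le (hG.diff h) θ
  have h7 : inner ℝ (gradient G h) (θ - h) = -inner ℝ (gradient G h) (h - θ) := by
    rw [← inner_neg_right, neg_sub]
  have h8 := real_inner_le_norm (gradient G h) (h - θ)
  have h9 : G h - G θ ≤ ‖gradient G h‖ * ‖h - θ‖ := by linarith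
  have h10 : m * ‖h - θ‖ ≤ ‖gradient G h‖ * ε * ‖h - θ‖ := by
    calc _ ≤ ε * (G h - G θ) := h4
      _ ≤ ε * (‖gradient G h‖ * ‖h - θ‖) := by gcongr
      _ = _ := by ring
  exact le_of_mul_le_mul_right h10 hn

/-- If the values converge along a sequence on which the gradients come arbitrarily close to `0`,
the sequence converges to `θ`. -/
theorem tendsto_of_frequently (hG : SmoothConvex G θ L) {u : ℕ → Vec d} {l : ℝ}
    (hl : Tendsto (fun n => G (u n) - G θ) atTop (𝓝 l))
    (hf : ∀ ε > 0, ∃ᶠ n in atTop, ‖gradient G (u n)‖ < ε) : Tendsto u atTop (𝓝 θ) := by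
  -- A positive limit would keep the sequence away from `θ`, where gradients are bounded below,
  -- against the assumption that they are frequently small.
  have hl0 : l = 0 := by
    by_contra hne
    have hlnn : 0 ≤ l := ge_of_tendsto' hl fun n => sub_nonneg.2 (hG.min_le _)
    have hlpos : 0 < l := lt_of_le_of_ne hlnn (Ne.symm hne)
    have hcont : Tendsto (fun h => G h - G θ) (𝓝 θ) (𝓝 0) := by
      simpa using (hG.diff.continuous.tendsto θ).sub_const (G θ)
    obtain ⟨ε, hε, hball⟩ := Metric.eventually_nhds_iff.1
      (hcont.eventually_lt_const (half_pos hlpos))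
    obtain ⟨m, hm, hsharp⟩ := hG.exists_sharp hε
    obtain ⟨n, hn1, hn2⟩ := ((hf m hm).and_eventually
      (hl.eventually_const_lt (half_lt_self hlpos))).exists
    rcases lt_or_ge ‖u n - θ‖ ε with h1 | h1
    · have := hball (y := u n) (by rwa [dist_eq_norm])
      linarith
    · exact absurd hn1 (not_lt.2 (hsharp _ h1).2)
  rw [hl0] at hl
  rw [Metric.tendsto_atTop]
  intro ε hε
  obtain ⟨m, hm, hsharp⟩ := hG.exists_sharp hε
  obtain ⟨N, hN⟩ := eventually_atTop.1 (hl.eventually_lt_const hm)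
  refine ⟨N, fun n hn => ?_⟩
  rw [dist_eq_norm]
  by_contra hcon
  exact absurd (hN n hn) (not_lt.2 (hsharp _ (not_lt.1 hcon)).1)

end SmoothConvex

/-- Subtracting the affine minorant leaves a function with a minimum at `h`, whose derivative
vanishes there. -/
theorem gradient_eq_of_forall_le {G : Vec d → ℝ} {h v : Vec d} (hG : DifferentiableAt ℝ G h)
    (hle : ∀ k, G h + inner ℝ v (k - h) ≤ G k) : gradient G h = v := by
  have h1 : HasFDerivAt (fun k => G k - inner ℝ v (k - h)) (fderiv ℝ G h - innerSL ℝ v) h := by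
    have h2 : HasFDerivAt (fun k => inner ℝ v (k - h)) (innerSL ℝ v) h :=
      (innerSL ℝ v).hasFDerivAt.comp h ((hasFDerivAt_id h).sub_const h)
    exact hG.hasFDerivAt.sub h2
  have h3 : IsLocalMin (fun k => G k - inner ℝ v (k - h)) h := by
    refine Eventually.of_forall fun k => ?_
    have := hle k
    simp only [sub_self, inner_zero_right, sub_zero]
    linarith
  have h4 := h3.hasFDerivAt_eq_zero h1
  refine ext_inner_right ℝ fun w => ?_
  rw [inner_gradient_left, sub_eq_zero.1 h4]
  simp

/-! ### The objective -/

section Objective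

variable {Ω : Type*} [MeasurableSpace Ω] {P : Measure Ω} {p : ℕ} {X : Ω → Vec p}
  {g : Vec p → Vec d → ℝ} {θ : Vec d}

theorem Framework.differentiable (hframe : Framework P X g θ) (h : Vec d) :
    ∀ᵐ ω ∂P, DifferentiableAt ℝ (g (X ω)) h := by
  filter_upwards [hframe.twiceDifferentiable h] with ω hω using hω.1.self_of_nhds

theorem Framework.measurable_gradient_comp (hframe : Framework P X g θ) (h : Vec d) :
    Measurable fun ω => gradient (g (X ω)) h :=
  hframe.measurable_gradient.comp (hframe.measurable_X.prodMk measurable_const)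

theorem integrable_gradient [IsProbabilityMeasure P] (hframe : Framework P X g θ)
    (hA1a : AssumptionA1a P X g θ) (h : Vec d) : Integrable (fun ω => gradient (g (X ω)) h) P := by
  obtain ⟨C, -, hC⟩ := hA1a
  refine ((integrable_const 1).add (hC h).1).mono'
    (hframe.measurable_gradient_comp h).aestronglyMeasurable (Eventually.of_forall fun ω => ?_)
  simp only [Pi.add_apply]
  nlinarith [sq_nonneg (‖gradient (g (X ω)) h‖ - 1)]

/-- Averaging the gradient inequalities of `g (X ω)` shows that the mean gradient is a subgradient
of the differentiable function `G`. No differentiation under the integral is needed. -/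
theorem gradient_objective [IsProbabilityMeasure P] (hframe : Framework P X g θ)
    (hA1a : AssumptionA1a P X g θ) {h : Vec d} (hG : DifferentiableAt ℝ (objective P X g) h) :
    gradient (objective P X g) h = ∫ ω, gradient (g (X ω)) h ∂P := by
  refine gradient_eq_of_forall_le hG fun k => ?_
  have hi := integrable_gradient hframe hA1a h
  have e : inner ℝ (∫ ω, gradient (g (X ω)) h ∂P) (k - h)
      = ∫ ω, inner ℝ (gradient (g (X ω)) h) (k - h) ∂P := by
    rw [real_inner_comm, ← integral_inner hi]
    exact integral_congr_ae (Eventually.of_forall fun ω => real_inner_comm _ _)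
  rw [e]
  simp only [objective]
  rw [← integral_add (hframe.integrable h) (hi.inner_const _)]
  refine integral_mono_ae ((hframe.integrable h).add (hi.inner_const _)) (hframe.integrable k) ?_
  filter_upwards [hframe.convex, hframe.differentiable h] with ω h1 h2
  exact h1.add_inner_gradient_le h2 k

theorem convexOn_objective (hframe : Framework P X g θ) :
    ConvexOn ℝ Set.univ (objective P X g) := by
  refine ⟨convex_univ, fun h _ k _ s t hs ht hst => ?_⟩
  simp only [objective, smul_eq_mul]
  rw [← integral_const_mul, ← integral_const_mul,
    ← integral_add ((hframe.integrable h).const_mul s) ((hframe.integrable k).const_mul t)]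
  refine integral_mono_ae (hframe.integrable _)
    (((hframe.integrable h).const_mul s).add ((hframe.integrable k).const_mul t)) ?_
  filter_upwards [hframe.convex] with ω hω
  exact hω.2 (Set.mem_univ h) (Set.mem_univ k) hs ht hst

theorem differentiable_gradient {G : Vec d → ℝ} (hG : ContDiff ℝ 2 G) :
    Differentiable ℝ (gradient G) := by
  have h1 : ContDiff ℝ 1 (fderiv ℝ G) := hG.fderiv_right (by norm_num)
  exact (InnerProductSpace.toDual ℝ (Vec d)).symm.differentiable.comp (h1.differentiable (by norm_num))

theorem exists_smoothConvex_objective (hframe : Framework P X g θ) (hA2 : AssumptionA2 P X g θ) :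
    ∃ L, SmoothConvex (objective P X g) θ L := by
  obtain ⟨hC2, -, L, hL, hbd⟩ := hA2
  exact ⟨L, convexOn_objective hframe, hC2.differentiable (by norm_num), hL, fun h k =>
    convex_univ.norm_image_sub_le_of_norm_fderiv_le
      (fun x _ => (differentiable_gradient hC2) x) (fun x _ => hbd x) (Set.mem_univ h)
      (Set.mem_univ k), hframe.gradient_eq_zero_iff⟩

theorem inner_mv (B : Mat d) (w v : Vec d) : inner ℝ w (mv B v) = inner ℝ (mv B.transpose w) v := by
  rw [inner_eq_dotProduct, inner_eq_dotProduct]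
  simp only [mv]
  rw [Matrix.dotProduct_mulVec, Matrix.mulVec_transpose]

/-- The expected decrease of the objective in one step of the algorithm. -/
theorem integral_objective_step_le [IsProbabilityMeasure P] (hframe : Framework P X g θ)
    (hA1a : AssumptionA1a P X g θ) {L C : ℝ} (hG : SmoothConvex (objective P X g) θ L)
    (hC : ∀ h : Vec d, Integrable (fun ω => ‖gradient (g (X ω)) h‖ ^ 2) P ∧
      ∫ ω, ‖gradient (g (X ω)) h‖ ^ 2 ∂P ≤ C * (1 + objective P X g h - objective P X g θ))
    (ν : ℝ) (B : Mat d) (h : Vec d) :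
    Integrable (fun ω => objective P X g (h - ν • mv B (gradient (g (X ω)) h))
        - objective P X g θ) P ∧
      ∫ ω, (objective P X g (h - ν • mv B (gradient (g (X ω)) h)) - objective P X g θ) ∂P
        ≤ (1 + L * C * (ν ^ 2 * ‖B‖ ^ 2)) * (objective P X g h - objective P X g θ)
          + L * C * (ν ^ 2 * ‖B‖ ^ 2)
          - ν * inner ℝ (gradient (objective P X g) h) (mv B (gradient (objective P X g) h)) := by
  set G := objective P X g with hGdef
  have hi := integrable_gradient hframe hA1a h
  -- Moving `B` to the deterministic side makes the first-order term linear in the sampled gradient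
  -- `v`, so that its mean involves only the gradient of `G`.
  have hpt : ∀ v : Vec d, G (h - ν • mv B v) - G θ ≤ (G h - G θ)
      - ν * inner ℝ (mv B.transpose (gradient G h)) v + L * (ν ^ 2 * ‖B‖ ^ 2) * ‖v‖ ^ 2 := by
    intro v
    have h1 := hG.le_add h (h - ν • mv B v)
    rw [sub_sub_cancel_left, inner_neg_right, inner_smul_right, inner_mv, norm_neg, norm_smul,
      mul_pow, Real.norm_eq_abs, sq_abs] at h1
    have h2 : ‖mv B v‖ ^ 2 ≤ ‖B‖ ^ 2 * ‖v‖ ^ 2 := by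
      rw [← mul_pow]
      gcongr
      exact norm_mv_le B v
    have h3 := mul_le_mul_of_nonneg_left h2 (mul_nonneg hG.L_pos.le (sq_nonneg ν))
    linarith
  have i1 : Integrable (fun ω => (G h - G θ)
      - ν * inner ℝ (mv B.transpose (gradient G h)) (gradient (g (X ω)) h)) P :=
    (integrable_const _).sub ((hi.const_inner _).const_mul ν)
  have i2 : Integrable (fun ω => L * (ν ^ 2 * ‖B‖ ^ 2) * ‖gradient (g (X ω)) h‖ ^ 2) P :=
    (hC h).1.const_mul _
  have hm : Measurable fun ω => G (h - ν • mv B (gradient (g (X ω)) h)) - G θ := by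
    refine (hG.diff.continuous.measurable.comp ?_).sub_const _
    exact (measurable_const.sub
      ((measurable_mv measurable_const (hframe.measurable_gradient_comp h)).const_smul ν))
  have hint : Integrable (fun ω => G (h - ν • mv B (gradient (g (X ω)) h)) - G θ) P := by
    refine (i1.add i2).mono' hm.aestronglyMeasurable (Eventually.of_forall fun ω => ?_)
    rw [Real.norm_of_nonneg (sub_nonneg.2 (hG.min_le _))]
    exact hpt _
  refine ⟨hint, (integral_mono hint (i1.add i2) fun ω => hpt _).trans ?_⟩
  rw [integral_add' i1 i2, integral_sub (integrable_const _) ((hi.const_inner _).const_mul ν),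
    integral_const_mul, integral_const_mul, integral_inner hi, ← gradient_objective hframe hA1a
    (hG.diff h), ← inner_mv]
  simp only [integral_const, probReal_univ, smul_eq_mul, one_mul]
  have h4 := mul_le_mul_of_nonneg_left (hC h).2
    (mul_nonneg hG.L_pos.le (mul_nonneg (sq_nonneg ν) (sq_nonneg ‖B‖)))
  linarith

end Objective

end USN
end

/-! ### Power sequences and their exponents. -/

noncomputable section

namespace USN

/-! ### The step sequences -/

theorem summable_succ_rpow {s : ℝ} (hs : s < -1) :
    Summable fun n : ℕ => ((n + 1 : ℕ) : ℝ) ^ s :=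
  (summable_nat_add_iff (f := fun n : ℕ => (n : ℝ) ^ s) 1).2 (Real.summable_nat_rpow.2 hs)

theorem not_summable_succ_rpow {s : ℝ} (hs : -1 ≤ s) :
    ¬ Summable fun n : ℕ => ((n + 1 : ℕ) : ℝ) ^ s := fun h =>
  absurd (Real.summable_nat_rpow.1 ((summable_nat_add_iff (f := fun n : ℕ => (n : ℝ) ^ s) 1).1 h))
    (not_lt.2 hs)

/-- Bernoulli's inequality for the concave power `1 - s` at `-1 / (n + 1)` shows that the increment
of `n ^ (1 - s)` is at least `(1 - s) * (n + 1) ^ (-s)`; the increments telescope. -/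
theorem sum_succ_rpow_le {s : ℝ} (hs0 : 0 ≤ s) (hs1 : s < 1) (n : ℕ) :
    (1 - s) * ∑ k ∈ Finset.range n, ((k + 1 : ℕ) : ℝ) ^ (-s) ≤ (n : ℝ) ^ (1 - s) := by
  induction n with
  | zero =>
    simp only [Finset.range_zero, Finset.sum_empty, mul_zero]
    positivity
  | succ n ih =>
    rw [Finset.sum_range_succ, mul_add]
    have hn : (0 : ℝ) < ((n + 1 : ℕ) : ℝ) := by exact_mod_cast n.succ_pos
    have h1 := rpow_one_add_le_one_add_mul_self (s := -(1 / ((n + 1 : ℕ) : ℝ))) (p := 1 - s)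
      (by
        rw [neg_le_neg_iff, div_le_one hn]
        exact_mod_cast Nat.succ_pos n) (by linarith) (by linarith)
    have h2 : (n : ℝ) ^ (1 - s)
        = ((n + 1 : ℕ) : ℝ) ^ (1 - s) * (1 + -(1 / ((n + 1 : ℕ) : ℝ))) ^ (1 - s) := by
      rw [← Real.mul_rpow hn.le]
      · congr 1
        push_cast at hn ⊢
        field_simp
        ring
      · rw [← sub_eq_add_neg, sub_nonneg, div_le_one hn]
        exact_mod_cast Nat.succ_pos n
    have h3 : ((n + 1 : ℕ) : ℝ) ^ (1 - s) * (1 / ((n + 1 : ℕ) : ℝ)) = ((n + 1 : ℕ) : ℝ) ^ (-s) := by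
      rw [mul_one_div, ← Real.rpow_sub_one hn.ne']
      congr 1
      ring
    have h4 := mul_le_mul_of_nonneg_left h1 (Real.rpow_nonneg hn.le (1 - s))
    rw [← h2] at h4
    have h5 : ((n + 1 : ℕ) : ℝ) ^ (1 - s) * (1 + (1 - s) * -(1 / ((n + 1 : ℕ) : ℝ)))
        = ((n + 1 : ℕ) : ℝ) ^ (1 - s) - (1 - s) * ((n + 1 : ℕ) : ℝ) ^ (-s) := by
      rw [← h3]; ring
    rw [h5] at h4
    linarith

/-- Sequences with `u (n + 1) ≤ (1 + a n) u n + c n` and `a` summable. -/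
theorem exists_le_of_le_one_add_mul_add {u a c : ℕ → ℝ} (ha0 : ∀ n, 0 ≤ a n) (hc0 : ∀ n, 0 ≤ c n)
    (hu0 : 0 ≤ u 0) (ha : Summable a) (hu : ∀ n, u (n + 1) ≤ (1 + a n) * u n + c n) :
    ∃ D, 0 < D ∧ ∀ n, u n ≤ D * (1 + ∑ k ∈ Finset.range n, c k) := by
  have h1 : ∀ n, u n ≤ Real.exp (∑ k ∈ Finset.range n, a k)
      * (u 0 + ∑ k ∈ Finset.range n, c k) := by
    intro n
    induction n with
    | zero => simp
    | succ n ih =>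
      have hs : 0 ≤ ∑ k ∈ Finset.range n, c k := Finset.sum_nonneg fun k _ => hc0 k
      have hsa : 0 ≤ ∑ k ∈ Finset.range n, a k := Finset.sum_nonneg fun k _ => ha0 k
      have h2 : 1 + a n ≤ Real.exp (a n) := by linarith [Real.add_one_le_exp (a n)]
      rw [Finset.sum_range_succ, Finset.sum_range_succ, Real.exp_add]
      set e := Real.exp (∑ k ∈ Finset.range n, a k)
      have he : 1 ≤ e := Real.one_le_exp hsa
      have he2 : 1 ≤ Real.exp (a n) := Real.one_le_exp (ha0 n)
      calc u (n + 1) ≤ (1 + a n) * u n + c n := hu n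
        _ ≤ (1 + a n) * (e * (u 0 + ∑ k ∈ Finset.range n, c k)) + c n := by
            have := ha0 n
            gcongr
        _ ≤ Real.exp (a n) * (e * (u 0 + ∑ k ∈ Finset.range n, c k)) + e * Real.exp (a n) * c n := by
            gcongr
            exact le_mul_of_one_le_left (hc0 n) (one_le_mul_of_one_le_of_one_le he he2)
        _ = _ := by ring
  refine ⟨Real.exp (∑' k, a k) * (u 0 + 1), by positivity, fun n => (h1 n).trans ?_⟩
  have hs : 0 ≤ ∑ k ∈ Finset.range n, c k := Finset.sum_nonneg fun k _ => hc0 k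
  calc _ ≤ Real.exp (∑' k, a k) * (u 0 + ∑ k ∈ Finset.range n, c k) := by
        gcongr
        exact ha.sum_le_tsum _ fun k _ => ha0 k
    _ ≤ Real.exp (∑' k, a k) * ((u 0 + 1) * (1 + ∑ k ∈ Finset.range n, c k)) := by
        gcongr
        nlinarith
    _ = _ := by ring

theorem driftError_nonneg {q C K γ b : ℝ} (hC : 0 ≤ C) (hγ : 0 ≤ γ) (hb : 0 ≤ b) :
    0 ≤ driftError q C K γ b := by
  have h1 := Real.rpow_nonneg hb (-(q - 1))
  have h2 := Real.rpow_nonneg (sq_nonneg K) q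
  have h3 : 0 ≤ K ^ 4 := by positivity
  unfold driftError
  positivity

namespace Params

variable {a : Params}

theorem gammaSeq_pos (h : 0 < a.cγ) {n : ℕ} (hn : 1 ≤ n) : 0 < a.gammaSeq n :=
  mul_pos h (Real.rpow_pos_of_pos (by exact_mod_cast hn) _)

theorem betaSeq_pos (h : 0 < a.cβ) {n : ℕ} (hn : 1 ≤ n) : 0 < a.betaSeq n :=
  mul_pos h (Real.rpow_pos_of_pos (by exact_mod_cast hn) _)

theorem betaSeq'_pos (h : 0 < a.cβ') {n : ℕ} (hn : 1 ≤ n) : 0 < a.betaSeq' n :=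
  mul_pos h (Real.rpow_pos_of_pos (by exact_mod_cast hn) _)

theorem betaSeq'_nonneg (h : 0 < a.cβ') (n : ℕ) : 0 ≤ a.betaSeq' n :=
  mul_nonneg h.le (Real.rpow_nonneg (Nat.cast_nonneg n) _)

theorem nuSeq_pos (h : 0 < a.cν) {n : ℕ} (hn : 1 ≤ n) : 0 < a.nuSeq n :=
  mul_pos h (Real.rpow_pos_of_pos (by exact_mod_cast hn) _)

theorem betaSeq_le_succ (h : 0 < a.cβ) (hβ : 0 ≤ a.β) (n : ℕ) : a.betaSeq n ≤ a.betaSeq (n + 1) :=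
  mul_le_mul_of_nonneg_left (Real.rpow_le_rpow (Nat.cast_nonneg n) (by push_cast; linarith) hβ) h.le

theorem betaSeq'_le_succ (h : 0 < a.cβ') (hβ : 0 ≤ a.β') (n : ℕ) :
    a.betaSeq' n ≤ a.betaSeq' (n + 1) :=
  mul_le_mul_of_nonneg_left (Real.rpow_le_rpow (Nat.cast_nonneg n) (by push_cast; linarith) hβ) h.le

theorem le_betaSeq (h : 0 < a.cβ) (hβ : 0 ≤ a.β) {n : ℕ} (hn : 1 ≤ n) : a.cβ ≤ a.betaSeq n :=
  le_mul_of_one_le_right h.le (Real.one_le_rpow (by exact_mod_cast hn) hβ)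

theorem le_betaSeq' (h : 0 < a.cβ') (hβ : 0 ≤ a.β') {n : ℕ} (hn : 1 ≤ n) :
    a.cβ' ≤ a.betaSeq' n :=
  le_mul_of_one_le_right h.le (Real.one_le_rpow (by exact_mod_cast hn) hβ)

theorem tendsto_betaSeq_div (hβ : a.β < 1) :
    Tendsto (fun n : ℕ => a.betaSeq n / n) atTop (𝓝 0) := by
  have h1 : Tendsto (fun n : ℕ => a.cβ * (n : ℝ) ^ (-(1 - a.β))) atTop (𝓝 (a.cβ * 0)) :=
    ((tendsto_rpow_neg_atTop (by linarith)).comp tendsto_natCast_atTop_atTop).const_mul _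
  rw [mul_zero] at h1
  refine h1.congr' ?_
  filter_upwards [eventually_ge_atTop 1] with n hn
  have hn0 : (n : ℝ) ≠ 0 := by exact_mod_cast (by omega : n ≠ 0)
  rw [betaSeq, mul_div_assoc, ← Real.rpow_sub_one hn0]
  congr 2
  ring

theorem tendsto_gammaSeq_mul_betaSeq (h : a.β < a.γ) :
    Tendsto (fun n : ℕ => a.gammaSeq n * a.betaSeq n) atTop (𝓝 0) := by
  have h1 : Tendsto (fun n : ℕ => a.cγ * a.cβ * (n : ℝ) ^ (-(a.γ - a.β))) atTop
      (𝓝 (a.cγ * a.cβ * 0)) :=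
    ((tendsto_rpow_neg_atTop (by linarith)).comp tendsto_natCast_atTop_atTop).const_mul _
  rw [mul_zero] at h1
  refine h1.congr' ?_
  filter_upwards [eventually_ge_atTop 1] with n hn
  have hn0 : (0 : ℝ) < n := by exact_mod_cast hn
  have e : -(a.γ - a.β) = -a.γ + a.β := by ring
  rw [betaSeq, gammaSeq, e, Real.rpow_add hn0]
  ring

/-- The lower bound on `β` says exactly that `γ_n β_n^{-(q-1)}` has exponent below `-1`; the bound
on `γ` does the same for `γ_n²`. -/
theorem summable_driftError {q C K : ℝ} (hcβ : 0 < a.cβ) (hγ : 1 / 2 < a.γ) (hq : 1 < q)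
    (hβ : (1 - a.γ) / (q - 1) < a.β) :
    Summable fun n : ℕ => driftError q C K (a.gammaSeq (n + 1)) (a.betaSeq (n + 1)) := by
  have h1 : -a.γ + a.β * -(q - 1) < -1 := by
    rw [div_lt_iff₀ (by linarith)] at hβ
    linarith
  have h2 : -a.γ + -a.γ < -1 := by linarith
  refine (((summable_succ_rpow h1).mul_left
    (2 * (a.cγ * (a.cβ ^ (-(q - 1)) * ((K ^ 2) ^ q * C))))).add
    ((summable_succ_rpow h2).mul_left (a.cγ ^ 2 * (K ^ 4 * (1 + C))))).congr fun n => ?_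
  have hn : (0 : ℝ) < ((n + 1 : ℕ) : ℝ) := by exact_mod_cast n.succ_pos
  rw [driftError, gammaSeq, betaSeq, Real.mul_rpow hcβ.le (Real.rpow_nonneg hn.le _),
    ← Real.rpow_mul hn.le, Real.rpow_add hn, Real.rpow_add hn]
  ring

theorem not_summable_gammaSeq (h : 0 < a.cγ) (hγ : a.γ < 1) :
    ¬ Summable fun n : ℕ => a.gammaSeq (n + 1) := fun hs => by
  refine not_summable_succ_rpow (s := -a.γ) (by linarith) ((hs.mul_left a.cγ⁻¹).congr fun n => ?_)
  rw [gammaSeq, inv_mul_cancel_left₀ h.ne']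

/-- The total exponent `-2ν + 2(1 - γ)` is below `-1` exactly when `γ + ν > 3/2`. -/
theorem summable_nuSeq_sq_mul (h : 3 / 2 < a.γ + a.ν) (D : ℝ) :
    Summable fun n : ℕ => a.nuSeq (n + 1) ^ 2 * (D * ((n + 1 : ℕ) : ℝ) ^ (1 - a.γ)) ^ 2 := by
  have h1 : (-a.ν + -a.ν) + ((1 - a.γ) + (1 - a.γ)) < -1 := by linarith
  refine ((summable_succ_rpow h1).mul_left (a.cν ^ 2 * D ^ 2)).congr fun n => ?_
  have hn : (0 : ℝ) < ((n + 1 : ℕ) : ℝ) := by exact_mod_cast n.succ_pos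
  rw [nuSeq, Real.rpow_add hn, Real.rpow_add hn, Real.rpow_add hn]
  ring

theorem not_summable_nuSeq_div_betaSeq (hν : 0 < a.cν) (hβ : 0 < a.cβ) (hβ0 : 0 ≤ a.β)
    (h : a.ν + a.β ≤ 1) : ¬ Summable fun n : ℕ => a.nuSeq (n + 1) / a.betaSeq n := fun hs => by
  refine not_summable_succ_rpow (s := -a.ν + -a.β) (by linarith) ?_
  -- The term `n = 0` is discarded because `betaSeq 0` vanishes when `β > 0`.
  rw [← summable_nat_add_iff 1] at hs ⊢
  refine (hs.mul_left (a.cβ / a.cν)).of_nonneg_of_le (fun n => by positivity) fun n => ?_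
  have hn : (0 : ℝ) < ((n + 1 + 1 : ℕ) : ℝ) := by exact_mod_cast (n + 1).succ_pos
  have hn' : (0 : ℝ) < ((n + 1 : ℕ) : ℝ) := by exact_mod_cast n.succ_pos
  have h1 : ((n + 1 : ℕ) : ℝ) ^ a.β ≤ ((n + 1 + 1 : ℕ) : ℝ) ^ a.β :=
    Real.rpow_le_rpow hn'.le (by push_cast; linarith) hβ0
  have h2 : a.cβ / a.cν * (a.nuSeq (n + 1 + 1) / a.betaSeq (n + 1))
      = ((n + 1 + 1 : ℕ) : ℝ) ^ (-a.ν) / ((n + 1 : ℕ) : ℝ) ^ a.β := by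
    rw [nuSeq, betaSeq]
    have := Real.rpow_pos_of_pos hn' a.β
    field_simp
  rw [h2, Real.rpow_add hn, Real.rpow_neg hn.le a.β, ← div_eq_mul_inv]
  have := Real.rpow_pos_of_pos hn' a.β
  exact div_le_div_of_nonneg_left (Real.rpow_nonneg hn.le _) this h1

end Params

end USN
end

/-! ### The algorithm as a Markov chain, and the growth and positivity of its matrices. -/

noncomputable section

namespace USN

open scoped Matrix.Norms.Frobenius

/-! ### The algorithm as a Markov chain -/

section Chain

variable {p d : ℕ}

/-- The quantities `θ_n`, `θ_{n,τ'}`, `A_n`, `A_{n,τ}`, and the product of the matrices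
`1 - γ_k Z_k Q_kᵀ` for `2 ≤ k ≤ n`. -/
abbrev ChainState (d : ℕ) : Type := Vec d × Vec d × Mat d × Mat d × Mat d

/-- One transition, from index `n` to index `n + 1`. -/
def chainStep (g : Vec p → Vec d → ℝ) (a : Params) (n : ℕ) (t : ChainState d)
    (y : Vec p × Vec d) : ChainState d :=
  let H := hessianMatrix (g y.1) t.2.1
  let th := t.1 - a.nuSeq (n + 1) • mv t.2.2.2.1 (gradient (g y.1) t.1)
  let A := frobProj (a.betaSeq' (n + 1))
    (preA (a.gammaSeq (n + 1)) (a.betaSeq (n + 1)) t.2.2.1 H y.2)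
  (th, (1 - avgWeight a.τ' (n + 1)) • t.2.1 + avgWeight a.τ' (n + 1) • th, A,
    (1 - avgWeight a.τ (n + 1)) • t.2.2.2.1 + avgWeight a.τ (n + 1) • A,
    -- The product starts after the first update, from which index on the norm bound of the
    -- projection is available.
    if n = 0 then t.2.2.2.2
    else stepM (a.gammaSeq (n + 1)) (a.betaSeq (n + 1)) t.2.2.2.2 H y.2)

/-- The chain driven by the sequences `x` and `z`. -/
def chain (g : Vec p → Vec d → ℝ) (a : Params) (θ₀ : Vec d) (A₀ : Mat d) (x : ℕ → Vec p)
    (z : ℕ → Vec d) : ℕ → ChainState d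
  | 0 => (θ₀, θ₀, A₀, A₀, 1)
  | n + 1 => chainStep g a n (chain g a θ₀ A₀ x z n) (x n, z n)

theorem chain_eq_iterate (g : Vec p → Vec d → ℝ) (a : Params) (θ₀ : Vec d) (A₀ : Mat d)
    (x : ℕ → Vec p) (z : ℕ → Vec d) (n : ℕ) :
    (chain g a θ₀ A₀ x z n).1 = (iterate g a θ₀ A₀ x z n).theta ∧
    (chain g a θ₀ A₀ x z n).2.1 = (iterate g a θ₀ A₀ x z n).thetaAvg ∧
    (chain g a θ₀ A₀ x z n).2.2.1 = (iterate g a θ₀ A₀ x z n).A ∧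
    (chain g a θ₀ A₀ x z n).2.2.2.1 = (iterate g a θ₀ A₀ x z n).AAvg := by
  induction n with
  | zero => exact ⟨rfl, rfl, rfl, rfl⟩
  | succ n ih =>
    obtain ⟨h1, h2, h3, h4⟩ := ih
    simp only [chain, iterate, chainStep, h1, h2, h3, h4]
    exact ⟨rfl, rfl, rfl, rfl⟩

/-- The chain as a stochastic process. -/
def proc {Ω : Type*} (g : Vec p → Vec d → ℝ) (Xs : ℕ → Ω → Vec p) (Zs : ℕ → Ω → Vec d) (a : Params)
    (A₀ : Mat d) (θ₀ : Vec d) (n : ℕ) (ω : Ω) : ChainState d :=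
  chain g a θ₀ A₀ (fun k => Xs k ω) (fun k => Zs k ω) n

theorem proc_succ {Ω : Type*} (g : Vec p → Vec d → ℝ) (Xs : ℕ → Ω → Vec p) (Zs : ℕ → Ω → Vec d)
    (a : Params) (A₀ : Mat d) (θ₀ : Vec d) (n : ℕ) (ω : Ω) : proc g Xs Zs a A₀ θ₀ (n + 1) ω
      = chainStep g a n (proc g Xs Zs a A₀ θ₀ n ω) (Xs n ω, Zs n ω) := rfl

end Chain

/-- The standing assumptions, in the form in which they are used. -/
structure Setting {Ω : Type*} [MeasurableSpace Ω] (P : Measure Ω) {p d : ℕ} (X : Ω → Vec p)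
    (g : Vec p → Vec d → ℝ) (θ : Vec d) (Xs : ℕ → Ω → Vec p) (Zs : ℕ → Ω → Vec d) (a : Params)
    (A₀ : Mat d) (q C K L : ℝ) : Prop where
  frame : Framework P X g θ
  A1a : AssumptionA1a P X g θ
  smooth : SmoothConvex (objective P X g) θ L
  sample : IsSample P X Xs Zs
  hess : ∀ h, HessianLaw (P.map X) (P.map (Zs 0)) (fun x => hessianMatrix (g x) h) q C K
  cγ_pos : 0 < a.cγ
  cβ_pos : 0 < a.cβ
  cβ'_pos : 0 < a.cβ'
  cν_pos : 0 < a.cν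
  lt_γ : 1 / 2 < a.γ
  γ_lt : a.γ < 1
  lt_β : (1 - a.γ) / (q - 1) < a.β
  β_lt : a.β < a.γ - 1 / 2
  γν : 3 / 2 < a.γ + a.ν
  ν_lt : a.ν < 1 - a.β
  β'_pos : 0 < a.β'
  trunc : ∀ n : ℕ, 1 ≤ n → a.gammaSeq n ^ 2 * a.betaSeq n ^ 2 * a.betaSeq' n ≤ a.gammaSeq n
  τ_nonneg : 0 ≤ a.τ
  symm : A₀.IsSymm

namespace Setting

variable {Ω : Type*} [MeasurableSpace Ω] {P : Measure Ω} {p d : ℕ} {X : Ω → Vec p}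
    {g : Vec p → Vec d → ℝ} {θ : Vec d} {Xs : ℕ → Ω → Vec p} {Zs : ℕ → Ω → Vec d} {a : Params}
    {A₀ : Mat d} {q C K L : ℝ}

theorem two_lt (s : Setting P X g θ Xs Zs a A₀ q C K L) : 2 < q := (s.hess 0).two_lt

theorem β_pos (s : Setting P X g θ Xs Zs a A₀ q C K L) : 0 < a.β :=
  (div_pos (by linarith [s.γ_lt]) (by linarith [s.two_lt])).trans s.lt_β

theorem measurable_data (s : Setting P X g θ Xs Zs a A₀ q C K L) (k : ℕ) :
    Measurable fun ω => (Xs k ω, Zs k ω) := (s.sample.measurable_X k).prodMk (s.sample.measurable_Z k)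

/-- The filtration generated by the data. -/
def hist (s : Setting P X g θ Xs Zs a A₀ q C K L) : Filtration ℕ (inferInstance : MeasurableSpace Ω) :=
  past (fun k ω => (Xs k ω, Zs k ω)) s.measurable_data

theorem indep_hist [IsProbabilityMeasure P] (s : Setting P X g θ Xs Zs a A₀ q C K L) (n : ℕ) :
    Indep (s.hist n) (MeasurableSpace.comap (fun ω => (Xs n ω, Zs n ω)) inferInstance) P :=
  indep_past s.measurable_data (iIndepFun_prodMk_of_indepFun s.sample.measurable_X
    s.sample.measurable_Z s.sample.iIndep_X s.sample.iIndep_Z s.sample.indep_XZ) n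

theorem map_data [IsProbabilityMeasure P] (s : Setting P X g θ Xs Zs a A₀ q C K L) (n : ℕ) :
    P.map (fun ω => (Xs n ω, Zs n ω)) = (P.map X).prod (P.map (Zs 0)) := by
  have h1 : IndepFun (Xs n) (Zs n) P :=
    s.sample.indep_XZ.comp (measurable_pi_apply n) (measurable_pi_apply n)
  rw [(indepFun_iff_map_prod_eq_prod_map_map (s.sample.measurable_X n).aemeasurable
    (s.sample.measurable_Z n).aemeasurable).1 h1, (s.sample.identDistrib_X n).map_eq,
    (s.sample.identDistrib_Z n).map_eq]

theorem measurable_hessian (s : Setting P X g θ Xs Zs a A₀ q C K L) :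
    Measurable fun y : Vec p × Vec d => hessianMatrix (g y.1) y.2 :=
  measurable_matrix_iff.2 s.frame.measurable_hessian

theorem measurable_chainStep (s : Setting P X g θ Xs Zs a A₀ q C K L) (n : ℕ) :
    Measurable fun y : ChainState d × (Vec p × Vec d) => chainStep g a n y.1 y.2 := by
  have ht : Measurable fun y : ChainState d × (Vec p × Vec d) => y.1.1 :=
    measurable_fst.comp measurable_fst
  have hta : Measurable fun y : ChainState d × (Vec p × Vec d) => y.1.2.1 :=
    measurable_fst.comp (measurable_snd.comp measurable_fst)
  have hA : Measurable fun y : ChainState d × (Vec p × Vec d) => y.1.2.2.1 :=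
    measurable_fst.comp (measurable_snd.comp (measurable_snd.comp measurable_fst))
  have hAa : Measurable fun y : ChainState d × (Vec p × Vec d) => y.1.2.2.2.1 :=
    measurable_fst.comp (measurable_snd.comp (measurable_snd.comp (measurable_snd.comp
      measurable_fst)))
  have hM : Measurable fun y : ChainState d × (Vec p × Vec d) => y.1.2.2.2.2 :=
    measurable_snd.comp (measurable_snd.comp (measurable_snd.comp (measurable_snd.comp
      measurable_fst)))
  have hx : Measurable fun y : ChainState d × (Vec p × Vec d) => y.2.1 :=
    measurable_fst.comp measurable_snd
  have hz : Measurable fun y : ChainState d × (Vec p × Vec d) => y.2.2 :=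
    measurable_snd.comp measurable_snd
  have hH : Measurable fun y : ChainState d × (Vec p × Vec d) => hessianMatrix (g y.2.1) y.1.2.1 :=
    s.measurable_hessian.comp (hx.prodMk hta)
  have hgr : Measurable fun y : ChainState d × (Vec p × Vec d) => gradient (g y.2.1) y.1.1 :=
    s.frame.measurable_gradient.comp (hx.prodMk ht)
  have hth : Measurable fun y : ChainState d × (Vec p × Vec d) =>
      y.1.1 - a.nuSeq (n + 1) • mv y.1.2.2.2.1 (gradient (g y.2.1) y.1.1) :=
    ht.sub ((measurable_mv hAa hgr).const_smul (a.nuSeq (n + 1)))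
  have hA' := measurable_frobProj (a.betaSeq' (n + 1))
    (measurable_preA (a.gammaSeq (n + 1)) (a.betaSeq (n + 1)) hA hH hz)
  have hM' := measurable_stepM (a.gammaSeq (n + 1)) (a.betaSeq (n + 1)) hM hH hz
  refine hth.prodMk (((hta.const_smul (1 - avgWeight a.τ' (n + 1))).add
    (hth.const_smul (avgWeight a.τ' (n + 1)))).prodMk (hA'.prodMk
    ((measurable_matrix_add (measurable_matrix_smul measurable_const hAa)
      (measurable_matrix_smul measurable_const hA')).prodMk ?_)))
  by_cases hn : n = 0
  · simp only [hn, if_true]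
    exact hM
  · simp only [hn, if_false]
    exact hM'

theorem measurable_proc (s : Setting P X g θ Xs Zs a A₀ q C K L) (θ₀ : Vec d) (n : ℕ) :
    Measurable[s.hist n] (proc g Xs Zs a A₀ θ₀ n) := by
  induction n with
  | zero => exact measurable_const
  | succ n ih =>
    exact (s.measurable_chainStep n).comp ((ih.mono (s.hist.mono n.le_succ) le_rfl).prodMk
      (measurable_past s.measurable_data n.lt_succ_self))

/-- Transition bound, conditional on the past. -/
theorem transition [IsProbabilityMeasure P] (s : Setting P X g θ Xs Zs a A₀ q C K L) (θ₀ : Vec d)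
    (n : ℕ) {f : ChainState d → Vec p × Vec d → ℝ}
    (hf : Measurable fun y : ChainState d × (Vec p × Vec d) => f y.1 y.2)
    (hf0 : ∀ t y, 0 ≤ f t y) {R : Ω → ℝ} (hRi : Integrable R P)
    (hRm : StronglyMeasurable[s.hist n] R)
    (h : ∀ ω, Integrable (f (proc g Xs Zs a A₀ θ₀ n ω)) ((P.map X).prod (P.map (Zs 0))) ∧
      ∫ y, f (proc g Xs Zs a A₀ θ₀ n ω) y ∂((P.map X).prod (P.map (Zs 0))) ≤ R ω) :
    Integrable (fun ω => f (proc g Xs Zs a A₀ θ₀ n ω) (Xs n ω, Zs n ω)) P ∧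
      P[fun ω => f (proc g Xs Zs a A₀ θ₀ n ω) (Xs n ω, Zs n ω) | s.hist n] ≤ᵐ[P] R ∧
      ∫ ω, f (proc g Xs Zs a A₀ θ₀ n ω) (Xs n ω, Zs n ω) ∂P ≤ ∫ ω, R ω ∂P := by
  rw [← s.map_data n] at h
  obtain ⟨h1, h2⟩ := condExp_le_of_indep (s.hist.le n) (s.measurable_data n) (s.indep_hist n)
    (s.measurable_proc θ₀ n) hf hf0 hRi h
  refine ⟨h1, h2 hRm, ?_⟩
  exact (integral_le_of_indep (s.hist.le n) (s.measurable_data n) (s.indep_hist n)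
    (s.measurable_proc θ₀ n) hf hf0 hRi hRm h).2

theorem proc_isSymm (s : Setting P X g θ Xs Zs a A₀ q C K L) (θ₀ : Vec d) (n : ℕ) (ω : Ω) :
    (proc g Xs Zs a A₀ θ₀ n ω).2.2.1.IsSymm := by
  induction n with
  | zero => exact s.symm
  | succ n ih => exact frobProj_isSymm (Params.betaSeq'_nonneg s.cβ'_pos _) (preA_isSymm ih)

theorem norm_proc_le (s : Setting P X g θ Xs Zs a A₀ q C K L) (θ₀ : Vec d) {n : ℕ} (hn : 1 ≤ n)
    (ω : Ω) : ‖(proc g Xs Zs a A₀ θ₀ n ω).2.2.1‖ ≤ a.betaSeq' n := by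
  obtain ⟨n, rfl⟩ : ∃ m, n = m + 1 := ⟨n - 1, by omega⟩
  exact norm_frobProj_le (Params.betaSeq'_nonneg s.cβ'_pos _) _

/-- For each fixed `n` the matrices are bounded uniformly in `ω`; these crude bounds serve only for
integrability. -/
theorem exists_norm_le (s : Setting P X g θ Xs Zs a A₀ q C K L) (θ₀ : Vec d) (n : ℕ) :
    ∃ c : ℝ, 0 ≤ c ∧ ∀ ω : Ω, ‖(proc g Xs Zs a A₀ θ₀ n ω).2.2.1‖ ≤ c ∧
      ‖(proc g Xs Zs a A₀ θ₀ n ω).2.2.2.1‖ ≤ c := by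
  induction n with
  | zero => exact ⟨‖A₀‖, norm_nonneg _, fun ω => ⟨le_rfl, le_rfl⟩⟩
  | succ n ih =>
    obtain ⟨c, hc0, hc⟩ := ih
    have hb := Params.betaSeq'_nonneg (a := a) s.cβ'_pos (n + 1)
    refine ⟨c + a.betaSeq' (n + 1), by positivity, fun ω => ?_⟩
    have h1 := s.norm_proc_le θ₀ (n := n + 1) (by omega) ω
    refine ⟨by linarith, ?_⟩
    have hw0 := avgWeight_nonneg a.τ (n + 1)
    have hw1 := avgWeight_le_one a.τ (n + 1)
    change ‖(1 - avgWeight a.τ (n + 1)) • (proc g Xs Zs a A₀ θ₀ n ω).2.2.2.1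
      + avgWeight a.τ (n + 1) • (proc g Xs Zs a A₀ θ₀ (n + 1) ω).2.2.1‖ ≤ _
    refine (norm_add_le _ _).trans ?_
    rw [norm_smul, norm_smul, Real.norm_of_nonneg hw0, Real.norm_of_nonneg (sub_nonneg.2 hw1)]
    have h2 := mul_le_of_le_one_left hc0 (by linarith : 1 - avgWeight a.τ (n + 1) ≤ 1)
    have h3 := mul_le_mul_of_nonneg_left (hc ω).2 (sub_nonneg.2 hw1)
    have h4 := mul_le_mul_of_nonneg_left h1 hw0
    have h5 := mul_le_of_le_one_left hb hw1
    linarith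

/-! ### The matrices -/

section Measurability

theorem measurable_A (s : Setting P X g θ Xs Zs a A₀ q C K L) (θ₀ : Vec d) (n : ℕ) :
    StronglyMeasurable[s.hist n] fun ω => ‖(proc g Xs Zs a A₀ θ₀ n ω).2.2.1‖ :=
  ((measurable_frobenius_norm (f := fun t : ChainState d => t.2.2.1)
    (measurable_fst.comp (measurable_snd.comp measurable_snd))).comp
      (s.measurable_proc θ₀ n)).stronglyMeasurable

theorem measurable_AAvg (s : Setting P X g θ Xs Zs a A₀ q C K L) (θ₀ : Vec d) (n : ℕ) :
    StronglyMeasurable[s.hist n] fun ω => ‖(proc g Xs Zs a A₀ θ₀ n ω).2.2.2.1‖ :=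
  ((measurable_frobenius_norm (f := fun t : ChainState d => t.2.2.2.1)
    (measurable_fst.comp (measurable_snd.comp (measurable_snd.comp measurable_snd)))).comp
      (s.measurable_proc θ₀ n)).stronglyMeasurable

theorem measurable_M (s : Setting P X g θ Xs Zs a A₀ q C K L) (θ₀ : Vec d) (n : ℕ) :
    StronglyMeasurable[s.hist n] fun ω => ‖(proc g Xs Zs a A₀ θ₀ n ω).2.2.2.2‖ :=
  ((measurable_frobenius_norm (f := fun t : ChainState d => t.2.2.2.2)
    (measurable_snd.comp (measurable_snd.comp (measurable_snd.comp measurable_snd)))).comp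
      (s.measurable_proc θ₀ n)).stronglyMeasurable

end Measurability

theorem driftError_nonneg (s : Setting P X g θ Xs Zs a A₀ q C K L) (n : ℕ) :
    0 ≤ driftError q C K (a.gammaSeq (n + 1)) (a.betaSeq (n + 1)) :=
  USN.driftError_nonneg (s.hess 0).C_nonneg (Params.gammaSeq_pos s.cγ_pos (by omega)).le
    (Params.betaSeq_pos s.cβ_pos (by omega)).le

theorem summable_driftError (s : Setting P X g θ Xs Zs a A₀ q C K L) :
    Summable fun n : ℕ => driftError q C K (a.gammaSeq (n + 1)) (a.betaSeq (n + 1)) :=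
  Params.summable_driftError s.cβ_pos s.lt_γ (by linarith [s.two_lt]) s.lt_β

theorem matrixRecursion (s : Setting P X g θ Xs Zs a A₀ q C K L) (θ₀ : Vec d) (ω : Ω) :
    MatrixRecursion a.gammaSeq a.betaSeq a.betaSeq' (fun n => (proc g Xs Zs a A₀ θ₀ n ω).2.2.1)
      (fun n => (proc g Xs Zs a A₀ θ₀ n ω).2.2.2.2)
      (fun n => hessianMatrix (g (Xs n ω)) (proc g Xs Zs a A₀ θ₀ n ω).2.1) (fun n => Zs n ω) where
  γ_pos _ hn := Params.gammaSeq_pos s.cγ_pos hn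
  b_pos _ hn := Params.betaSeq_pos s.cβ_pos hn
  b_mono n _ := Params.betaSeq_le_succ s.cβ_pos s.β_pos.le n
  r_pos _ hn := Params.betaSeq'_pos s.cβ'_pos hn
  r_mono n _ := Params.betaSeq'_le_succ s.cβ'_pos s.β'_pos.le n
  trunc := s.trunc
  symm n := s.proc_isSymm θ₀ n ω
  norm_le _ hn := s.norm_proc_le θ₀ hn ω
  A_succ _ _ := rfl
  M_one := rfl
  M_succ n hn := by
    rw [proc_succ, chainStep]
    exact if_neg (by omega)

variable [IsProbabilityMeasure P]

theorem isProbabilityMeasure_X (s : Setting P X g θ Xs Zs a A₀ q C K L) :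
    IsProbabilityMeasure (P.map X) := Measure.isProbabilityMeasure_map s.frame.measurable_X.aemeasurable

theorem isProbabilityMeasure_Z (s : Setting P X g θ Xs Zs a A₀ q C K L) :
    IsProbabilityMeasure (P.map (Zs 0)) :=
  Measure.isProbabilityMeasure_map (s.sample.measurable_Z 0).aemeasurable

theorem M_step (s : Setting P X g θ Xs Zs a A₀ q C K L) (θ₀ : Vec d) (n : ℕ)
    (hi : Integrable (fun ω => ‖(proc g Xs Zs a A₀ θ₀ n ω).2.2.2.2‖ ^ 2) P) :
    Integrable (fun ω => ‖(proc g Xs Zs a A₀ θ₀ (n + 1) ω).2.2.2.2‖ ^ 2) P ∧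
      P[fun ω => ‖(proc g Xs Zs a A₀ θ₀ (n + 1) ω).2.2.2.2‖ ^ 2 | s.hist n] ≤ᵐ[P]
        fun ω => (1 + driftError q C K (a.gammaSeq (n + 1)) (a.betaSeq (n + 1)))
          * ‖(proc g Xs Zs a A₀ θ₀ n ω).2.2.2.2‖ ^ 2 := by
  have := s.isProbabilityMeasure_X
  have := s.isProbabilityMeasure_Z
  have hγ := (Params.gammaSeq_pos s.cγ_pos (by omega : 1 ≤ n + 1)).le
  have hβ := Params.betaSeq_pos s.cβ_pos (by omega : 1 ≤ n + 1)
  have h := s.transition θ₀ n (f := fun t y => ‖(chainStep g a n t y).2.2.2.2‖ ^ 2)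
    ((measurable_frobenius_norm (f := fun y : ChainState d × (Vec p × Vec d) =>
      (chainStep g a n y.1 y.2).2.2.2.2) (measurable_snd.comp (measurable_snd.comp
        (measurable_snd.comp (measurable_snd.comp (s.measurable_chainStep n)))))).pow_const 2)
    (fun _ _ => sq_nonneg _)
    (R := fun ω => (1 + driftError q C K (a.gammaSeq (n + 1)) (a.betaSeq (n + 1)))
          * ‖(proc g Xs Zs a A₀ θ₀ n ω).2.2.2.2‖ ^ 2) (hi.const_mul _)
    (((s.measurable_M θ₀ n).pow 2).const_mul _) (fun ω => by
      by_cases hn : n = 0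
      · simp only [chainStep, hn, if_true, integral_const, probReal_univ, smul_eq_mul, one_mul]
        refine ⟨integrable_const _, le_mul_of_one_le_left (sq_nonneg _) ?_⟩
        have := s.driftError_nonneg 0
        linarith
      · simp only [chainStep, hn, if_false]
        exact (s.hess _).integral_norm_sq_stepM_le hγ hβ _)
  exact ⟨h.1, h.2.1⟩

theorem integrable_M (s : Setting P X g θ Xs Zs a A₀ q C K L) (θ₀ : Vec d) (n : ℕ) :
    Integrable (fun ω => ‖(proc g Xs Zs a A₀ θ₀ n ω).2.2.2.2‖ ^ 2) P := by
  induction n with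
  | zero => exact integrable_const (‖(1 : Mat d)‖ ^ 2)
  | succ n ih => exact (s.M_step θ₀ n ih).1

/-- The products stay bounded almost surely. -/
theorem ae_bounded_M (s : Setting P X g θ Xs Zs a A₀ q C K L) (θ₀ : Vec d) :
    ∀ᵐ ω ∂P, ∃ B, ∀ n, ‖(proc g Xs Zs a A₀ θ₀ n ω).2.2.2.2‖ ^ 2 ≤ B := by
  have h := ae_tendsto_of_condExp_le (P := P) (F := s.hist)
    (V := fun n ω => ‖(proc g Xs Zs a A₀ θ₀ n ω).2.2.2.2‖ ^ 2)
    (a := fun n _ => driftError q C K (a.gammaSeq (n + 1)) (a.betaSeq (n + 1)))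
    (b := fun _ _ => 0) (c := fun _ _ => 0)
    (fun _ _ => sq_nonneg _) (fun n _ => s.driftError_nonneg n) (fun _ _ => le_rfl)
    (fun _ _ => le_rfl) (fun n => (s.measurable_M θ₀ n).pow 2) (fun _ => stronglyMeasurable_const)
    (fun _ => stronglyMeasurable_const) (fun _ => stronglyMeasurable_const)
    (s.integrable_M θ₀) (fun _ => integrable_zero _ _ _) (fun _ => integrable_zero _ _ _)
    (fun n => by
      simp only [add_zero, sub_zero]
      exact (s.M_step θ₀ n (s.integrable_M θ₀ n)).2)
    (Eventually.of_forall fun _ => s.summable_driftError)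
    (Eventually.of_forall fun _ => summable_zero)
  filter_upwards [h] with ω hω
  obtain ⟨⟨l, hl⟩, -⟩ := hω
  obtain ⟨B, hB⟩ := hl.bddAbove_range
  exact ⟨B, fun n => hB ⟨n, rfl⟩⟩

variable (g Xs Zs a A₀) in
/-- The truncation indicator of the step from `n` to `n + 1`. -/
def gateProc (θ₀ : Vec d) (n : ℕ) (ω : Ω) : ℝ :=
  gate (a.betaSeq (n + 1)) (hessianMatrix (g (Xs n ω)) (proc g Xs Zs a A₀ θ₀ n ω).2.1) (Zs n ω)

/-- The weights `γ` carried by truncated steps have summable expectations, whereas the sum of all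
the `γ` diverges. -/
theorem ae_tendsto_sum_gate (s : Setting P X g θ Xs Zs a A₀ q C K L) (θ₀ : Vec d) :
    ∀ᵐ ω ∂P, Tendsto (fun n => ∑ k ∈ Finset.range n,
      a.gammaSeq (k + 1) * gateProc g Xs Zs a A₀ θ₀ k ω) atTop atTop := by
  have := s.isProbabilityMeasure_X
  have := s.isProbabilityMeasure_Z
  have hstep : ∀ n, Integrable
      (fun ω => a.gammaSeq (n + 1) * (1 - gateProc g Xs Zs a A₀ θ₀ n ω)) P ∧
      ∫ ω, a.gammaSeq (n + 1) * (1 - gateProc g Xs Zs a A₀ θ₀ n ω) ∂P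
        ≤ a.cβ⁻¹ * driftError q C K (a.gammaSeq (n + 1)) (a.betaSeq (n + 1)) := by
    intro n
    have hγ := (Params.gammaSeq_pos s.cγ_pos (by omega : 1 ≤ n + 1)).le
    have hβ := Params.le_betaSeq s.cβ_pos s.β_pos.le (by omega : 1 ≤ n + 1)
    have h := s.transition θ₀ n
      (f := fun t y => a.gammaSeq (n + 1) * (1 - gate (a.betaSeq (n + 1))
        (hessianMatrix (g y.1) t.2.1) y.2))
      (((measurable_gate _ (s.measurable_hessian.comp
        ((measurable_fst.comp measurable_snd).prodMk
          (measurable_fst.comp (measurable_snd.comp measurable_fst))))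
        (measurable_snd.comp measurable_snd)).const_sub 1).const_mul _)
      (fun _ _ => mul_nonneg hγ (sub_nonneg.2 (gate_le_one _ _ _)))
      (R := fun _ => a.cβ⁻¹ * driftError q C K (a.gammaSeq (n + 1)) (a.betaSeq (n + 1)))
      (integrable_const _) stronglyMeasurable_const
      (fun ω => (s.hess _).integral_one_sub_gate_le hγ s.cβ_pos hβ)
    refine ⟨h.1, h.2.2.trans ?_⟩
    simp
  have hsum := ae_summable_of_integral_le (P := P)
    (fun n ω => mul_nonneg (Params.gammaSeq_pos s.cγ_pos (by omega : 1 ≤ n + 1)).le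
      (sub_nonneg.2 (gate_le_one _ _ _))) (fun n => (hstep n).1)
    (s.summable_driftError.mul_left _) (fun n => (hstep n).2)
  filter_upwards [hsum] with ω hω
  refine (not_summable_iff_tendsto_nat_atTop_of_nonneg fun n =>
    mul_nonneg (Params.gammaSeq_pos s.cγ_pos (by omega : 1 ≤ n + 1)).le (gate_nonneg _ _ _)).1 ?_
  intro hs
  refine Params.not_summable_gammaSeq s.cγ_pos s.γ_lt ((hs.add hω).congr fun n => ?_)
  ring

/-- The smallest eigenvalue of the averaged matrices is eventually at least a multiple of
`1 / β_n`. -/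
theorem ae_exists_AAvg_ge (s : Setting P X g θ Xs Zs a A₀ q C K L) (θ₀ : Vec d) :
    ∀ᵐ ω ∂P, ∃ c, 0 < c ∧ ∀ᶠ n in atTop, ∀ x, c / a.betaSeq n * (x ⬝ᵥ x)
      ≤ x ⬝ᵥ ((proc g Xs Zs a A₀ θ₀ n ω).2.2.2.1).mulVec x := by
  filter_upwards [s.ae_bounded_M θ₀, s.ae_tendsto_sum_gate θ₀] with ω h1 h2
  obtain ⟨B, hB⟩ := h1
  have hcc : 0 < a.cβ * a.cβ' := mul_pos s.cβ_pos s.cβ'_pos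
  obtain ⟨c, hc, N, hN⟩ := (s.matrixRecursion θ₀ ω).exists_quadForm_ge
    -- As `β_n β'_n ≥ c_β c'_β` for `n ≥ 1`, the second summand of `κ` absorbs `2 * √d`.
    (κ := 2 + 2 * √d / (a.cβ * a.cβ')) hB h2 (le_add_of_nonneg_right (by positivity))
    (fun n hn => by
      have g1 := Params.le_betaSeq s.cβ_pos s.β_pos.le hn
      have g2 := Params.le_betaSeq' s.cβ'_pos s.β'_pos.le hn
      have g3 : a.cβ * a.cβ' ≤ a.betaSeq n * a.betaSeq' n :=
        mul_le_mul g1 g2 s.cβ'_pos.le (s.cβ_pos.le.trans g1)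
      have g4 : 2 * √d ≤ 2 * √d / (a.cβ * a.cβ') * (a.betaSeq n * a.betaSeq' n) := by
        calc 2 * √d = 2 * √d / (a.cβ * a.cβ') * (a.cβ * a.cβ') :=
            (div_mul_cancel₀ _ hcc.ne').symm
          _ ≤ _ := by gcongr
      linarith)
    (by
      have := (Params.tendsto_gammaSeq_mul_betaSeq (a := a)
        (by linarith [s.β_lt, s.lt_γ])).const_mul (2 + 2 * √d / (a.cβ * a.cβ'))
      rw [mul_zero] at this
      exact (this.eventually_lt_const (by norm_num : (0 : ℝ) < 1 / 2)).mono fun n hn => hn.le)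
  refine ⟨c / 2, by positivity, ?_⟩
  have h := exists_avg_quadForm_ge s.τ_nonneg
    (A := fun n => (proc g Xs Zs a A₀ θ₀ n ω).2.2.1)
    (B := fun n => (proc g Xs Zs a A₀ θ₀ n ω).2.2.2.1) rfl (fun n => rfl)
    (b := a.betaSeq) (fun n hn => Params.betaSeq_pos s.cβ_pos hn)
    (fun n _ => Params.betaSeq_le_succ s.cβ_pos s.β_pos.le n)
    (Params.tendsto_betaSeq_div (by linarith [s.β_lt, s.γ_lt])) hc hN
  refine h.mono fun n hn x => ?_
  rw [div_div]
  exact hn x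

/-- One step for the second moment of the matrices. -/
theorem A_step (s : Setting P X g θ Xs Zs a A₀ q C K L) (θ₀ : Vec d) (n : ℕ) :
    ∫ ω, ‖(proc g Xs Zs a A₀ θ₀ (n + 1) ω).2.2.1‖ ^ 2 ∂P ≤
      ∫ ω, ((1 + 8 * driftError q C K (a.gammaSeq (n + 1)) (a.betaSeq (n + 1)))
          * ‖(proc g Xs Zs a A₀ θ₀ n ω).2.2.1‖ ^ 2
        + 4 * a.gammaSeq (n + 1) * √d * ‖(proc g Xs Zs a A₀ θ₀ n ω).2.2.1‖
        + 8 * a.gammaSeq (n + 1) ^ 2 * d) ∂P := by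
  have := s.isProbabilityMeasure_X
  have := s.isProbabilityMeasure_Z
  have hγ := (Params.gammaSeq_pos s.cγ_pos (by omega : 1 ≤ n + 1)).le
  have hβ := Params.betaSeq_pos s.cβ_pos (by omega : 1 ≤ n + 1)
  obtain ⟨c, hc0, hc⟩ := s.exists_norm_le θ₀ n
  have hm := s.measurable_A θ₀ n
  have hm0 := (hm.mono (s.hist.le n)).aestronglyMeasurable (μ := P)
  have hi1 : Integrable (fun ω => ‖(proc g Xs Zs a A₀ θ₀ n ω).2.2.1‖) P :=
    (integrable_const c).mono' hm0 (Eventually.of_forall fun ω => by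
      rw [norm_norm]; exact (hc ω).1)
  have hi2 : Integrable (fun ω => ‖(proc g Xs Zs a A₀ θ₀ n ω).2.2.1‖ ^ 2) P :=
    (integrable_const (c ^ 2)).mono' (hm0.pow 2) (Eventually.of_forall fun ω => by
      rw [Real.norm_of_nonneg (sq_nonneg _)]
      have := (hc ω).1
      gcongr)
  exact (s.transition θ₀ n (f := fun t y => ‖(chainStep g a n t y).2.2.1‖ ^ 2)
    ((measurable_frobenius_norm (f := fun y : ChainState d × (Vec p × Vec d) =>
      (chainStep g a n y.1 y.2).2.2.1) (measurable_fst.comp (measurable_snd.comp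
        (measurable_snd.comp (s.measurable_chainStep n))))).pow_const 2)
    (fun _ _ => sq_nonneg _) (((hi2.const_mul _).add (hi1.const_mul _)).add (integrable_const _))
    ((((hm.pow 2).const_mul _).add (hm.const_mul _)).add stronglyMeasurable_const)
    (fun ω => (s.hess _).integral_norm_sq_frobProj_preA_le hγ hβ
      (Params.betaSeq'_nonneg s.cβ'_pos _) (s.proc_isSymm θ₀ n ω))).2.2

theorem integrable_norm_sq (s : Setting P X g θ Xs Zs a A₀ q C K L) (θ₀ : Vec d) (n : ℕ) :
    Integrable (fun ω => ‖(proc g Xs Zs a A₀ θ₀ n ω).2.2.1‖) P ∧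
    Integrable (fun ω => ‖(proc g Xs Zs a A₀ θ₀ n ω).2.2.1‖ ^ 2) P ∧
    Integrable (fun ω => ‖(proc g Xs Zs a A₀ θ₀ n ω).2.2.2.1‖ ^ 2) P := by
  obtain ⟨c, hc0, hc⟩ := s.exists_norm_le θ₀ n
  have hm0 := ((s.measurable_A θ₀ n).mono (s.hist.le n)).aestronglyMeasurable (μ := P)
  have hm1 := ((s.measurable_AAvg θ₀ n).mono (s.hist.le n)).aestronglyMeasurable (μ := P)
  refine ⟨(integrable_const c).mono' hm0 (Eventually.of_forall fun ω => by
      rw [norm_norm]; exact (hc ω).1),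
    (integrable_const (c ^ 2)).mono' (hm0.pow 2) (Eventually.of_forall fun ω => ?_),
    (integrable_const (c ^ 2)).mono' (hm1.pow 2) (Eventually.of_forall fun ω => ?_)⟩
  · rw [Real.norm_of_nonneg (sq_nonneg _)]
    have := (hc ω).1
    gcongr
  · rw [Real.norm_of_nonneg (sq_nonneg _)]
    have := (hc ω).2
    gcongr

theorem sq_integral_le_integral_sq {f : Ω → ℝ} (hf : Integrable f P)
    (hf2 : Integrable (fun ω => f ω ^ 2) P) : (∫ ω, f ω ∂P) ^ 2 ≤ ∫ ω, f ω ^ 2 ∂P := by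
  set m := ∫ ω, f ω ∂P
  have h1 : 0 ≤ ∫ ω, (f ω - m) ^ 2 ∂P := integral_nonneg fun _ => sq_nonneg _
  have e : ∀ ω, (f ω - m) ^ 2 = f ω ^ 2 - 2 * m * f ω + m ^ 2 := fun ω => by ring
  simp_rw [e] at h1
  have hi : Integrable (fun ω => f ω ^ 2 - 2 * m * f ω) P := hf2.sub (hf.const_mul _)
  rw [integral_add hi (integrable_const _), integral_sub hf2 (hf.const_mul _), integral_const_mul] at h1
  simp only [integral_const, probReal_univ, smul_eq_mul, one_mul] at h1
  change 0 ≤ ∫ ω, f ω ^ 2 ∂P - 2 * m * m + m ^ 2 at h1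
  linarith

/-- The second moment of the matrices is `O(n^{2(1 - γ)})`. -/
theorem exists_integral_norm_sq_le (s : Setting P X g θ Xs Zs a A₀ q C K L) (θ₀ : Vec d) :
    ∃ D, 0 < D ∧ ∀ n : ℕ, ∫ ω, ‖(proc g Xs Zs a A₀ θ₀ n ω).2.2.1‖ ^ 2 ∂P
      ≤ (D * ((n + 1 : ℕ) : ℝ) ^ (1 - a.γ)) ^ 2 := by
  let u : ℕ → ℝ := fun n => √(∫ ω, ‖(proc g Xs Zs a A₀ θ₀ n ω).2.2.1‖ ^ 2 ∂P)
  have hI0 : ∀ n, 0 ≤ ∫ ω, ‖(proc g Xs Zs a A₀ θ₀ n ω).2.2.1‖ ^ 2 ∂P := fun n =>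
    integral_nonneg fun _ => sq_nonneg _
  have hu0 : ∀ n, 0 ≤ u n := fun n => Real.sqrt_nonneg _
  have hγ : ∀ n, 0 ≤ a.gammaSeq (n + 1) := fun n => (Params.gammaSeq_pos s.cγ_pos (by omega)).le
  have hstep : ∀ n, u (n + 1) ≤
      (1 + 8 * driftError q C K (a.gammaSeq (n + 1)) (a.betaSeq (n + 1))) * u n
        + 4 * √d * a.gammaSeq (n + 1) := by
    intro n
    have hE := s.driftError_nonneg n
    set E := driftError q C K (a.gammaSeq (n + 1)) (a.betaSeq (n + 1))
    have hγn := hγ n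
    have hun := hu0 n
    obtain ⟨hi1, hi2, -⟩ := s.integrable_norm_sq θ₀ n
    have h1 := s.A_step θ₀ n
    have hi3 : Integrable (fun ω => (1 + 8 * E) * ‖(proc g Xs Zs a A₀ θ₀ n ω).2.2.1‖ ^ 2
        + 4 * a.gammaSeq (n + 1) * √d * ‖(proc g Xs Zs a A₀ θ₀ n ω).2.2.1‖) P :=
      (hi2.const_mul _).add (hi1.const_mul _)
    rw [integral_add hi3 (integrable_const _),
      integral_add (hi2.const_mul _) (hi1.const_mul _), integral_const_mul,
      integral_const_mul] at h1
    simp only [integral_const, probReal_univ, smul_eq_mul, one_mul] at h1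
    have h2 : ∫ ω, ‖(proc g Xs Zs a A₀ θ₀ n ω).2.2.1‖ ∂P ≤ u n :=
      Real.le_sqrt_of_sq_le (sq_integral_le_integral_sq hi1 hi2)
    have h3 : ∫ ω, ‖(proc g Xs Zs a A₀ θ₀ n ω).2.2.1‖ ^ 2 ∂P = u n ^ 2 := (Real.sq_sqrt (hI0 n)).symm
    rw [h3] at h1
    -- The square of the right-hand side dominates the recursive bound term by term, so the root
    -- mean square obeys a recursion with additive error of order `γ`.
    refine Real.sqrt_le_iff.2 ⟨by positivity, h1.trans ?_⟩
    have hd : (√d : ℝ) ^ 2 = d := Real.sq_sqrt (Nat.cast_nonneg d)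
    have h4 : 4 * a.gammaSeq (n + 1) * √d * ∫ ω, ‖(proc g Xs Zs a A₀ θ₀ n ω).2.2.1‖ ∂P
        ≤ 4 * a.gammaSeq (n + 1) * √d * u n := by gcongr
    have h5 : (1 + 8 * E) * u n ^ 2 ≤ (1 + 8 * E) ^ 2 * u n ^ 2 := by
      gcongr
      nlinarith
    have h6 : a.gammaSeq (n + 1) * √d * u n ≤ (1 + 8 * E) * (a.gammaSeq (n + 1) * √d * u n) :=
      le_mul_of_one_le_left (by positivity) (by linarith)
    have h7 : 0 ≤ a.gammaSeq (n + 1) * √d * u n := by positivity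
    have h8 : 0 ≤ a.gammaSeq (n + 1) ^ 2 * (√d) ^ 2 := by positivity
    have h9 : a.gammaSeq (n + 1) ^ 2 * (√d) ^ 2 = a.gammaSeq (n + 1) ^ 2 * d := by rw [hd]
    linarith
  obtain ⟨D, hD, hle⟩ := exists_le_of_le_one_add_mul_add (u := u)
    (fun n => mul_nonneg (by norm_num) (s.driftError_nonneg n))
    (fun n => mul_nonneg (by positivity) (hγ n)) (hu0 0) (s.summable_driftError.mul_left 8) hstep
  have hγ1 : 0 < 1 - a.γ := by linarith [s.γ_lt]
  have hcγ := s.cγ_pos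
  refine ⟨D * (1 + 4 * √d * a.cγ / (1 - a.γ)), by positivity, fun n => ?_⟩
  rw [← Real.sq_sqrt (hI0 n)]
  have hn1 : (1 : ℝ) ≤ ((n + 1 : ℕ) : ℝ) ^ (1 - a.γ) :=
    Real.one_le_rpow (by exact_mod_cast Nat.succ_pos n) hγ1.le
  have hsum : ∑ k ∈ Finset.range n, 4 * √d * a.gammaSeq (k + 1)
      ≤ 4 * √d * a.cγ / (1 - a.γ) * ((n + 1 : ℕ) : ℝ) ^ (1 - a.γ) := by
    have h1 := sum_succ_rpow_le (s := a.γ) (by linarith [s.lt_γ]) s.γ_lt n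
    have h2 : (n : ℝ) ^ (1 - a.γ) ≤ ((n + 1 : ℕ) : ℝ) ^ (1 - a.γ) :=
      Real.rpow_le_rpow (Nat.cast_nonneg n) (by push_cast; linarith) hγ1.le
    simp only [Params.gammaSeq, ← Finset.mul_sum]
    rw [div_mul_eq_mul_div, le_div_iff₀ hγ1]
    calc _ = 4 * √d * a.cγ * ((1 - a.γ) * ∑ k ∈ Finset.range n, ((k + 1 : ℕ) : ℝ) ^ (-a.γ)) := by
          ring
      _ ≤ _ := by
        gcongr
        exact h1.trans h2
  have h3 : u n ≤ D * (1 + 4 * √d * a.cγ / (1 - a.γ)) * ((n + 1 : ℕ) : ℝ) ^ (1 - a.γ) := by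
    refine (hle n).trans ?_
    rw [mul_assoc]
    refine mul_le_mul_of_nonneg_left ?_ hD.le
    linarith
  have := hu0 n
  change u n ^ 2 ≤ _
  gcongr

/-- By convexity of the square, an average inherits a nondecreasing bound on the second moments. -/
theorem integral_AAvg_sq_le (s : Setting P X g θ Xs Zs a A₀ q C K L) (θ₀ : Vec d) {U : ℕ → ℝ}
    (hU : Monotone U) (hA : ∀ n, ∫ ω, ‖(proc g Xs Zs a A₀ θ₀ n ω).2.2.1‖ ^ 2 ∂P ≤ U n) (n : ℕ) :
    ∫ ω, ‖(proc g Xs Zs a A₀ θ₀ n ω).2.2.2.1‖ ^ 2 ∂P ≤ U n := by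
  induction n with
  | zero => exact hA 0
  | succ n ih =>
    have hw0 := avgWeight_nonneg a.τ (n + 1)
    have hw1 := sub_nonneg.2 (avgWeight_le_one a.τ (n + 1))
    set w := avgWeight a.τ (n + 1) with hw
    have hi := (s.integrable_norm_sq θ₀ n).2.2
    have hi1 := (s.integrable_norm_sq θ₀ (n + 1)).2.1
    have h1 : ∀ ω, ‖(proc g Xs Zs a A₀ θ₀ (n + 1) ω).2.2.2.1‖ ^ 2
        ≤ (1 - w) * ‖(proc g Xs Zs a A₀ θ₀ n ω).2.2.2.1‖ ^ 2
          + w * ‖(proc g Xs Zs a A₀ θ₀ (n + 1) ω).2.2.1‖ ^ 2 := by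
      intro ω
      have h2 : ‖(proc g Xs Zs a A₀ θ₀ (n + 1) ω).2.2.2.1‖
          ≤ (1 - w) * ‖(proc g Xs Zs a A₀ θ₀ n ω).2.2.2.1‖
            + w * ‖(proc g Xs Zs a A₀ θ₀ (n + 1) ω).2.2.1‖ := by
        change ‖(1 - w) • (proc g Xs Zs a A₀ θ₀ n ω).2.2.2.1
          + w • (proc g Xs Zs a A₀ θ₀ (n + 1) ω).2.2.1‖ ≤ _
        refine (norm_add_le _ _).trans ?_
        rw [norm_smul, norm_smul, Real.norm_of_nonneg hw0, Real.norm_of_nonneg hw1]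
      generalize ‖(proc g Xs Zs a A₀ θ₀ (n + 1) ω).2.2.1‖ = y at *
      generalize ‖(proc g Xs Zs a A₀ θ₀ n ω).2.2.2.1‖ = x at *
      have h3 := pow_le_pow_left₀ (norm_nonneg _) h2 2
      have h4 := mul_nonneg (mul_nonneg hw0 hw1) (sq_nonneg (x - y))
      refine h3.trans ?_
      linarith
    refine (integral_mono (s.integrable_norm_sq θ₀ (n + 1)).2.2
      ((hi.const_mul _).add (hi1.const_mul _)) h1).trans ?_
    rw [integral_add' (hi.const_mul _) (hi1.const_mul _), integral_const_mul, integral_const_mul]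
    have h5 := mul_le_mul_of_nonneg_left (ih.trans (hU n.le_succ)) hw1
    have h6 := mul_le_mul_of_nonneg_left (hA (n + 1)) hw0
    linarith

theorem ae_summable_nuSeq_sq_mul_AAvg_sq (s : Setting P X g θ Xs Zs a A₀ q C K L) (θ₀ : Vec d) :
    ∀ᵐ ω ∂P, Summable fun n =>
      a.nuSeq (n + 1) ^ 2 * ‖(proc g Xs Zs a A₀ θ₀ n ω).2.2.2.1‖ ^ 2 := by
  obtain ⟨D, hD, hle⟩ := s.exists_integral_norm_sq_le θ₀
  have hmono : Monotone fun n : ℕ => (D * ((n + 1 : ℕ) : ℝ) ^ (1 - a.γ)) ^ 2 := by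
    intro m n hmn
    have : ((m + 1 : ℕ) : ℝ) ≤ ((n + 1 : ℕ) : ℝ) := by exact_mod_cast Nat.succ_le_succ hmn
    have hγ : 0 ≤ 1 - a.γ := by linarith [s.γ_lt]
    simp only
    gcongr
  refine ae_summable_of_integral_le (fun n ω => by positivity)
    (fun n => (s.integrable_norm_sq θ₀ n).2.2.const_mul _)
    (Params.summable_nuSeq_sq_mul s.γν D) fun n => ?_
  rw [integral_const_mul]
  exact mul_le_mul_of_nonneg_left (s.integral_AAvg_sq_le θ₀ hmono hle n) (sq_nonneg _)

end Setting

end USN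
end

/-! ### Almost sure convergence. -/

noncomputable section

namespace USN

open scoped Matrix.Norms.Frobenius

theorem StronglyMeasurable.max_zero {α : Type*} {m : MeasurableSpace α} {f : α → ℝ}
    (hf : StronglyMeasurable[m] f) : StronglyMeasurable[m] fun x => max (f x) 0 :=
  (continuous_id.max continuous_const).comp_stronglyMeasurable hf

namespace Setting

variable {Ω : Type*} [MeasurableSpace Ω] {P : Measure Ω} {p d : ℕ} {X : Ω → Vec p}
    {g : Vec p → Vec d → ℝ} {θ : Vec d} {Xs : ℕ → Ω → Vec p} {Zs : ℕ → Ω → Vec d} {a : Params}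
    {A₀ : Mat d} {q C K L : ℝ}

/-! ### Convergence -/

/-- The excess `G(θ_n) - G(θ)`. -/
def excess (_ : Setting P X g θ Xs Zs a A₀ q C K L) (θ₀ : Vec d) (n : ℕ) (ω : Ω) : ℝ :=
  objective P X g (proc g Xs Zs a A₀ θ₀ n ω).1 - objective P X g θ

/-- The expected decrease `ν_{n+1} ⟨∇G(θ_n), A_{n,τ} ∇G(θ_n)⟩`. -/
def decrease (_ : Setting P X g θ Xs Zs a A₀ q C K L) (θ₀ : Vec d) (n : ℕ) (ω : Ω) : ℝ :=
  a.nuSeq (n + 1) * inner ℝ (gradient (objective P X g) (proc g Xs Zs a A₀ θ₀ n ω).1)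
    (mv (proc g Xs Zs a A₀ θ₀ n ω).2.2.2.1
      (gradient (objective P X g) (proc g Xs Zs a A₀ θ₀ n ω).1))

/-- The squared step `ν_{n+1}² ‖A_{n,τ}‖²`. -/
def sqStep (_ : Setting P X g θ Xs Zs a A₀ q C K L) (θ₀ : Vec d) (n : ℕ) (ω : Ω) : ℝ :=
  a.nuSeq (n + 1) ^ 2 * ‖(proc g Xs Zs a A₀ θ₀ n ω).2.2.2.1‖ ^ 2

theorem excess_nonneg (s : Setting P X g θ Xs Zs a A₀ q C K L) (θ₀ : Vec d) (n : ℕ) (ω : Ω) :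
    0 ≤ s.excess θ₀ n ω := sub_nonneg.2 (s.smooth.min_le _)

theorem sqStep_nonneg (s : Setting P X g θ Xs Zs a A₀ q C K L) (θ₀ : Vec d) (n : ℕ) (ω : Ω) :
    0 ≤ s.sqStep θ₀ n ω := by
  unfold sqStep
  positivity

theorem continuous_gradient (s : Setting P X g θ Xs Zs a A₀ q C K L) :
    Continuous (gradient (objective P X g)) := by
  refine (LipschitzWith.of_dist_le_mul (K := L.toNNReal) fun h k => ?_).continuous
  rw [dist_eq_norm, dist_eq_norm, Real.coe_toNNReal _ s.smooth.L_pos.le]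
  exact s.smooth.lip k h

theorem measurable_excess (s : Setting P X g θ Xs Zs a A₀ q C K L) (θ₀ : Vec d) (n : ℕ) :
    StronglyMeasurable[s.hist n] (s.excess θ₀ n) :=
  (((s.smooth.diff.continuous.measurable.comp measurable_fst).sub_const
    (objective P X g θ)).comp (s.measurable_proc θ₀ n)).stronglyMeasurable

theorem measurable_sqStep (s : Setting P X g θ Xs Zs a A₀ q C K L) (θ₀ : Vec d) (n : ℕ) :
    StronglyMeasurable[s.hist n] (s.sqStep θ₀ n) := ((s.measurable_AAvg θ₀ n).pow 2).const_mul _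

theorem measurable_decrease (s : Setting P X g θ Xs Zs a A₀ q C K L) (θ₀ : Vec d) (n : ℕ) :
    StronglyMeasurable[s.hist n] (s.decrease θ₀ n) := by
  have h1 : Measurable fun t : ChainState d => gradient (objective P X g) t.1 :=
    s.continuous_gradient.measurable.comp measurable_fst
  have h2 : Measurable fun t : ChainState d => t.2.2.2.1 :=
    measurable_fst.comp (measurable_snd.comp (measurable_snd.comp measurable_snd))
  exact (((h1.inner (measurable_mv h2 h1)).const_mul _).comp
    (s.measurable_proc θ₀ n)).stronglyMeasurable

theorem exists_sqStep_le (s : Setting P X g θ Xs Zs a A₀ q C K L) (θ₀ : Vec d) (n : ℕ) :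
    ∃ c, 0 ≤ c ∧ ∀ ω, s.sqStep θ₀ n ω ≤ c := by
  obtain ⟨c, hc0, hc⟩ := s.exists_norm_le θ₀ n
  refine ⟨a.nuSeq (n + 1) ^ 2 * c ^ 2, by positivity, fun ω => ?_⟩
  have := (hc ω).2
  unfold sqStep
  gcongr

theorem integrable_sqStep_mul (s : Setting P X g θ Xs Zs a A₀ q C K L) (θ₀ : Vec d) (n : ℕ)
    (hi : Integrable (s.excess θ₀ n) P) :
    Integrable (fun ω => s.sqStep θ₀ n ω * s.excess θ₀ n ω) P := by
  obtain ⟨c, -, hc⟩ := s.exists_sqStep_le θ₀ n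
  refine hi.bdd_mul (c := c) ((s.measurable_sqStep θ₀ n).mono (s.hist.le n)).aestronglyMeasurable
    (Eventually.of_forall fun ω => ?_)
  rw [Real.norm_of_nonneg (s.sqStep_nonneg θ₀ n ω)]
  exact hc ω

/-- The bound `‖∇G‖² ≤ 4L (G - G(θ))` reduces integrability to that of the excess, since the
averaged matrix is bounded for fixed `n`. -/
theorem integrable_decrease (s : Setting P X g θ Xs Zs a A₀ q C K L) (θ₀ : Vec d) (n : ℕ)
    (hi : Integrable (s.excess θ₀ n) P) : Integrable (s.decrease θ₀ n) P := by
  obtain ⟨c, hc0, hc⟩ := s.exists_norm_le θ₀ n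
  have hν := (Params.nuSeq_pos s.cν_pos (by omega : 1 ≤ n + 1)).le
  refine (hi.const_mul (a.nuSeq (n + 1) * (c * (4 * L)))).mono'
    ((s.measurable_decrease θ₀ n).mono (s.hist.le n)).aestronglyMeasurable
    (Eventually.of_forall fun ω => ?_)
  rw [decrease, norm_mul, Real.norm_of_nonneg hν, mul_assoc]
  refine mul_le_mul_of_nonneg_left ((norm_inner_le_norm _ _).trans ?_) hν
  set v := gradient (objective P X g) (proc g Xs Zs a A₀ θ₀ n ω).1 with hv
  have h1 := norm_mv_le (proc g Xs Zs a A₀ θ₀ n ω).2.2.2.1 v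
  have h2 : ‖v‖ ^ 2 ≤ 4 * L * s.excess θ₀ n ω := s.smooth.norm_gradient_sq_le _
  have h3 := (hc ω).2
  calc ‖v‖ * ‖mv (proc g Xs Zs a A₀ θ₀ n ω).2.2.2.1 v‖ ≤ ‖v‖ * (c * ‖v‖) := by
        gcongr
        exact h1.trans (by gcongr)
    _ = c * ‖v‖ ^ 2 := by ring
    _ ≤ c * (4 * L * s.excess θ₀ n ω) := by gcongr
    _ = _ := by ring

variable [IsProbabilityMeasure P]

theorem integrable_sqStep (s : Setting P X g θ Xs Zs a A₀ q C K L) (θ₀ : Vec d) (n : ℕ) :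
    Integrable (s.sqStep θ₀ n) P := (s.integrable_norm_sq θ₀ n).2.2.const_mul _

/-- The recursive inequality for the excess. -/
theorem excess_step (s : Setting P X g θ Xs Zs a A₀ q C K L) {C₁ : ℝ}
    (hC₁ : ∀ h : Vec d, Integrable (fun ω => ‖gradient (g (X ω)) h‖ ^ 2) P ∧
      ∫ ω, ‖gradient (g (X ω)) h‖ ^ 2 ∂P ≤ C₁ * (1 + objective P X g h - objective P X g θ))
    (θ₀ : Vec d) (n : ℕ) (hi : Integrable (s.excess θ₀ n) P) :
    Integrable (s.excess θ₀ (n + 1)) P ∧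
      P[s.excess θ₀ (n + 1) | s.hist n] ≤ᵐ[P] fun ω =>
        (1 + L * C₁ * s.sqStep θ₀ n ω) * s.excess θ₀ n ω + L * C₁ * s.sqStep θ₀ n ω
          - s.decrease θ₀ n ω := by
  have := s.isProbabilityMeasure_X
  have := s.isProbabilityMeasure_Z
  have hG := s.smooth
  let f : ChainState d → Vec p → ℝ := fun t x =>
    objective P X g (t.1 - a.nuSeq (n + 1) • mv t.2.2.2.1 (gradient (g x) t.1)) - objective P X g θ
  have hf : Measurable fun y : ChainState d × (Vec p × Vec d) => f y.1 y.2.1 := by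
    have h1 : Measurable fun y : ChainState d × (Vec p × Vec d) => (chainStep g a n y.1 y.2).1 :=
      measurable_fst.comp (s.measurable_chainStep n)
    exact (hG.diff.continuous.measurable.comp h1).sub_const _
  have hRi : Integrable (fun ω => (1 + L * C₁ * s.sqStep θ₀ n ω) * s.excess θ₀ n ω
      + L * C₁ * s.sqStep θ₀ n ω - s.decrease θ₀ n ω) P := by
    have e : (fun ω => (1 + L * C₁ * s.sqStep θ₀ n ω) * s.excess θ₀ n ω)
        = fun ω => s.excess θ₀ n ω + L * C₁ * (s.sqStep θ₀ n ω * s.excess θ₀ n ω) := by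
      funext ω
      ring
    have h1 : Integrable (fun ω => (1 + L * C₁ * s.sqStep θ₀ n ω) * s.excess θ₀ n ω) P := by
      rw [e]
      exact hi.add ((s.integrable_sqStep_mul θ₀ n hi).const_mul _)
    exact (h1.add ((s.integrable_sqStep θ₀ n).const_mul _)).sub (s.integrable_decrease θ₀ n hi)
  have hRm : StronglyMeasurable[s.hist n] (fun ω => (1 + L * C₁ * s.sqStep θ₀ n ω)
      * s.excess θ₀ n ω + L * C₁ * s.sqStep θ₀ n ω - s.decrease θ₀ n ω) :=
    (((stronglyMeasurable_const.add ((s.measurable_sqStep θ₀ n).const_mul _)).mul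
      (s.measurable_excess θ₀ n)).add ((s.measurable_sqStep θ₀ n).const_mul _)).sub
      (s.measurable_decrease θ₀ n)
  have h := s.transition θ₀ n (f := fun t y => f t y.1) hf
    (fun _ _ => sub_nonneg.2 (hG.min_le _)) hRi hRm (fun ω => by
      have h1 := integral_objective_step_le s.frame s.A1a hG hC₁ (a.nuSeq (n + 1))
        (proc g Xs Zs a A₀ θ₀ n ω).2.2.2.1 (proc g Xs Zs a A₀ θ₀ n ω).1
      have hfx : Measurable (f (proc g Xs Zs a A₀ θ₀ n ω)) :=
        hf.comp (measurable_const.prodMk (measurable_id.prodMk (measurable_const (a := (0 : Vec d)))))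
      have hfi : Integrable (f (proc g Xs Zs a A₀ θ₀ n ω)) (P.map X) :=
        (integrable_map_measure hfx.aestronglyMeasurable s.frame.measurable_X.aemeasurable).2 h1.1
      refine ⟨hfi.comp_fst _, ?_⟩
      rw [integral_fun_fst (f (proc g Xs Zs a A₀ θ₀ n ω)), probReal_univ, one_smul,
        integral_map s.frame.measurable_X.aemeasurable hfx.aestronglyMeasurable]
      exact h1.2)
  exact ⟨h.1, h.2.1⟩

theorem ae_eventually_decrease_ge (s : Setting P X g θ Xs Zs a A₀ q C K L) (θ₀ : Vec d) :
    ∀ᵐ ω ∂P, ∃ c, 0 < c ∧ ∀ᶠ n in atTop, a.nuSeq (n + 1) / a.betaSeq n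
      * (c * ‖gradient (objective P X g) (proc g Xs Zs a A₀ θ₀ n ω).1‖ ^ 2)
        ≤ s.decrease θ₀ n ω := by
  filter_upwards [s.ae_exists_AAvg_ge θ₀] with ω ⟨c, hc, h⟩
  refine ⟨c, hc, h.mono fun n hn => ?_⟩
  have h1 := hn (gradient (objective P X g) (proc g Xs Zs a A₀ θ₀ n ω).1).ofLp
  rw [← norm_sq_eq_dotProduct] at h1
  have hν := (Params.nuSeq_pos s.cν_pos (by omega : 1 ≤ n + 1)).le
  rw [decrease, inner_eq_dotProduct]
  refine le_trans (le_of_eq ?_) (mul_le_mul_of_nonneg_left h1 hν)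
  ring

/-- Almost sure convergence of the excess, and summability of the positive part of the
decrease. -/
theorem ae_tendsto_excess (s : Setting P X g θ Xs Zs a A₀ q C K L) (θ₀ : Vec d) :
    ∀ᵐ ω ∂P, (∃ l, Tendsto (fun n => s.excess θ₀ n ω) atTop (𝓝 l)) ∧
      Summable fun n => max (s.decrease θ₀ n ω) 0 := by
  obtain ⟨C₁, hC₁0, hC₁⟩ := s.A1a
  have hi : ∀ n, Integrable (s.excess θ₀ n) P := by
    intro n
    induction n with
    | zero => exact integrable_const (objective P X g θ₀ - objective P X g θ)
    | succ n ih => exact (s.excess_step hC₁ θ₀ n ih).1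
  have hLC : 0 ≤ L * C₁ := mul_nonneg s.smooth.L_pos.le hC₁0.le
  have ha0 : ∀ n ω, 0 ≤ L * C₁ * s.sqStep θ₀ n ω := fun n ω => mul_nonneg hLC (s.sqStep_nonneg θ₀ n ω)
  have hsq : ∀ᵐ ω ∂P, Summable fun n => L * C₁ * s.sqStep θ₀ n ω := by
    filter_upwards [s.ae_summable_nuSeq_sq_mul_AAvg_sq θ₀] with ω hω using hω.mul_left _
  refine ae_tendsto_of_condExp_le (P := P) (F := s.hist) (V := s.excess θ₀)
    (a := fun n ω => L * C₁ * s.sqStep θ₀ n ω)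
    -- The averaged matrix is positive only eventually, from a random index on, so the decrease may
    -- be negative at first. Its negative part joins the perturbation, where it is summable because
    -- almost surely only finitely many terms are nonzero.
    (b := fun n ω => L * C₁ * s.sqStep θ₀ n ω + max (-s.decrease θ₀ n ω) 0)
    (c := fun n ω => max (s.decrease θ₀ n ω) 0)
    (s.excess_nonneg θ₀) ha0 (fun n ω => add_nonneg (ha0 n ω) (le_max_right _ _))
    (fun n ω => le_max_right _ _) (s.measurable_excess θ₀)
    (fun n => (s.measurable_sqStep θ₀ n).const_mul _)
    (fun n => ((s.measurable_sqStep θ₀ n).const_mul _).add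
      (StronglyMeasurable.max_zero (s.measurable_decrease θ₀ n).neg))
    (fun n => StronglyMeasurable.max_zero (s.measurable_decrease θ₀ n)) hi
    (fun n => ((s.integrable_sqStep θ₀ n).const_mul _).add
      (s.integrable_decrease θ₀ n (hi n)).neg.pos_part)
    (fun n => (s.integrable_decrease θ₀ n (hi n)).pos_part) (fun n => ?_) hsq ?_
  · filter_upwards [(s.excess_step hC₁ θ₀ n (hi n)).2] with ω hω
    refine hω.trans (le_of_eq ?_)
    rcases le_total 0 (s.decrease θ₀ n ω) with h | h
    · rw [max_eq_left h, max_eq_right (by linarith)]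
      ring
    · rw [max_eq_right h, max_eq_left (by linarith)]
      ring
  · filter_upwards [hsq, s.ae_eventually_decrease_ge θ₀] with ω h1 ⟨c, hc, h2⟩
    refine h1.add (summable_of_hasFiniteSupport ?_)
    obtain ⟨N, hN⟩ := eventually_atTop.1 h2
    refine (Set.finite_lt_nat (max N 1)).subset fun n hn => ?_
    by_contra hcon
    have hnN : max N 1 ≤ n := not_lt.1 hcon
    have h3 := hN n ((le_max_left _ _).trans hnN)
    have h4 : 0 ≤ s.decrease θ₀ n ω := by
      refine le_trans ?_ h3
      have := Params.nuSeq_pos s.cν_pos (by omega : 1 ≤ n + 1)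
      have := Params.betaSeq_pos s.cβ_pos ((le_max_right _ _).trans hnN)
      positivity
    exact hn (max_eq_right (by linarith))

/-- If the gradients stayed above some `ε`, summability of the decrease would make `ν_{n+1} / β_n`
summable, which `ν + β < 1` forbids. -/
theorem ae_tendsto_theta (s : Setting P X g θ Xs Zs a A₀ q C K L) (θ₀ : Vec d) :
    ∀ᵐ ω ∂P, Tendsto (fun n => (proc g Xs Zs a A₀ θ₀ n ω).1) atTop (𝓝 θ) := by
  filter_upwards [s.ae_tendsto_excess θ₀, s.ae_eventually_decrease_ge θ₀] with ω h1 ⟨c, hc, h2⟩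
  obtain ⟨⟨l, hl⟩, hs⟩ := h1
  refine s.smooth.tendsto_of_frequently hl fun ε hε => ?_
  by_contra hcon
  rw [not_frequently] at hcon
  refine Params.not_summable_nuSeq_div_betaSeq (a := a) s.cν_pos s.cβ_pos s.β_pos.le
    (by linarith [s.ν_lt]) ?_
  refine (hs.mul_left (c * ε ^ 2)⁻¹).of_norm_bounded_eventually_nat ?_
  filter_upwards [h2, hcon, eventually_ge_atTop 1] with n hn1 hn2 hn3
  have hν := Params.nuSeq_pos s.cν_pos (by omega : 1 ≤ n + 1)
  have hβ := Params.betaSeq_pos s.cβ_pos hn3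
  have hcε : 0 < c * ε ^ 2 := by positivity
  rw [Real.norm_of_nonneg (by positivity), inv_mul_eq_div, le_div_iff₀ hcε]
  have h3 := not_lt.1 hn2
  calc _ ≤ a.nuSeq (n + 1) / a.betaSeq n
        * (c * ‖gradient (objective P X g) (proc g Xs Zs a A₀ θ₀ n ω).1‖ ^ 2) := by gcongr
    _ ≤ s.decrease θ₀ n ω := hn1
    _ ≤ _ := le_max_left _ _

end Setting

/-- The Hessian of the loss at a point and one of the vectors `Z` form a `HessianLaw`. -/
theorem hessianLaw_of_moment {Ω : Type*} [MeasurableSpace Ω] {P : Measure Ω}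
    {p d : ℕ} {g : Vec p → Vec d → ℝ} {X : Ω → Vec p} {θ : Vec d}
    (hframe : Framework P X g θ) {q : ℝ} (hq : 2 < q)
    {Xs : ℕ → Ω → Vec p} {Zs : ℕ → Ω → Vec d} (hsample : IsSample P X Xs Zs)
    {C M : ℝ} {h : Vec d} (hint : Integrable (fun ω => ‖hessianMatrix (g (X ω)) h‖ ^ q) P)
    (hC : ∫ ω, ‖hessianMatrix (g (X ω)) h‖ ^ q ∂P ≤ C) (hM : ∀ᵐ ω ∂P, ‖Zs 0 ω‖ ≤ M) :
    HessianLaw (P.map X) (P.map (Zs 0)) (fun x => hessianMatrix (g x) h) q C (max M 1) := by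
  have hXm := hframe.measurable_X.aemeasurable (μ := P)
  have hZm := (hsample.measurable_Z 0).aemeasurable (μ := P)
  have hy : Measurable fun x : Vec p => (x, h) := measurable_id.prodMk measurable_const
  have hH : Measurable fun x => hessianMatrix (g x) h :=
    measurable_matrix_iff.2 fun i j => by
      have := (hframe.measurable_hessian i j).comp hy
      simpa only [Function.comp_def] using this
  have hpow : Measurable fun x => ‖hessianMatrix (g x) h‖ ^ q :=
    (measurable_frobenius_norm hH).pow_const q
  refine
    { two_lt := hq, one_le := le_max_right _ _, meas := hH, int := ?_, le := ?_, psd := fun v => ?_,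
      bdd := ?_, cov := fun i j => ?_ }
  · exact (integrable_map_measure hpow.aestronglyMeasurable hXm).2 hint
  · rw [integral_map hXm hpow.aestronglyMeasurable]
    exact hC
  · have hv : Measurable fun x => v ⬝ᵥ (hessianMatrix (g x) h).mulVec v :=
      measurable_dotProduct (u := fun _ => WithLp.toLp 2 v) measurable_const
        (measurable_mv (v := fun _ => WithLp.toLp 2 v) hH measurable_const)
    rw [ae_map_iff hXm (measurableSet_le measurable_const hv)]
    filter_upwards [hframe.convex, hframe.twiceDifferentiable h] with ω h1 h2
    exact h1.hessianMatrix_nonneg h2 v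
  · rw [ae_map_iff hZm (measurableSet_le measurable_norm measurable_const)]
    filter_upwards [hM] with ω hω using hω.trans (le_max_left _ _)
  · have hz : Measurable fun z : Vec d => z.ofLp i * z.ofLp j :=
      (measurable_coord measurable_id i).mul (measurable_coord measurable_id j)
    rw [integral_map hZm hz.aestronglyMeasurable]
    exact hsample.cov_Z 0 i j

/-- The assumptions of the theorem provide a `Setting`. -/
theorem exists_setting {Ω : Type*} [MeasurableSpace Ω] {P : Measure Ω} [IsProbabilityMeasure P]
    {p d : ℕ} {g : Vec p → Vec d → ℝ} {X : Ω → Vec p} {θ : Vec d}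
    (hframe : Framework P X g θ) (hA1a : AssumptionA1a P X g θ) (hA2 : AssumptionA2 P X g θ)
    {q : ℝ} (hq : 2 < q) (hA4 : AssumptionA4 P X g q)
    {Xs : ℕ → Ω → Vec p} {Zs : ℕ → Ω → Vec d} (hsample : IsSample P X Xs Zs) {a : Params}
    (hcγ : 0 < a.cγ) (hcβ : 0 < a.cβ) (hcβ' : 0 < a.cβ') (hcν : 0 < a.cν)
    (hγ : a.γ ∈ Set.Ioo (1 / 2 : ℝ) 1)
    (hβ : a.β ∈ Set.Ioo ((1 - a.γ) / (q - 1)) (a.γ - 1 / 2))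
    (hγν : 3 / 2 < a.γ + a.ν) (hν : a.ν < 1 - a.β) (hβ' : 0 < a.β')
    (htrunc : ∀ n : ℕ, 1 ≤ n →
      a.gammaSeq n ^ 2 * a.betaSeq n ^ 2 * a.betaSeq' n ≤ a.gammaSeq n)
    (hτ : 0 ≤ a.τ) {A₀ : Mat d} (hA₀ : A₀.IsSymm) :
    ∃ C K L, Setting P X g θ Xs Zs a A₀ q C K L := by
  obtain ⟨C, hC⟩ := hA4
  obtain ⟨M, hM⟩ := hsample.bounded_Z
  obtain ⟨L, hL⟩ := exists_smoothConvex_objective hframe hA2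
  exact ⟨C, max M 1, L,
    { frame := hframe
      A1a := hA1a
      smooth := hL
      sample := hsample
      hess := fun h => hessianLaw_of_moment hframe hq hsample (hC h).1 (hC h).2 (hM 0)
      cγ_pos := hcγ
      cβ_pos := hcβ
      cβ'_pos := hcβ'
      cν_pos := hcν
      lt_γ := hγ.1
      γ_lt := hγ.2
      lt_β := hβ.1
      β_lt := hβ.2
      γν := hγν
      ν_lt := hν
      β'_pos := hβ'
      trunc := htrunc
      τ_nonneg := hτ
      symm := hA₀ }⟩

end USN
end

theorem theorem4p1 {Ω : Type*} [MeasurableSpace Ω] (P : Measure Ω) [IsProbabilityMeasure P]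
    {p d : ℕ} (g : USN.Vec p → USN.Vec d → ℝ) (X : Ω → USN.Vec p) (θ : USN.Vec d)
    (hframe : USN.Framework P X g θ)
    (hA1a : USN.AssumptionA1a P X g θ)
    (hA2 : USN.AssumptionA2 P X g θ)
    (hA3 : USN.AssumptionA3 P X g θ)
    (q : ℝ) (hq : 2 < q) (hA4 : USN.AssumptionA4 P X g q)
    (Xs : ℕ → Ω → USN.Vec p) (Zs : ℕ → Ω → USN.Vec d) (hsample : USN.IsSample P X Xs Zs)
    (a : USN.Params)
    (hcγ : 0 < a.cγ) (hcβ : 0 < a.cβ) (hcβ' : 0 < a.cβ') (hcν : 0 < a.cν)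
    (hγ : a.γ ∈ Set.Ioo (1 / 2 : ℝ) 1)
    (hβ : a.β ∈ Set.Ioo ((1 - a.γ) / (q - 1)) (a.γ - 1 / 2))
    (hγν : 3 / 2 < a.γ + a.ν)
    (hν : a.ν ∈ Set.Ioo (1 / 2 : ℝ) (1 - a.β))
    (hβ' : a.β' ∈ Set.Ioo (1 - a.γ) (a.γ - 2 * a.β))
    (htrunc : ∀ n : ℕ, 1 ≤ n →
      a.gammaSeq n ^ 2 * a.betaSeq n ^ 2 * a.betaSeq' n ≤ a.gammaSeq n)
    (hτ : 0 ≤ a.τ) (hτ' : 0 ≤ a.τ')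
    (θ₀ : USN.Vec d) (A₀ : USN.Mat d) (hA₀ : A₀.PosDef) :
    (∀ᵐ ω ∂P, Tendsto
      (fun n => (USN.iterate g a θ₀ A₀ (fun k => Xs k ω) (fun k => Zs k ω) n).theta)
      atTop (𝓝 θ)) ∧
    (∀ᵐ ω ∂P, Tendsto
      (fun n => (USN.iterate g a θ₀ A₀ (fun k => Xs k ω) (fun k => Zs k ω) n).thetaAvg)
      atTop (𝓝 θ)) := by
  have hsymm : A₀.IsSymm := by
    have := hA₀.isHermitian
    rwa [Matrix.IsHermitian, Matrix.conjTranspose_eq_transpose_of_trivial] at this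
  obtain ⟨C, K, L, s⟩ := USN.exists_setting hframe hA1a hA2 hq hA4 hsample hcγ hcβ hcβ' hcν hγ hβ
    hγν hν.2 (lt_trans (by linarith [hγ.2]) hβ'.1) htrunc hτ hsymm
  have key : ∀ᵐ ω ∂P, Tendsto
      (fun n => (USN.iterate g a θ₀ A₀ (fun k => Xs k ω) (fun k => Zs k ω) n).theta)
      atTop (𝓝 θ) := by
    filter_upwards [s.ae_tendsto_theta θ₀] with ω hω
    exact hω.congr fun n => (USN.chain_eq_iterate g a θ₀ A₀ _ _ n).1
  refine ⟨key, ?_⟩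
  filter_upwards [key] with ω hω
  exact USN.tendsto_avg
    (u := fun n => (USN.iterate g a θ₀ A₀ (fun k => Xs k ω) (fun k => Zs k ω) n).theta)
    (v := fun n => (USN.iterate g a θ₀ A₀ (fun k => Xs k ω) (fun k => Zs k ω) n).thetaAvg)
    hτ' rfl (fun n => rfl) hω
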